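/- Work over $\mathbb C$. Let $X=(F=0)\subset\mathbb P^3$ be a smooth quartic surface containing no line, and let $\mathbb G=\mathbb G(2,4)$ be the Grassmannian of lines in $\mathbb P^3$. A line $l\subset\mathbb P^3$ is called bitangent to $X$ if $l\not\subset X$ and the scheme $X|_l=X\cap l$ is non-reduced at each of its points. The scheme of bitangents $S\subset\mathbb G$ is the closed subscheme with the following universal property: for every $\mathbb C$-algebra $A$, a family of lines $\operatorname{Spec}A\to\mathbb G$, given by a locally free rank-two subbundle $L\subset A^4$ with locally free quotient, factors through $S$ if and only if no line of the family is contained in $X$ and, locally on $\operatorname{Spec}A$, $F|_L=c\,q^2$ for a unit $c$ and a quadratic form $q$ on $L$. Then $S$ exists, its $\mathbb C$-points are exactly the lines bitangent to $X$, and $S$ is a smooth surface: it is non-empty and smooth over $\mathbb C$ of pure dimension $2$. -/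

import Mathlib

open CategoryTheory AlgebraicGeometry Opposite
open scoped TensorProduct

namespace QuarticBitangents

noncomputable section

/-- `F` is the equation of a smooth quartic surface `X = (F = 0)` in `ℙ³` (over `ℂ`): a quartic form
whose partial derivatives do not all vanish at any point of `X`. -/
structure IsSmoothQuartic (F : MvPolynomial (Fin 4) ℂ) : Prop where
  isHomogeneous : F.IsHomogeneous 4
  jacobian : ∀ v : Fin 4 → ℂ, v ≠ 0 → MvPolynomial.eval v F = 0 →
    ∃ i, MvPolynomial.eval v (MvPolynomial.pderiv i F) ≠ 0

/-- The surface `(F = 0)` contains no line of `ℙ³`, a line being the projectivisation of a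
two-dimensional subspace of `ℂ⁴`. -/
def ContainsNoLine (F : MvPolynomial (Fin 4) ℂ) : Prop :=
  ∀ L : Submodule ℂ (Fin 4 → ℂ), Module.finrank ℂ L = 2 → ∃ v ∈ L, MvPolynomial.eval v F ≠ 0

/-- The line `ℙ(L)` is bitangent to `X = (F = 0)`: it is not contained in `X` (in which case
`X|_l = l` would be reduced), and the scheme `X|_l` is non-reduced at each of its points, i.e. the
restriction of `F` to `L` vanishes to order at least two at each of its zeros: the derivative of `F`
at such a zero `v`, in every direction `w` of `L`, is zero. -/
def IsBitangentLine (F : MvPolynomial (Fin 4) ℂ) (L : Submodule ℂ (Fin 4 → ℂ)) : Prop :=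
  (∃ v ∈ L, MvPolynomial.eval v F ≠ 0) ∧
    ∀ v ∈ L, v ≠ 0 → MvPolynomial.eval v F = 0 →
      ∀ w ∈ L, ∑ i, w i * MvPolynomial.eval v (MvPolynomial.pderiv i F) = 0

/-- The functor of points of the Grassmannian of lines in `ℙ³`: a `ℂ`-algebra `A` is sent to the set
of submodules of `A ⊗ ℂ⁴` whose quotient is locally free of rank `4 - 2 = 2`, that is, the families
of lines of `ℙ³` over `Spec A`. -/
abbrev linesFunctor : CommAlgCat.{0} ℂ ⥤ Type :=
  Module.Grassmannian.functor (R := ℂ) (M := Fin 4 → ℂ) 2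

/-- The functor of points, on `ℂ`-algebras, of a scheme over `ℂ`. -/
abbrev pointsFunctor (Y : Over (Spec (CommRingCat.of ℂ))) : CommAlgCat.{0} ℂ ⥤ Type :=
  (algSpec (CommRingCat.of ℂ)).rightOp ⋙ yoneda.obj Y

/-- A family of lines over `A`, as a submodule of `A⁴` (through `A ⊗ ℂ⁴ ≃ A⁴`). -/
def lineInCoordinates {A : CommAlgCat.{0} ℂ} (N : linesFunctor.obj A) :
    Submodule A (Fin 4 → A) :=
  (Module.Grassmannian.toSubmodule (R := A) (M := A ⊗[ℂ] (Fin 4 → ℂ)) (k := 2) N).map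
    (TensorProduct.piScalarRight ℂ A A (Fin 4)).toLinearMap

/-- The stalk `L_p ⊆ A_p⁴` of a submodule `L ⊆ A⁴` at a prime `p`. -/
def stalkAt {A : Type} [CommRing A] (L : Submodule A (Fin 4 → A)) (p : Ideal A) [p.IsPrime] :
    Submodule (Localization.AtPrime p) (Fin 4 → Localization.AtPrime p) :=
  Submodule.span _ ((fun (v : Fin 4 → A) i => algebraMap A (Localization.AtPrime p) (v i)) '' L)

/-- A family of lines, given by `L ⊆ A⁴`, is a family of bitangents to `(F = 0)`: locally on
`Spec A`, the restriction of `F` to the family is a unit times the square of a quadratic form, and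
it does not vanish identically on any line of the family. (As `A` is a `ℚ`-algebra, forms on the
locally free module `L` are determined by their values.) -/
def IsBitangentFamily (F : MvPolynomial (Fin 4) ℂ) {A : Type} [CommRing A] [Algebra ℂ A]
    (L : Submodule A (Fin 4 → A)) : Prop :=
  ∀ (p : Ideal A) [p.IsPrime],
    (∃ v ∈ stalkAt L p, IsUnit (MvPolynomial.aeval v F)) ∧
    ∃ (c : (Localization.AtPrime p)ˣ) (Q : QuadraticForm (Localization.AtPrime p) (stalkAt L p)),
      ∀ v : stalkAt L p, MvPolynomial.aeval (v : Fin 4 → Localization.AtPrime p) F = c * Q v ^ 2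

/-- `G`, with the identification `e` of its functor of points, is the Grassmannian `𝔾(2,4)` of lines
of `ℙ³`, and `ι : S ⟶ G` is the closed subscheme parametrising the bitangents to `(F = 0)`:
a family of lines `Spec A ⟶ G` factors through `S` if and only if it is a family of bitangents. -/
structure IsBitangentScheme (F : MvPolynomial (Fin 4) ℂ) {G : Over (Spec (CommRingCat.of ℂ))}
    (e : pointsFunctor G ≅ linesFunctor) {S : Over (Spec (CommRingCat.of ℂ))} (ι : S ⟶ G) :
    Prop where
  isClosedImmersion : IsClosedImmersion ι.left
  factors_iff : ∀ (A : CommAlgCat.{0} ℂ) (x : (algSpec (CommRingCat.of ℂ)).obj (op A) ⟶ G),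
    (∃ y : (algSpec (CommRingCat.of ℂ)).obj (op A) ⟶ S, y ≫ ι = x) ↔
      IsBitangentFamily F (lineInCoordinates (e.hom.app A x))

end

end QuarticBitangents

/-! The Grassmannian is covered by affine four-spaces: a line close to a given one is the graph of a
2 × 2 matrix. Gluing these charts (`AffineAtlas`, `linesAtlas`) yields a scheme representing
`linesFunctor`.

On a chart, the restriction of F to the line is a binary quartic with coefficients a₄, …, a₀. No
line lies on X, so over a local ring some aᵢ is a unit, and by interpolation F takes a unit value at
one of five fixed points of the line; taking that point as the point at infinity makes a₄ a unit
(`exists_chartIndex`). Completing the square then computes a candidate root from a₃ and a₂, and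
leaves two equations, `squareEqn`, which hold if and only if F|_L is a unit times the square of a
quadratic form (`ChartIndex.exists_quadraticForm_iff`). This criterion does not depend on the chart.
Hence the scheme-theoretic image S of the disjoint union of these loci restricts to the expected
locus on each chart (`factors_iff_eqn`), and the universal property follows because factoring
through a closed subscheme can be tested at the local rings of A.

Smoothness is a Jacobian criterion. Let F|_l = c q². Deforming l changes F|_l by λ₀∂₀F + λ₁∂₁F,
where the λⱼ are arbitrary linear forms on l and ∂₀, ∂₁ are transverse derivatives. The differential
of the two equations reads this variation modulo q (`squareEqnDeriv_of_square`). At a zero of q the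
derivatives of F along l vanish, so ∂₀F and ∂₁F cannot both vanish there, X being smooth
(`ChartIndex.span_eq_top`). As linear forms attain every residue modulo q, the differential has rank
two (`ChartIndex.exists_sum_eq`), and S is smooth of dimension 4 - 2.

Over ℂ, a quartic polynomial with only multiple roots is a constant times a square, which identifies
the points of S. For non-emptiness, take p in X and the pencil of lines through p in the tangent
plane. The residual intersection of such a line with X is a binary quadric whose discriminant is a
form of degree 6 in the direction, so it vanishes for some line (`exists_isBitangentLine`). -/

namespace AlgebraicGeometry

/-! ### Gluing a scheme from the affine charts of a functor of points. -/

open Limits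

/-- The ring map `R ⟶ Γ(T, ⊤)` of a morphism from a scheme `T` to `Spec R`. -/
noncomputable def comorph {T : Scheme.{0}} {R : CommRingCat.{0}} (a : T ⟶ Spec R) : R ⟶ Γ(T, ⊤) :=
  (Scheme.ΓSpecIso R).inv ≫ a.appTop

theorem comorph_comp {T T' : Scheme.{0}} {R : CommRingCat.{0}} (b : T' ⟶ T) (a : T ⟶ Spec R) :
    comorph (b ≫ a) = comorph a ≫ b.appTop := by
  simp [comorph]

theorem comorph_comp_specMap {T : Scheme.{0}} {R S : CommRingCat.{0}} (a : T ⟶ Spec S)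
    (f : R ⟶ S) : comorph (a ≫ Spec.map f) = f ≫ comorph a := by
  rw [comorph, comorph, Scheme.ΓSpecIso_inv_naturality_assoc, Scheme.Hom.comp_appTop]

theorem toSpecΓ_comp_comorph {T : Scheme.{0}} {R : CommRingCat.{0}} (a : T ⟶ Spec R) :
    T.toSpecΓ ≫ Spec.map (comorph a) = a := by
  rw [comorph, Spec.map_comp, ← Scheme.toSpecΓ_naturality_assoc,
    toSpecΓ_SpecMap_ΓSpecIso_inv, Category.comp_id]

theorem comorph_injective {T : Scheme.{0}} {R : CommRingCat.{0}} {a a' : T ⟶ Spec R}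
    (h : comorph a = comorph a') : a = a' := by
  rw [← toSpecΓ_comp_comorph a, h, toSpecΓ_comp_comorph]

theorem comorph_specMap {R S : CommRingCat.{0}} (f : R ⟶ S) :
    comorph (Spec.map f) = f ≫ (Scheme.ΓSpecIso S).inv := by
  rw [comorph, Scheme.ΓSpecIso_inv_naturality]

/-- A functor of points on commutative rings which is a sheaf for the Zariski topology and is
covered by affine charts: the chart `Spec (R j)` carries the point `u j`, the overlap of the charts
`i` and `j` being the principal open subset of `Spec (R i)` where `d i j` is invertible. -/
structure AffineAtlas where
  pt : CommRingCat.{0} → Type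
  map : ∀ {A B : CommRingCat.{0}}, (A ⟶ B) → pt A → pt B
  map_id : ∀ {A : CommRingCat.{0}} (x : pt A), map (𝟙 A) x = x
  map_comp : ∀ {A B C : CommRingCat.{0}} (f : A ⟶ B) (g : B ⟶ C) (x : pt A),
    map (f ≫ g) x = map g (map f x)
  J : Type
  R : J → CommRingCat.{0}
  u : ∀ j, pt (R j)
  u_inj : ∀ (j : J) {B : CommRingCat.{0}} (ψ ψ' : R j ⟶ B), map ψ (u j) = map ψ' (u j) → ψ = ψ'
  d : ∀ i : J, J → R i
  isUnit_iff : ∀ (i j : J) {B : CommRingCat.{0}} (ψ : R i ⟶ B),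
    IsUnit (ψ (d i j)) ↔ ∃ χ : R j ⟶ B, map χ (u j) = map ψ (u i)
  locally_chart : ∀ {A : CommRingCat.{0}} (N : pt A), Ideal.span {f : A | ∃ (j : J)
    (ψ : R j ⟶ CommRingCat.of (Localization.Away f)),
    map ψ (u j) = map (CommRingCat.ofHom (algebraMap A (Localization.Away f))) N} = ⊤
  separated : ∀ {A : CommRingCat.{0}} {ι : Type} [Finite ι] (f : ι → A)
    (_ : Ideal.span (Set.range f) = ⊤) (N N' : pt A)
    (_ : ∀ k, map (CommRingCat.ofHom (algebraMap A (Localization.Away (f k)))) N =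
      map (CommRingCat.ofHom (algebraMap A (Localization.Away (f k)))) N'), N = N'
  glue : ∀ {A : CommRingCat.{0}} {ι : Type} [Finite ι] (f : ι → A)
    (_ : Ideal.span (Set.range f) = ⊤) (N : ∀ k, pt (CommRingCat.of (Localization.Away (f k))))
    (_ : ∀ (k l : ι) {B : CommRingCat.{0}} (φ : CommRingCat.of (Localization.Away (f k)) ⟶ B)
      (φ' : CommRingCat.of (Localization.Away (f l)) ⟶ B),
      CommRingCat.ofHom (algebraMap A (Localization.Away (f k))) ≫ φ =
        CommRingCat.ofHom (algebraMap A (Localization.Away (f l))) ≫ φ' →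
      map φ (N k) = map φ' (N l)),
    ∃ M : pt A, ∀ k, map (CommRingCat.ofHom (algebraMap A (Localization.Away (f k)))) M = N k

namespace AffineAtlas

variable (H : AffineAtlas)

/-- The point over `Γ(T, ⊤)` given by a morphism from `T` to a chart. -/
noncomputable def el {T : Scheme.{0}} {j : H.J} (a : T ⟶ Spec (H.R j)) : H.pt Γ(T, ⊤) :=
  H.map (comorph a) (H.u j)

theorem el_comp {T T' : Scheme.{0}} {j : H.J} (b : T' ⟶ T) (a : T ⟶ Spec (H.R j)) :
    H.el (b ≫ a) = H.map b.appTop (H.el a) := by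
  rw [el, el, comorph_comp, H.map_comp]

theorem el_injective {T : Scheme.{0}} {j : H.J} {a a' : T ⟶ Spec (H.R j)}
    (h : H.el a = H.el a') : a = a' :=
  comorph_injective (H.u_inj j _ _ h)

theorem el_comp_specMap {T : Scheme.{0}} {B : CommRingCat.{0}} {j : H.J} (a : T ⟶ Spec B)
    (ψ : H.R j ⟶ B) : H.el (a ≫ Spec.map ψ) = H.map (comorph a) (H.map ψ (H.u j)) := by
  rw [el, comorph_comp_specMap, H.map_comp]

theorem el_specMap {B : CommRingCat.{0}} {j : H.J} (ψ : H.R j ⟶ B) :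
    H.el (Spec.map ψ) = H.map (Scheme.ΓSpecIso B).inv (H.map ψ (H.u j)) := by
  rw [el, comorph_specMap, H.map_comp]

theorem map_iso_injective {A B : CommRingCat.{0}} (e : A ≅ B) {x y : H.pt A}
    (h : H.map e.hom x = H.map e.hom y) : x = y := by
  have := congrArg (H.map e.inv) h
  rwa [← H.map_comp, ← H.map_comp, e.hom_inv_id, H.map_id, H.map_id] at this

theorem el_specMap_eq_iff {B : CommRingCat.{0}} {i j : H.J} (ψ : H.R i ⟶ B) (χ : H.R j ⟶ B) :
    H.el (Spec.map ψ) = H.el (Spec.map χ) ↔ H.map ψ (H.u i) = H.map χ (H.u j) := by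
  rw [el_specMap, el_specMap]
  exact ⟨fun h ↦ H.map_iso_injective (Scheme.ΓSpecIso B).symm h, fun h ↦ by rw [h]⟩

/-- The overlap of the charts `i` and `j`, as a scheme. -/
noncomputable abbrev overlap (i j : H.J) : Scheme.{0} :=
  Spec (CommRingCat.of (Localization.Away (H.d i j)))

/-- The inclusion of the overlap of the charts `i` and `j` in the chart `i`. -/
noncomputable abbrev incl (i j : H.J) : H.overlap i j ⟶ Spec (H.R i) :=
  Spec.map (CommRingCat.ofHom (algebraMap (H.R i) (Localization.Away (H.d i j))))

/-- The morphism `a'` to the chart `j` carries the same point as `a`, so by `isUnit_iff` it forces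
`d i j` to become invertible along `a`. -/
theorem exists_lift {T : Scheme.{0}} {i j : H.J} (a : T ⟶ Spec (H.R i)) (a' : T ⟶ Spec (H.R j))
    (h : H.el a = H.el a') : ∃ b : T ⟶ H.overlap i j, b ≫ H.incl i j = a := by
  have hu : IsUnit (comorph a (H.d i j)) := (H.isUnit_iff i j _).mpr ⟨comorph a', h.symm⟩
  refine ⟨T.toSpecΓ ≫ Spec.map (CommRingCat.ofHom
    (IsLocalization.Away.lift (S := Localization.Away (H.d i j)) (H.d i j)
      (g := (comorph a).hom) hu)), ?_⟩
  rw [Category.assoc, ← Spec.map_comp, ← CommRingCat.ofHom_comp, IsLocalization.Away.lift_comp,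
    CommRingCat.ofHom_hom, toSpecΓ_comp_comorph]

theorem exists_other (i j : H.J) :
    ∃ g : H.overlap i j ⟶ Spec (H.R j), H.el g = H.el (H.incl i j) := by
  obtain ⟨χ, hχ⟩ := (H.isUnit_iff i j (CommRingCat.ofHom
    (algebraMap (H.R i) (Localization.Away (H.d i j))))).mp
    (IsLocalization.Away.algebraMap_isUnit (H.d i j))
  exact ⟨Spec.map χ, (H.el_specMap_eq_iff _ _).mpr hχ⟩

/-- The map of the overlap of the charts `i` and `j` to the chart `j`. -/
noncomputable def other (i j : H.J) : H.overlap i j ⟶ Spec (H.R j) := (H.exists_other i j).choose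

theorem el_other (i j : H.J) : H.el (H.other i j) = H.el (H.incl i j) :=
  (H.exists_other i j).choose_spec

/-- The transition map between two overlaps. -/
noncomputable def trans (i j : H.J) : H.overlap i j ⟶ H.overlap j i :=
  (H.exists_lift (H.other i j) (H.incl i j) (H.el_other i j)).choose

theorem trans_incl (i j : H.J) : H.trans i j ≫ H.incl j i = H.other i j :=
  (H.exists_lift (H.other i j) (H.incl i j) (H.el_other i j)).choose_spec

instance (i j : H.J) : IsOpenImmersion (H.incl i j) :=
  IsOpenImmersion.of_isLocalization (H.d i j)

/-- On the triple overlap the maps to the charts `j` and `k` both carry the point restricted from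
the chart `i`; by `exists_lift` they define a map to the overlap of `j` and `k`. -/
theorem exists_trans₃ (i j k : H.J) :
    ∃ t : pullback (H.incl i j) (H.incl i k) ⟶ pullback (H.incl j k) (H.incl j i),
      t ≫ pullback.snd _ _ = pullback.fst _ _ ≫ H.trans i j := by
  have h : H.el (pullback.fst (H.incl i j) (H.incl i k) ≫ H.other i j) =
      H.el (pullback.snd (H.incl i j) (H.incl i k) ≫ H.other i k) := by
    rw [el_comp, el_comp, el_other, el_other, ← el_comp, ← el_comp, pullback.condition]
  obtain ⟨b, hb⟩ := H.exists_lift _ _ h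
  exact ⟨pullback.lift b (pullback.fst _ _ ≫ H.trans i j)
    (by rw [hb, Category.assoc, trans_incl]), pullback.lift_snd _ _ _⟩

/-- The transition map between triple overlaps. -/
noncomputable def trans₃ (i j k : H.J) :
    pullback (H.incl i j) (H.incl i k) ⟶ pullback (H.incl j k) (H.incl j i) :=
  (H.exists_trans₃ i j k).choose

theorem trans₃_snd (i j k : H.J) :
    H.trans₃ i j k ≫ pullback.snd _ _ = pullback.fst _ _ ≫ H.trans i j :=
  (H.exists_trans₃ i j k).choose_spec

theorem el_trans₃ (i j k : H.J) :
    H.el (H.trans₃ i j k ≫ pullback.fst _ _ ≫ H.incl j k) =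
      H.el (pullback.fst (H.incl i j) (H.incl i k) ≫ H.incl i j) := by
  rw [pullback.condition, ← Category.assoc, trans₃_snd, Category.assoc, trans_incl, el_comp,
    el_other, ← el_comp]

/-- The gluing data of an atlas. -/
noncomputable def glueData : Scheme.GlueData.{0} where
  J := H.J
  U i := Spec (H.R i)
  V p := H.overlap p.1 p.2
  f i j := H.incl i j
  f_mono i j := inferInstance
  f_id i := by
    have hu : IsUnit (H.d i i) := (H.isUnit_iff i i (𝟙 _)).mpr ⟨𝟙 _, rfl⟩
    have : IsIso (CommRingCat.ofHom (algebraMap (H.R i) (Localization.Away (H.d i i)))) :=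
      (IsLocalization.atUnit (H.R i) (Localization.Away (H.d i i)) (H.d i i)
        hu).toRingEquiv.toCommRingCatIso.isIso_hom
    infer_instance
  t i j := H.trans i j
  t_id i := by
    rw [← cancel_mono (H.incl i i), trans_incl, Category.id_comp]
    exact H.el_injective (H.el_other i i)
  t' i j k := H.trans₃ i j k
  t_fac i j k := H.trans₃_snd i j k
  -- Each transition preserves the point of the functor (`el_trans₃`), so going once around the
  -- cycle preserves it too, and a morphism to a chart is determined by its point.
  cocycle i j k := by
    rw [← cancel_mono (pullback.fst (H.incl i j) (H.incl i k)), ← cancel_mono (H.incl i j),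
      Category.id_comp]
    apply H.el_injective
    rw [Category.assoc, Category.assoc, Category.assoc, el_comp, el_comp, el_trans₃,
      ← el_comp, el_trans₃, ← el_comp, el_trans₃]
  f_open i j := inferInstance

/-- The scheme glued from the charts of an atlas. -/
noncomputable def scheme : Scheme.{0} := H.glueData.glued

/-- The inclusion of a chart in the scheme glued from an atlas. -/
noncomputable def chart (j : H.J) : Spec (H.R j) ⟶ H.scheme := H.glueData.ι j

instance (j : H.J) : IsOpenImmersion (H.chart j) :=
  Scheme.GlueData.ι_isOpenImmersion H.glueData j

theorem chart_jointly_surjective (x : H.scheme) : ∃ j, x ∈ (H.chart j).opensRange := by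
  obtain ⟨j, y, hy⟩ := H.glueData.ι_jointly_surjective x
  exact ⟨j, y, hy⟩

/-- The overlap is the fibre product of the two charts over the glued scheme, so equality after
gluing means factoring compatibly through the overlap. -/
theorem comp_chart_eq_iff {T : Scheme.{0}} {i j : H.J} (a : T ⟶ Spec (H.R i))
    (a' : T ⟶ Spec (H.R j)) : a ≫ H.chart i = a' ≫ H.chart j ↔ H.el a = H.el a' := by
  have hw : H.trans i j ≫ H.incl j i ≫ H.chart j = H.incl i j ≫ H.chart i :=
    H.glueData.glue_condition i j
  constructor
  · intro h
    let l : T ⟶ H.overlap i j :=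
      PullbackCone.IsLimit.lift (H.glueData.vPullbackConeIsLimit i j) a a' h
    have h1 : l ≫ H.incl i j = a :=
      PullbackCone.IsLimit.lift_fst (H.glueData.vPullbackConeIsLimit i j) a a' h
    have h2 : l ≫ H.trans i j ≫ H.incl j i = a' :=
      PullbackCone.IsLimit.lift_snd (H.glueData.vPullbackConeIsLimit i j) a a' h
    rw [← h1, ← h2, trans_incl, el_comp, el_comp, el_other]
  · intro h
    obtain ⟨b, hb⟩ := H.exists_lift a a' h
    have hb' : b ≫ H.other i j = a' := by
      apply H.el_injective
      rw [el_comp, el_other, ← el_comp, hb, h]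
    rw [← hb, ← hb', ← trans_incl, Category.assoc, Category.assoc, Category.assoc, hw]

theorem specMap_comp_chart_eq_iff {B : CommRingCat.{0}} {i j : H.J} (ψ : H.R i ⟶ B)
    (χ : H.R j ⟶ B) : Spec.map ψ ≫ H.chart i = Spec.map χ ≫ H.chart j ↔
      H.map ψ (H.u i) = H.map χ (H.u j) := by
  rw [comp_chart_eq_iff, el_specMap_eq_iff]

/-- The point `N` over `A` and the morphism `x` from `Spec A` correspond to each other when they
have the same restrictions to the charts. -/
def Corresponds {A : CommRingCat.{0}} (x : Spec A ⟶ H.scheme) (N : H.pt A) : Prop :=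
  ∀ (B : CommRingCat.{0}) (φ : A ⟶ B) (j : H.J) (ψ : H.R j ⟶ B),
    Spec.map φ ≫ x = Spec.map ψ ≫ H.chart j ↔ H.map φ N = H.map ψ (H.u j)

theorem Corresponds.comp {A B : CommRingCat.{0}} {x : Spec A ⟶ H.scheme} {N : H.pt A}
    (h : H.Corresponds x N) (φ : A ⟶ B) : H.Corresponds (Spec.map φ ≫ x) (H.map φ N) := by
  intro C φ' j ψ
  rw [← Category.assoc, ← Spec.map_comp, ← H.map_comp]
  exact h C (φ ≫ φ') j ψ

theorem corresponds_specMap_comp_chart {A : CommRingCat.{0}} {j : H.J} (ψ : H.R j ⟶ A) :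
    H.Corresponds (Spec.map ψ ≫ H.chart j) (H.map ψ (H.u j)) := by
  intro C φ i χ
  rw [← Category.assoc, ← Spec.map_comp, ← H.map_comp]
  exact H.specMap_comp_chart_eq_iff _ _

theorem exists_finite_chart {A : CommRingCat.{0}} (N : H.pt A) : ∃ s : Finset A,
    Ideal.span (Set.range ((↑) : s → A)) = ⊤ ∧ ∀ f : s, ∃ (j : H.J)
      (ψ : H.R j ⟶ CommRingCat.of (Localization.Away (f : A))), H.map ψ (H.u j) =
        H.map (CommRingCat.ofHom (algebraMap A (Localization.Away (f : A)))) N := by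
  obtain ⟨s, hs, hs'⟩ := (Ideal.span_eq_top_iff_finite _).mp (H.locally_chart N)
  exact ⟨s, by simpa using hs', fun f ↦ hs f.2⟩

theorem exists_finite_factor {A : CommRingCat.{0}} (x : Spec A ⟶ H.scheme) : ∃ s : Finset A,
    Ideal.span (Set.range ((↑) : s → A)) = ⊤ ∧ ∀ f : s, ∃ (j : H.J)
      (ψ : H.R j ⟶ CommRingCat.of (Localization.Away (f : A))), Spec.map ψ ≫ H.chart j =
        Spec.map (CommRingCat.ofHom (algebraMap A (Localization.Away (f : A)))) ≫ x := by
  let T : Set A := {f | ∃ (j : H.J) (ψ : H.R j ⟶ CommRingCat.of (Localization.Away (f : A))),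
    Spec.map ψ ≫ H.chart j =
      Spec.map (CommRingCat.ofHom (algebraMap A (Localization.Away (f : A)))) ≫ x}
  have hT : Ideal.span T = ⊤ := by
    -- A maximal ideal containing `T` is a point of `Spec A` whose image lies in some chart. A basic
    -- open neighbourhood of it maps into that chart, which puts an element outside the ideal in
    -- `T`.
    by_contra hne
    obtain ⟨m, hm, hTm⟩ := Ideal.exists_le_maximal _ hne
    let p : Spec A := ⟨m, hm.isPrime⟩
    obtain ⟨j, hj⟩ := H.chart_jointly_surjective (x p)
    obtain ⟨_, ⟨_, ⟨f, rfl⟩, rfl⟩, hpf, hfU⟩ :=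
      PrimeSpectrum.isBasis_basic_opens.exists_subset_of_mem_open
      (show p ∈ (x ⁻¹ᵁ (H.chart j).opensRange : Set (Spec A)) from hj)
      (x ⁻¹ᵁ (H.chart j).opensRange).2
    refine hpf (hTm (Ideal.subset_span ?_))
    have hr : Set.range (Spec.map (CommRingCat.ofHom (algebraMap A (Localization.Away f))) ≫ x) ⊆
        Set.range (H.chart j) := by
      rintro _ ⟨q, rfl⟩
      have : Spec.map (CommRingCat.ofHom (algebraMap A (Localization.Away f))) q ∈
          (PrimeSpectrum.basicOpen f : Set (PrimeSpectrum A)) := by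
        have := PrimeSpectrum.localization_away_comap_range (Localization.Away f) f
        rw [← this]
        exact ⟨q, rfl⟩
      exact hfU this
    refine ⟨j, Spec.preimage (IsOpenImmersion.lift (H.chart j) _ hr), ?_⟩
    rw [Spec.map_preimage, IsOpenImmersion.lift_fac]
  obtain ⟨s, hs, hs'⟩ := (Ideal.span_eq_top_iff_finite _).mp hT
  exact ⟨s, by simpa using hs', fun f ↦ hs f.2⟩

theorem hom_ext_of_span {A : CommRingCat.{0}} {Y : Scheme.{0}} {ι : Type} (f : ι → A)
    (hf : Ideal.span (Set.range f) = ⊤) {x y : Spec A ⟶ Y}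
    (h : ∀ k, Spec.map (CommRingCat.ofHom (algebraMap A (Localization.Away (f k)))) ≫ x =
      Spec.map (CommRingCat.ofHom (algebraMap A (Localization.Away (f k)))) ≫ y) : x = y :=
  Scheme.Cover.hom_ext (Scheme.affineOpenCoverOfSpanRangeEqTop f hf).openCover _ _ h

/-- It is enough to check locally that a point and a morphism correspond to each other. -/
theorem corresponds_of_span {A : CommRingCat.{0}} {ι : Type} [Finite ι] (f : ι → A)
    (hf : Ideal.span (Set.range f) = ⊤) {x : Spec A ⟶ H.scheme} {N : H.pt A}
    (h : ∀ k, H.Corresponds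
      (Spec.map (CommRingCat.ofHom (algebraMap A (Localization.Away (f k)))) ≫ x)
      (H.map (CommRingCat.ofHom (algebraMap A (Localization.Away (f k)))) N)) :
    H.Corresponds x N := by
  intro B φ j ψ
  have hf' : Ideal.span (Set.range (φ ∘ f)) = ⊤ := by
    have := congrArg (Ideal.map φ.hom) hf
    rwa [Ideal.map_span, Ideal.map_top, ← Set.range_comp] at this
  have key (k : ι) : ∃ φ' : CommRingCat.of (Localization.Away (f k)) ⟶
      CommRingCat.of (Localization.Away (φ (f k))),
      CommRingCat.ofHom (algebraMap A (Localization.Away (f k))) ≫ φ' =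
        φ ≫ CommRingCat.ofHom (algebraMap B (Localization.Away (φ (f k)))) :=
    ⟨CommRingCat.ofHom (Localization.awayMap φ.hom (f k)), by
      ext a
      simp [Localization.awayMap, IsLocalization.Away.map]⟩
  choose φ' hφ' using key
  have key2 (k : ι) := h k _ (φ' k) j
    (ψ ≫ CommRingCat.ofHom (algebraMap B (Localization.Away (φ (f k)))))
  simp only [← Category.assoc, ← Spec.map_comp, ← H.map_comp, hφ'] at key2
  constructor
  · intro hx
    refine H.separated _ hf' _ _ fun k ↦ ?_
    rw [← H.map_comp, ← H.map_comp]
    refine (key2 k).mp ?_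
    rw [Spec.map_comp, Category.assoc, hx, Spec.map_comp, Category.assoc]
  · intro hN
    refine hom_ext_of_span _ hf' fun k ↦ ?_
    rw [← Category.assoc, ← Category.assoc, ← Spec.map_comp, ← Spec.map_comp]
    refine (key2 k).mpr ?_
    rw [H.map_comp, hN, ← H.map_comp]

/-- Locally on `Spec A` the morphism factors through charts, where correspondence prescribes the
point; separatedness of the functor concludes. In `unique_hom` the roles of points and morphisms are
exchanged. -/
theorem Corresponds.unique_pt {A : CommRingCat.{0}} {x : Spec A ⟶ H.scheme} {N N' : H.pt A}
    (h : H.Corresponds x N) (h' : H.Corresponds x N') : N = N' := by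
  obtain ⟨s, hs, hs'⟩ := H.exists_finite_factor x
  refine H.separated _ hs _ _ fun f ↦ ?_
  obtain ⟨j, ψ, hψ⟩ := hs' f
  rw [(h _ _ j ψ).mp hψ.symm, (h' _ _ j ψ).mp hψ.symm]

theorem Corresponds.unique_hom {A : CommRingCat.{0}} {x x' : Spec A ⟶ H.scheme} {N : H.pt A}
    (h : H.Corresponds x N) (h' : H.Corresponds x' N) : x = x' := by
  obtain ⟨s, hs, hs'⟩ := H.exists_finite_chart N
  refine hom_ext_of_span _ hs fun f ↦ ?_
  obtain ⟨j, ψ, hψ⟩ := hs' f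
  rw [(h _ _ j ψ).mpr hψ.symm, (h' _ _ j ψ).mpr hψ.symm]

theorem exists_pt {A : CommRingCat.{0}} (x : Spec A ⟶ H.scheme) :
    ∃ N : H.pt A, H.Corresponds x N := by
  obtain ⟨s, hs, hs'⟩ := H.exists_finite_factor x
  choose j ψ hψ using hs'
  obtain ⟨N, hN⟩ := H.glue _ hs (fun f ↦ H.map (ψ f) (H.u (j f))) (by
    intro k l B φ φ' h
    rw [← H.map_comp, ← H.map_comp, ← specMap_comp_chart_eq_iff, Spec.map_comp, Category.assoc, hψ,
      Spec.map_comp, Category.assoc, hψ, ← Category.assoc, ← Category.assoc, ← Spec.map_comp,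
      ← Spec.map_comp, h])
  refine ⟨N, H.corresponds_of_span _ hs fun f ↦ ?_⟩
  rw [hN, ← hψ]
  exact H.corresponds_specMap_comp_chart _

/-- The local maps to the charts agree on overlaps because they carry restrictions of the same point
`N`, so they glue. -/
theorem exists_hom {A : CommRingCat.{0}} (N : H.pt A) :
    ∃ x : Spec A ⟶ H.scheme, H.Corresponds x N := by
  obtain ⟨s, hs, hs'⟩ := H.exists_finite_chart N
  choose j ψ hψ using hs'
  have key (f g : s) {T : Scheme.{0}} (a : T ⟶ Spec (CommRingCat.of (Localization.Away (f : A))))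
      (b : T ⟶ Spec (CommRingCat.of (Localization.Away (g : A))))
      (h : a ≫ Spec.map (CommRingCat.ofHom (algebraMap A (Localization.Away (f : A)))) =
        b ≫ Spec.map (CommRingCat.ofHom (algebraMap A (Localization.Away (g : A))))) :
      a ≫ Spec.map (ψ f) ≫ H.chart (j f) = b ≫ Spec.map (ψ g) ≫ H.chart (j g) := by
    rw [← Category.assoc, ← Category.assoc, comp_chart_eq_iff, el_comp_specMap, el_comp_specMap,
      hψ, hψ, ← H.map_comp, ← H.map_comp, ← comorph_comp_specMap, ← comorph_comp_specMap, h]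
  let 𝒰 := (Scheme.affineOpenCoverOfSpanRangeEqTop _ hs).openCover
  let x : Spec A ⟶ H.scheme := Scheme.Cover.glueMorphisms 𝒰
    (fun f ↦ Spec.map (ψ f) ≫ H.chart (j f)) (fun f g ↦ key f g _ _ pullback.condition)
  refine ⟨x, H.corresponds_of_span _ hs fun f ↦ ?_⟩
  have hx : Spec.map (CommRingCat.ofHom (algebraMap A (Localization.Away (f : A)))) ≫ x =
      Spec.map (ψ f) ≫ H.chart (j f) := Scheme.Cover.ι_glueMorphisms 𝒰 _ _ f
  rw [hx, ← hψ]
  exact H.corresponds_specMap_comp_chart _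

/-- The points of the scheme glued from an atlas. -/
noncomputable def homEquiv (A : CommRingCat.{0}) : (Spec A ⟶ H.scheme) ≃ H.pt A where
  toFun x := (H.exists_pt x).choose
  invFun N := (H.exists_hom N).choose
  left_inv x := Corresponds.unique_hom H (H.exists_hom _).choose_spec (H.exists_pt x).choose_spec
  right_inv N := Corresponds.unique_pt H (H.exists_pt _).choose_spec (H.exists_hom N).choose_spec

theorem corresponds_homEquiv {A : CommRingCat.{0}} (x : Spec A ⟶ H.scheme) :
    H.Corresponds x (H.homEquiv A x) :=
  (H.exists_pt x).choose_spec

theorem homEquiv_comp {A B : CommRingCat.{0}} (φ : A ⟶ B) (x : Spec A ⟶ H.scheme) :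
    H.homEquiv B (Spec.map φ ≫ x) = H.map φ (H.homEquiv A x) :=
  Corresponds.unique_pt H (H.corresponds_homEquiv _) ((H.corresponds_homEquiv x).comp H φ)

theorem homEquiv_chart {A : CommRingCat.{0}} {j : H.J} (ψ : H.R j ⟶ A) :
    H.homEquiv A (Spec.map ψ ≫ H.chart j) = H.map ψ (H.u j) :=
  Corresponds.unique_pt H (H.corresponds_homEquiv _) (H.corresponds_specMap_comp_chart ψ)

end AffineAtlas

end AlgebraicGeometry

/-! ### Submodules of `A⁴`: base change, descent, graphs of matrices, and the atlas of lines. -/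

namespace QuarticBitangents

open Matrix

section Submodules

variable {A B C : Type} [CommRing A] [CommRing B] [CommRing C]

/-- The submodule of `B⁴` generated by a submodule of `A⁴`, for a ring map `A → B`. -/
def extend (φ : A →+* B) (N : Submodule A (Fin 4 → A)) : Submodule B (Fin 4 → B) :=
  Submodule.span B ((fun (v : Fin 4 → A) i ↦ φ (v i)) '' N)

theorem mem_extend (φ : A →+* B) {N : Submodule A (Fin 4 → A)} {v : Fin 4 → A} (hv : v ∈ N) :
    (fun i ↦ φ (v i)) ∈ extend φ N :=
  Submodule.subset_span ⟨v, hv, rfl⟩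

theorem extend_le_iff (φ : A →+* B) {N : Submodule A (Fin 4 → A)}
    {P : Submodule B (Fin 4 → B)} :
    extend φ N ≤ P ↔ ∀ v ∈ N, (fun i ↦ φ (v i)) ∈ P := by
  rw [extend, Submodule.span_le, Set.image_subset_iff]
  rfl

theorem extend_id (N : Submodule A (Fin 4 → A)) : extend (RingHom.id A) N = N := by
  apply le_antisymm
  · exact (extend_le_iff _).mpr fun _ hv ↦ hv
  · exact fun v hv ↦ mem_extend (RingHom.id A) hv

theorem extend_comp (φ : A →+* B) (χ : B →+* C) (N : Submodule A (Fin 4 → A)) :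
    extend (χ.comp φ) N = extend χ (extend φ N) := by
  apply le_antisymm
  · exact (extend_le_iff _).mpr fun v hv ↦ mem_extend χ (mem_extend φ hv)
  · rw [extend_le_iff]
    intro w hw
    induction hw using Submodule.span_induction with
    | mem w hw =>
      obtain ⟨v, hv, rfl⟩ := hw
      exact mem_extend (χ.comp φ) hv
    | zero => convert Submodule.zero_mem _; simp
    | add x y _ _ hx hy => convert Submodule.add_mem _ hx hy using 1; ext; simp
    | smul a x _ hx => convert Submodule.smul_mem _ (χ a) hx using 1; ext; simp

theorem exists_of_mem_extend {f : A} [Algebra A B] [IsLocalization.Away f B]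
    {N : Submodule A (Fin 4 → A)} {w : Fin 4 → B} (hw : w ∈ extend (algebraMap A B) N) :
    ∃ (n : ℕ), ∃ v ∈ N, (fun i ↦ algebraMap A B (v i)) = algebraMap A B (f ^ n) • w := by
  induction hw using Submodule.span_induction with
  | mem w hw =>
    obtain ⟨v, hv, rfl⟩ := hw
    exact ⟨0, v, hv, by simp⟩
  | zero => exact ⟨0, 0, N.zero_mem, by ext; simp⟩
  | add x y _ _ hx hy =>
    obtain ⟨n, v, hv, hx⟩ := hx
    obtain ⟨m, w, hw, hy⟩ := hy
    refine ⟨n + m, f ^ m • v + f ^ n • w, N.add_mem (N.smul_mem _ hv) (N.smul_mem _ hw), ?_⟩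
    ext i
    have h1 := congrFun hx i
    have h2 := congrFun hy i
    simp only [Pi.smul_apply, smul_eq_mul, map_pow] at h1 h2
    simp only [Pi.add_apply, Pi.smul_apply, smul_eq_mul, map_add, map_mul, map_pow, h1, h2]
    ring
  | smul b x _ hx =>
    obtain ⟨n, v, hv, hx⟩ := hx
    obtain ⟨m, a, ha⟩ := IsLocalization.Away.surj f b
    refine ⟨n + m, a • v, N.smul_mem _ hv, ?_⟩
    ext i
    have h1 := congrFun hx i
    simp only [Pi.smul_apply, smul_eq_mul, map_pow] at h1 ⊢
    rw [map_mul, h1, ← ha]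
    ring

/-- Clearing denominators gives an equality that holds only after localization; a further power of
`f`, common to the four coordinates, makes it hold in `A`. -/
theorem exists_smul_mem_of_mem_extend {f : A} [Algebra A B] [IsLocalization.Away f B]
    {N : Submodule A (Fin 4 → A)} {v : Fin 4 → A}
    (hw : (fun i ↦ algebraMap A B (v i)) ∈ extend (algebraMap A B) N) :
    ∃ n : ℕ, f ^ n • v ∈ N := by
  obtain ⟨n, v', hv', h⟩ := exists_of_mem_extend (f := f) hw
  have key (i : Fin 4) : ∃ m : ℕ, f ^ m * v' i = f ^ m * (f ^ n * v i) := by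
    have h1 := congrFun h i
    simp only [Pi.smul_apply, smul_eq_mul, ← map_mul] at h1
    exact IsLocalization.Away.exists_of_eq f h1
  choose m hm using key
  refine ⟨(∑ i, m i) + n, ?_⟩
  convert N.smul_mem (f ^ ∑ i, m i) hv' using 1
  ext i
  obtain ⟨k, hk⟩ := Nat.exists_eq_add_of_le (Finset.single_le_sum (fun j _ ↦ Nat.zero_le (m j))
    (Finset.mem_univ i))
  simp only [Pi.smul_apply, smul_eq_mul]
  rw [hk]
  linear_combination (-(f ^ k)) * hm i

/-- A submodule is determined by its localizations. -/
theorem le_of_extend_le {ι : Type} (f : ι → A) (hf : Ideal.span (Set.range f) = ⊤)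
    {N N' : Submodule A (Fin 4 → A)}
    (h : ∀ k, extend (algebraMap A (Localization.Away (f k))) N ≤
      extend (algebraMap A (Localization.Away (f k))) N') : N ≤ N' := by
  intro v hv
  refine N'.mem_of_span_eq_top_of_smul_pow_mem (Set.range f) hf v ?_
  rintro ⟨_, k, rfl⟩
  exact exists_smul_mem_of_mem_extend (h k (mem_extend _ hv))

/-- The glued module consists of the vectors whose image lies in every `N k`. To reach a given `w ∈
N k`, clear its denominators; by compatibility on the overlaps, a power of `f k` then moves the
vector into each `N l`, and finiteness of `ι` provides one exponent for all `l`. -/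
theorem exists_extend_eq {ι : Type} [Finite ι] (f : ι → A)
    (N : ∀ k, Submodule (Localization.Away (f k)) (Fin 4 → Localization.Away (f k)))
    (h : ∀ (k l : ι) {B : Type} [CommRing B] (φ : Localization.Away (f k) →+* B)
      (φ' : Localization.Away (f l) →+* B), φ.comp (algebraMap A _) = φ'.comp (algebraMap A _) →
      extend φ (N k) = extend φ' (N l)) :
    ∃ M : Submodule A (Fin 4 → A),
      ∀ k, extend (algebraMap A (Localization.Away (f k))) M = N k := by
  let M : Submodule A (Fin 4 → A) :=
    { carrier := {v | ∀ k, (fun i ↦ algebraMap A (Localization.Away (f k)) (v i)) ∈ N k}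
      add_mem' := fun {v w} hv hw k ↦ by
        convert (N k).add_mem (hv k) (hw k) using 1; ext; simp
      zero_mem' := fun k ↦ by convert (N k).zero_mem; simp
      smul_mem' := fun a v hv k ↦ by
        convert (N k).smul_mem (algebraMap A _ a) (hv k) using 1; ext; simp }
  refine ⟨M, fun k ↦ le_antisymm ((extend_le_iff _).mpr fun v hv ↦ hv k) fun w hw ↦ ?_⟩
  have key (i : Fin 4) : ∃ (n : ℕ) (a : A), w i * algebraMap A (Localization.Away (f k)) (f k ^ n) =
      algebraMap A _ a := by
    obtain ⟨n, a, ha⟩ := IsLocalization.Away.surj (f k) (w i)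
    exact ⟨n, a, by rw [map_pow, ha]⟩
  choose n a ha using key
  let m := ∑ i, n i
  let v : Fin 4 → A := fun i ↦ f k ^ (m - n i) * a i
  have hv : (fun i ↦ algebraMap A (Localization.Away (f k)) (v i)) =
      algebraMap A (Localization.Away (f k)) (f k ^ m) • w := by
    ext i
    have hle : n i ≤ m := Finset.single_le_sum (fun j _ ↦ Nat.zero_le (n j)) (Finset.mem_univ i)
    simp only [v, map_mul, ← ha, Pi.smul_apply, smul_eq_mul]
    rw [mul_left_comm, ← map_mul, ← pow_add, Nat.sub_add_cancel hle, mul_comm]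
  have key2 (l : ι) : ∃ r : ℕ, (algebraMap A (Localization.Away (f l)) (f k)) ^ r •
      (fun i ↦ algebraMap A (Localization.Away (f l)) (v i)) ∈ N l := by
    let g := algebraMap A (Localization.Away (f l)) (f k)
    let φ : Localization.Away (f k) →+* Localization.Away g :=
      IsLocalization.Away.lift (f k) (g := (algebraMap _ _).comp (algebraMap A _))
        (IsLocalization.Away.algebraMap_isUnit g)
    have hφ : φ.comp (algebraMap A _) = (algebraMap _ _).comp (algebraMap A _) :=
      IsLocalization.Away.lift_comp _ _
    refine exists_smul_mem_of_mem_extend (B := Localization.Away g) ?_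
    rw [← h k l φ (algebraMap _ _) hφ]
    have h1 : (fun i ↦ algebraMap A (Localization.Away (f k)) (v i)) ∈ N k :=
      hv ▸ (N k).smul_mem _ hw
    convert mem_extend φ h1 using 2 with i
    exact (RingHom.congr_fun hφ (v i)).symm
  choose r hr using key2
  have := Fintype.ofFinite ι
  let s := ∑ l, r l
  have hs : f k ^ s • v ∈ M := by
    intro l
    have hle : r l ≤ s := Finset.single_le_sum (fun j _ ↦ Nat.zero_le (r j)) (Finset.mem_univ l)
    convert (N l).smul_mem (algebraMap A _ (f k) ^ (s - r l)) (hr l) using 1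
    ext i
    simp only [Pi.smul_apply, smul_eq_mul, map_mul, map_pow]
    rw [← mul_assoc, ← pow_add, Nat.sub_add_cancel hle]
  have hu : IsUnit (algebraMap A (Localization.Away (f k)) (f k ^ (s + m))) := by
    rw [map_pow]
    exact (IsLocalization.Away.algebraMap_isUnit (f k)).pow _
  have hmem := mem_extend (algebraMap A (Localization.Away (f k))) hs
  have : (fun i ↦ algebraMap A (Localization.Away (f k)) ((f k ^ s • v) i)) =
      (algebraMap A (Localization.Away (f k)) (f k ^ (s + m))) • w := by
    rw [pow_add, map_mul, mul_smul, ← hv]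
    ext i
    simp
  rw [this] at hmem
  obtain ⟨c, hc⟩ := hu
  rw [← hc] at hmem
  simpa using Submodule.smul_mem _ ((c⁻¹ : (Localization.Away (f k))ˣ) : Localization.Away (f k))
    hmem

/-- The coordinate splittings of a set of four elements into two pairs. -/
abbrev Splitting : Type := Fin 2 ⊕ Fin 2 ≃ Fin 4

/-- The rows of the `2 × 4`-matrix with a unit block and the block `M`. -/
def row (σ : Splitting) (M : Matrix (Fin 2) (Fin 2) A) (i : Fin 2) : Fin 4 → A :=
  fun k ↦ Sum.elim (Pi.single i 1) (M i) (σ.symm k)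

@[simp] theorem row_inl (σ : Splitting) (M : Matrix (Fin 2) (Fin 2) A) (i j : Fin 2) :
    row σ M i (σ (Sum.inl j)) = (1 : Matrix (Fin 2) (Fin 2) A) i j := by
  simp [row, Matrix.one_apply, Pi.single_apply, eq_comm]

@[simp] theorem row_inr (σ : Splitting) (M : Matrix (Fin 2) (Fin 2) A) (i j : Fin 2) :
    row σ M i (σ (Sum.inr j)) = M i j := by
  simp [row]

theorem map_row (φ : A →+* B) (σ : Splitting) (M : Matrix (Fin 2) (Fin 2) A) (i : Fin 2) :
    (fun k ↦ φ (row σ M i k)) = row σ (M.map φ) i := by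
  ext k
  obtain ⟨k, rfl⟩ := σ.surjective k
  rcases k with k | k
  · simp only [row_inl, Matrix.one_apply]; split <;> simp
  · simp

/-- The family of lines which is the graph of a `2 × 2`-matrix. -/
def graph (σ : Splitting) (M : Matrix (Fin 2) (Fin 2) A) : Submodule A (Fin 4 → A) :=
  Submodule.span A (Set.range (row σ M))

theorem row_mem_graph (σ : Splitting) (M : Matrix (Fin 2) (Fin 2) A) (i : Fin 2) :
    row σ M i ∈ graph σ M :=
  Submodule.subset_span ⟨i, rfl⟩

theorem mem_graph_iff_exists {σ : Splitting} {M : Matrix (Fin 2) (Fin 2) A} {v : Fin 4 → A} :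
    v ∈ graph σ M ↔ ∃ c : Fin 2 → A, ∑ i, c i • row σ M i = v :=
  Submodule.mem_span_range_iff_exists_fun A

theorem mem_graph_iff {σ : Splitting} {M : Matrix (Fin 2) (Fin 2) A} {v : Fin 4 → A} :
    v ∈ graph σ M ↔ ∑ i, v (σ (Sum.inl i)) • row σ M i = v := by
  refine ⟨fun h ↦ ?_, fun h ↦ mem_graph_iff_exists.mpr ⟨_, h⟩⟩
  obtain ⟨c, rfl⟩ := mem_graph_iff_exists.mp h
  congr 1
  ext i : 1
  congr 1
  simp [Matrix.one_apply]

/-- By `mem_graph_iff` the coefficients of a vector of a graph are its own coordinates in the unit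
block, so a row of one matrix lying in the other graph must be the row of the same index. -/
theorem graph_injective (σ : Splitting) :
    Function.Injective (graph (A := A) σ) := by
  intro M M' h
  ext i j
  have := mem_graph_iff.mp (h ▸ row_mem_graph σ M i)
  have := congrFun this (σ (Sum.inr j))
  fin_cases i <;> simpa [Fin.sum_univ_two] using this.symm

theorem extend_graph (φ : A →+* B) (σ : Splitting) (M : Matrix (Fin 2) (Fin 2) A) :
    extend φ (graph σ M) = graph σ (M.map φ) := by
  apply le_antisymm
  · rw [extend_le_iff]
    intro v hv
    obtain ⟨c, rfl⟩ := mem_graph_iff_exists.mp hv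
    refine mem_graph_iff_exists.mpr ⟨fun i ↦ φ (c i), ?_⟩
    simp only [← map_row]
    ext
    simp
  · refine Submodule.span_le.mpr ?_
    rintro _ ⟨i, rfl⟩
    rw [← map_row]
    exact mem_extend φ (row_mem_graph σ M i)

/-- The block of the rows of a graph formed by the columns which are free for another splitting. -/
def block (σ τ : Splitting) (M : Matrix (Fin 2) (Fin 2) A) : Matrix (Fin 2) (Fin 2) A :=
  Matrix.of fun i j ↦ row σ M i (τ (Sum.inl j))

theorem map_det_block (φ : A →+* B) (σ τ : Splitting) (M : Matrix (Fin 2) (Fin 2) A) :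
    φ (block σ τ M).det = (block σ τ (M.map φ)).det := by
  rw [RingHom.map_det]
  congr 1
  ext i j
  exact congrFun (map_row φ σ M i) (τ (Sum.inl j))

/-- Multiplying the 2 × 4 matrix of rows by the inverse of the block turns the `τ`-columns into the
identity. Conversely, expressing the rows of `graph τ M'` through those of `graph σ M` gives a left
inverse of the block. -/
theorem isUnit_det_block_iff {σ τ : Splitting} {M : Matrix (Fin 2) (Fin 2) A} :
    IsUnit (block σ τ M).det ↔ ∃ M', graph τ M' = graph σ M := by
  constructor
  · intro hu
    let P := block σ τ M
    let Q : Matrix (Fin 2) (Fin 2) A := Matrix.of fun i j ↦ row σ M i (τ (Sum.inr j))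
    have hPP : P * P⁻¹ = 1 := Matrix.mul_nonsing_inv P hu
    have hPP' : P⁻¹ * P = 1 := Matrix.nonsing_inv_mul P hu
    refine ⟨P⁻¹ * Q, ?_⟩
    have hrow (i : Fin 2) : row σ M i = ∑ k, P i k • row τ (P⁻¹ * Q) k := by
      ext k
      obtain ⟨k, rfl⟩ := τ.surjective k
      rcases k with k | k
      · simp [P, block, Matrix.one_apply]
      · have : (P * (P⁻¹ * Q)) i k = Q i k := by rw [← Matrix.mul_assoc, hPP, Matrix.one_mul]
        simpa [Matrix.mul_apply, Q] using this.symm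
    have hrow' (i : Fin 2) : row τ (P⁻¹ * Q) i = ∑ k, P⁻¹ i k • row σ M k := by
      ext k
      obtain ⟨k, rfl⟩ := τ.surjective k
      rcases k with k | k
      · rw [row_inl, ← hPP', Matrix.mul_apply]
        simp [P, block]
      · rw [row_inr, Matrix.mul_apply]
        simp [Q]
    apply le_antisymm
    · refine Submodule.span_le.mpr ?_
      rintro _ ⟨i, rfl⟩
      rw [hrow']
      exact mem_graph_iff_exists.mpr ⟨_, rfl⟩
    · refine Submodule.span_le.mpr ?_
      rintro _ ⟨i, rfl⟩
      rw [hrow]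
      exact mem_graph_iff_exists.mpr ⟨_, rfl⟩
  · rintro ⟨M', hM'⟩
    have key (i : Fin 2) : ∃ c : Fin 2 → A, ∑ k, c k • row σ M k = row τ M' i :=
      mem_graph_iff_exists.mp (hM' ▸ row_mem_graph τ M' i)
    choose c hc using key
    refine Matrix.isUnit_det_of_left_inverse (B := Matrix.of c) ?_
    ext i j
    rw [← row_inl τ M' i j, ← hc]
    simp [Matrix.mul_apply, block]

/-- A submodule of `A⁴` which is locally the graph of a matrix. -/
def IsLocallyGraph (N : Submodule A (Fin 4 → A)) : Prop :=
  Ideal.span {f : A | ∃ (σ : Splitting) (M : Matrix (Fin 2) (Fin 2) (Localization.Away f)),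
    graph σ M = extend (algebraMap A (Localization.Away f)) N} = ⊤

theorem exists_graph_extend_of_isUnit {f : A} {φ : A →+* B} (hf : IsUnit (φ f))
    {N : Submodule A (Fin 4 → A)} {σ : Splitting}
    (h : ∃ M, graph σ M = extend (algebraMap A (Localization.Away f)) N) :
    ∃ M, graph σ M = extend φ N := by
  obtain ⟨M, hM⟩ := h
  refine ⟨M.map (IsLocalization.Away.lift f hf), ?_⟩
  rw [← extend_graph, hM, ← extend_comp, IsLocalization.Away.lift_comp]

theorem IsLocallyGraph.extend {N : Submodule A (Fin 4 → A)} (h : IsLocallyGraph N)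
    (φ : A →+* B) : IsLocallyGraph (extend φ N) := by
  have h' := congrArg (Ideal.map φ) h
  rw [Ideal.map_top, Ideal.map_span] at h'
  refine top_le_iff.mp (h'.symm.le.trans (Ideal.span_mono ?_))
  rintro _ ⟨f, ⟨σ, hσ⟩, rfl⟩
  refine ⟨σ, ?_⟩
  rw [← extend_comp]
  exact exists_graph_extend_of_isUnit (φ := (algebraMap B (Localization.Away (φ f))).comp φ)
    (IsLocalization.Away.algebraMap_isUnit (φ f)) hσ

theorem isLocallyGraph_graph (σ : Splitting) (M : Matrix (Fin 2) (Fin 2) A) :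
    IsLocallyGraph (graph σ M) := by
  refine (Ideal.eq_top_iff_one _).mpr (Ideal.subset_span ⟨σ, M.map (algebraMap A _), ?_⟩)
  rw [extend_graph]

/-- Given a maximal ideal `m` and `f k ∉ m`, the module is a graph over some localization of `A_{f
k}` at an element `g` outside the extended prime. If `a` is `g` cleared of denominators, then `a * f
k ∉ m` and the module is a graph over `A_{a * f k}`. -/
theorem IsLocallyGraph.of_span {ι : Type} (f : ι → A) (hf : Ideal.span (Set.range f) = ⊤)
    {N : Submodule A (Fin 4 → A)}
    (h : ∀ k,
      IsLocallyGraph (QuarticBitangents.extend (algebraMap A (Localization.Away (f k))) N)) :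
    IsLocallyGraph N := by
  by_contra hne
  obtain ⟨m, hm, hTm⟩ := Ideal.exists_le_maximal _ hne
  obtain ⟨k, hk⟩ : ∃ k, f k ∉ m := by
    by_contra! hcon
    exact hm.ne_top (top_le_iff.mp (hf.symm.le.trans (Ideal.span_le.mpr (by
      rintro _ ⟨k, rfl⟩
      exact hcon k))))
  have hdisj : Disjoint (Submonoid.powers (f k) : Set A) m :=
    (Ideal.disjoint_powers_iff_notMem_of_isPrime (f k)).mpr hk
  have hp := IsLocalization.isPrime_of_isPrime_disjoint (Submonoid.powers (f k))
    (Localization.Away (f k)) m hm.isPrime hdisj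
  obtain ⟨g, ⟨σ, hσ⟩, hg⟩ : ∃ g ∈ {g | ∃ (σ : Splitting) (M : Matrix (Fin 2) (Fin 2)
      (Localization.Away g)),
        graph σ M = QuarticBitangents.extend (algebraMap _ (Localization.Away g))
        (QuarticBitangents.extend (algebraMap A (Localization.Away (f k))) N)},
      g ∉ m.map (algebraMap A (Localization.Away (f k))) := by
    by_contra! hcon
    exact hp.ne_top (top_le_iff.mp ((h k).symm.le.trans (Ideal.span_le.mpr hcon)))
  obtain ⟨n, a, ha⟩ := IsLocalization.Away.surj (f k) g
  have ham : a ∉ m := by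
    intro ham
    have h1 : g * algebraMap A (Localization.Away (f k)) (f k) ^ n ∈ m.map (algebraMap A _) := by
      rw [ha]
      exact Ideal.mem_map_of_mem _ ham
    refine (hp.mem_or_mem h1).elim hg fun h2 ↦ hp.ne_top ?_
    exact Ideal.eq_top_of_isUnit_mem _ h2 ((IsLocalization.Away.algebraMap_isUnit (f k)).pow n)
  refine hm.isPrime.mul_notMem ham hk (hTm (Ideal.subset_span ⟨σ, ?_⟩))
  have hu := IsLocalization.Away.algebraMap_isUnit (S := Localization.Away (a * f k)) (a * f k)
  rw [map_mul, IsUnit.mul_iff] at hu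
  let φ : Localization.Away (f k) →+* Localization.Away (a * f k) :=
    IsLocalization.Away.lift (f k) hu.2
  have hφ : φ.comp (algebraMap A _) = algebraMap A _ := IsLocalization.Away.lift_comp _ _
  have hφg : IsUnit (φ g) := by
    have := congrArg φ ha
    rw [map_mul, ← RingHom.comp_apply φ, hφ] at this
    exact (IsUnit.mul_iff.mp (this ▸ hu.1)).1
  have := exists_graph_extend_of_isUnit hφg hσ
  rwa [← extend_comp, hφ] at this

end Submodules

/-- The generic `2 × 2`-matrix. -/
noncomputable def genericMatrix (R : Type) [CommRing R] :
    Matrix (Fin 2) (Fin 2) (MvPolynomial (Fin 2 × Fin 2) R) :=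
  Matrix.of fun i j ↦ MvPolynomial.X (i, j)

theorem map_genericMatrix_eval₂Hom {R B : Type} [CommRing R] [CommRing B] (φ : R →+* B)
    (M : Matrix (Fin 2) (Fin 2) B) :
    (genericMatrix R).map (MvPolynomial.eval₂Hom φ fun p ↦ M p.1 p.2) = M := by
  ext i j
  simp [genericMatrix]

/-- The atlas of the Grassmannian of rank two direct summands of a free module of rank four. -/
noncomputable def linesAtlas : AffineAtlas where
  pt A := {N : Submodule A (Fin 4 → A) // IsLocallyGraph N}
  map f N := ⟨extend f.hom N.1, N.2.extend f.hom⟩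
  map_id x := Subtype.ext (extend_id x.1)
  map_comp f g x := Subtype.ext (extend_comp f.hom g.hom x.1)
  J := Splitting
  -- The functor is defined on all commutative rings, so the charts are affine spaces over `ℤ`; the
  -- base change to `ℂ` comes later.
  R _ := CommRingCat.of (MvPolynomial (Fin 2 × Fin 2) ℤ)
  u σ := ⟨graph σ (genericMatrix ℤ), isLocallyGraph_graph _ _⟩
  u_inj σ B ψ ψ' h := by
    have h' := congrArg Subtype.val h
    dsimp only at h'
    rw [extend_graph, extend_graph] at h'
    have h'' := graph_injective σ h'
    ext p
    · simp
    · exact congrFun (congrFun h'' p.1) p.2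
  d σ τ := (block σ τ (genericMatrix ℤ)).det
  isUnit_iff σ τ B ψ := by
    have h : ψ (block σ τ (genericMatrix ℤ)).det =
        (block σ τ ((genericMatrix ℤ).map ψ.hom)).det := map_det_block ψ.hom σ τ _
    rw [h, isUnit_det_block_iff]
    constructor
    · rintro ⟨M, hM⟩
      refine ⟨CommRingCat.ofHom (MvPolynomial.eval₂Hom (Int.castRingHom B) fun p ↦ M p.1 p.2),
        Subtype.ext ?_⟩
      dsimp only
      rw [extend_graph, extend_graph, CommRingCat.hom_ofHom, map_genericMatrix_eval₂Hom, hM]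
    · rintro ⟨χ, hχ⟩
      have h' := congrArg Subtype.val hχ
      dsimp only at h'
      rw [extend_graph, extend_graph] at h'
      exact ⟨_, h'⟩
  locally_chart {A} N := by
    refine top_le_iff.mp (N.2.symm.le.trans (Ideal.span_mono ?_))
    rintro f ⟨σ, M, hM⟩
    refine ⟨σ, CommRingCat.ofHom (MvPolynomial.eval₂Hom (Int.castRingHom _) fun p ↦ M p.1 p.2),
        Subtype.ext ?_⟩
    dsimp only
    rw [extend_graph, CommRingCat.hom_ofHom, CommRingCat.hom_ofHom, map_genericMatrix_eval₂Hom, hM]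
  separated f hf N N' h := Subtype.ext (le_antisymm
    (le_of_extend_le f hf fun k ↦ (congrArg Subtype.val (h k)).le)
    (le_of_extend_le f hf fun k ↦ (congrArg Subtype.val (h k)).ge))
  glue {A ι} _ f hf N h := by
    obtain ⟨M, hM⟩ := exists_extend_eq f (fun k ↦ (N k).1) (fun k l B _ φ φ' hφ ↦
      congrArg Subtype.val (h k l (B := CommRingCat.of B) (CommRingCat.ofHom φ)
        (CommRingCat.ofHom φ') (by rw [← CommRingCat.ofHom_comp, ← CommRingCat.ofHom_comp, hφ])))
    exact ⟨⟨M, IsLocallyGraph.of_span f hf fun k ↦ by rw [hM]; exact (N k).2⟩,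
      fun k ↦ Subtype.ext (hM k)⟩

end QuarticBitangents

/-! ### Locally graphs are the submodules with projective quotient of rank two. -/

namespace QuarticBitangents

section Quotients

variable {A : Type} [CommRing A]

/-- The base change of the quotient of `A⁴` by a submodule. -/
noncomputable def mkQExtend (B : Type) [CommRing B] [Algebra A B] (N : Submodule A (Fin 4 → A)) :
    (Fin 4 → B) →ₗ[B] B ⊗[A] ((Fin 4 → A) ⧸ N) :=
  N.mkQ.baseChange B ∘ₗ (TensorProduct.piScalarRight A B B (Fin 4)).symm.toLinearMap

/-- Right exactness of the tensor product. -/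
theorem ker_mkQExtend (B : Type) [CommRing B] [Algebra A B] (N : Submodule A (Fin 4 → A)) :
    (mkQExtend B N).ker = extend (algebraMap A B) N := by
  apply le_antisymm
  · intro z hz
    have h1 : (TensorProduct.piScalarRight A B B (Fin 4)).symm z ∈
        (LinearMap.lTensor B N.mkQ).ker := hz
    rw [lTensor_mkQ] at h1
    obtain ⟨y, hy⟩ := h1
    rw [LinearEquiv.eq_symm_apply] at hy
    rw [← hy]
    clear hy hz
    induction y using TensorProduct.induction_on with
    | zero => simp
    | add x y hx hy => rw [map_add, map_add]; exact Submodule.add_mem _ hx hy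
    | tmul b n =>
      convert Submodule.smul_mem _ b (mem_extend (algebraMap A B) n.2) using 1
      ext i
      simp [Algebra.smul_def, mul_comm]
  · rw [extend_le_iff]
    intro v hv
    have h1 : (fun i ↦ algebraMap A B (v i)) =
        TensorProduct.piScalarRight A B B (Fin 4) (1 ⊗ₜ[A] v) := by
      ext i
      simp [Algebra.smul_def]
    rw [h1, LinearMap.mem_ker, mkQExtend, LinearMap.comp_apply, LinearEquiv.coe_coe,
      LinearEquiv.symm_apply_apply, LinearMap.baseChange_tmul, Submodule.mkQ_apply,
      (Submodule.Quotient.mk_eq_zero N).mpr hv, TensorProduct.tmul_zero]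

theorem mkQExtend_surjective (B : Type) [CommRing B] [Algebra A B]
    (N : Submodule A (Fin 4 → A)) : Function.Surjective (mkQExtend B N) :=
  (LinearMap.baseChange_surjective B (Submodule.mkQ_surjective _)).comp
    (TensorProduct.piScalarRight A B B (Fin 4)).symm.surjective

/-- Quotients of free modules of rank four commute with base change. -/
noncomputable def quotientExtendEquiv (B : Type) [CommRing B] [Algebra A B]
    (N : Submodule A (Fin 4 → A)) :
    ((Fin 4 → B) ⧸ extend (algebraMap A B) N) ≃ₗ[B] B ⊗[A] ((Fin 4 → A) ⧸ N) :=
  Submodule.quotEquivOfEq _ _ (ker_mkQExtend B N).symm ≪≫ₗ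
    (mkQExtend B N).quotKerEquivOfSurjective (mkQExtend_surjective B N)

/-- The equations of the graph of a matrix. -/
def graphEquations (σ : Splitting) (M : Matrix (Fin 2) (Fin 2) A) :
    (Fin 4 → A) →ₗ[A] (Fin 2 → A) :=
  LinearMap.pi fun j ↦ LinearMap.proj (σ (Sum.inr j)) -
    ∑ i, M i j • LinearMap.proj (σ (Sum.inl i))

theorem ker_graphEquations (σ : Splitting) (M : Matrix (Fin 2) (Fin 2) A) :
    (graphEquations σ M).ker = graph σ M := by
  ext v
  rw [LinearMap.mem_ker, mem_graph_iff]
  constructor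
  · intro h
    ext k
    obtain ⟨k, rfl⟩ := σ.surjective k
    rcases k with k | k
    · simp [Matrix.one_apply]
    · have := congrFun h k
      simp only [graphEquations, LinearMap.pi_apply, LinearMap.sub_apply, LinearMap.proj_apply,
        LinearMap.sum_apply, LinearMap.smul_apply, smul_eq_mul, Pi.zero_apply, sub_eq_zero] at this
      simp [this, mul_comm]
  · intro h
    ext j
    have := congrFun h (σ (Sum.inr j))
    simp only [Finset.sum_apply, Pi.smul_apply, row_inr, smul_eq_mul] at this
    simp [graphEquations, ← this, mul_comm]

theorem graphEquations_surjective (σ : Splitting) (M : Matrix (Fin 2) (Fin 2) A) :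
    Function.Surjective (graphEquations σ M) := by
  intro w
  refine ⟨fun k ↦ Sum.elim 0 w (σ.symm k), ?_⟩
  ext j
  simp [graphEquations]

/-- The quotient by a graph is free of rank two. -/
noncomputable def quotientGraphEquiv (σ : Splitting) (M : Matrix (Fin 2) (Fin 2) A) :
    ((Fin 4 → A) ⧸ graph σ M) ≃ₗ[A] (Fin 2 → A) :=
  Submodule.quotEquivOfEq _ _ (ker_graphEquations σ M).symm ≪≫ₗ
    (graphEquations σ M).quotKerEquivOfSurjective (graphEquations_surjective σ M)

theorem exists_tensor_quotient_equiv {N : Submodule A (Fin 4 → A)} {f : A}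
    (h : ∃ (σ : Splitting) (M : Matrix (Fin 2) (Fin 2) (Localization.Away f)),
      graph σ M = extend (algebraMap A (Localization.Away f)) N) :
    Nonempty (Localization.Away f ⊗[A] ((Fin 4 → A) ⧸ N) ≃ₗ[Localization.Away f]
      (Fin 2 → Localization.Away f)) := by
  obtain ⟨σ, M, hM⟩ := h
  exact ⟨(quotientExtendEquiv _ N).symm ≪≫ₗ Submodule.quotEquivOfEq _ _ hM.symm ≪≫ₗ
    quotientGraphEquiv σ M⟩

theorem exists_notMem_of_isLocallyGraph {N : Submodule A (Fin 4 → A)} (h : IsLocallyGraph N)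
    (p : Ideal A) [hp : p.IsPrime] : ∃ f ∉ p, ∃ (σ : Splitting)
      (M : Matrix (Fin 2) (Fin 2) (Localization.Away f)),
      graph σ M = extend (algebraMap A (Localization.Away f)) N := by
  by_contra! hcon
  refine hp.ne_top (top_le_iff.mp (h.symm.le.trans (Ideal.span_le.mpr ?_)))
  rintro f ⟨σ, M, hM⟩
  by_contra hf
  exact hcon f hf σ M hM

theorem IsLocallyGraph.finitePresentation {N : Submodule A (Fin 4 → A)} (h : IsLocallyGraph N) :
    Module.FinitePresentation A ((Fin 4 → A) ⧸ N) := by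
  refine Module.FinitePresentation.of_localizationSpan' _ h
    (Rₚ := fun g ↦ Localization.Away g.1)
    (fun g ↦ TensorProduct.mk A (Localization.Away g.1) ((Fin 4 → A) ⧸ N) 1) fun g ↦ ?_
  obtain ⟨e⟩ := exists_tensor_quotient_equiv g.2
  exact Module.FinitePresentation.of_equiv e.symm

theorem exists_away_prime {f : A} {p : Ideal A} [hp : p.IsPrime] (hf : f ∉ p) :
    ∃ q : PrimeSpectrum (Localization.Away f),
      q.comap (algebraMap A (Localization.Away f)) = ⟨p, hp⟩ := by
  have h := PrimeSpectrum.localization_away_comap_range (Localization.Away f) f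
  have : (⟨p, hp⟩ : PrimeSpectrum A) ∈ (PrimeSpectrum.basicOpen f : Set (PrimeSpectrum A)) := hf
  rw [← h] at this
  exact this

theorem IsLocallyGraph.projective {N : Submodule A (Fin 4 → A)} (h : IsLocallyGraph N) :
    Module.Projective A ((Fin 4 → A) ⧸ N) := by
  have := h.finitePresentation
  rw [← Module.freeLocus_eq_univ_iff, Set.eq_univ_iff_forall]
  rintro ⟨p, hp⟩
  obtain ⟨f, hf, hσ⟩ := exists_notMem_of_isLocallyGraph h p
  obtain ⟨e⟩ := exists_tensor_quotient_equiv hσ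
  obtain ⟨q, hq⟩ := exists_away_prime hf
  rw [← hq]
  have hfree : q ∈ Module.freeLocus (Localization.Away f)
      (Localization.Away f ⊗[A] ((Fin 4 → A) ⧸ N)) := by
    have : Module.Free (Localization.Away f) (Localization.Away f ⊗[A] ((Fin 4 → A) ⧸ N)) :=
      Module.Free.of_equiv e.symm
    rw [Module.freeLocus_eq_univ]
    trivial
  have := Module.freeLocus_localization (R := A) (M := (Fin 4 → A) ⧸ N) (Submonoid.powers f)
  have h2 := Module.freeLocus_congr (IsLocalizedModule.isBaseChange (Submonoid.powers f)
    (Localization.Away f) (LocalizedModule.mkLinearMap (Submonoid.powers f)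
      ((Fin 4 → A) ⧸ N))).equiv
  rw [h2, this] at hfree
  exact hfree

theorem IsLocallyGraph.rankAtStalk_eq {N : Submodule A (Fin 4 → A)} (h : IsLocallyGraph N)
    (p : PrimeSpectrum A) : Module.rankAtStalk (R := A) ((Fin 4 → A) ⧸ N) p = 2 := by
  have := h.finitePresentation
  have := h.projective
  obtain ⟨f, hf, hσ⟩ := exists_notMem_of_isLocallyGraph h p.asIdeal
  obtain ⟨e⟩ := exists_tensor_quotient_equiv hσ
  obtain ⟨q, hq⟩ := exists_away_prime hf
  have : Nontrivial (Localization.Away f) := ⟨⟨0, 1, fun h01 ↦ q.isPrime.ne_top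
    ((Ideal.eq_top_iff_one _).mpr (h01 ▸ Ideal.zero_mem _))⟩⟩
  have h1 := congrFun (Module.rankAtStalk_eq_of_equiv e) q
  rw [Module.rankAtStalk_baseChange, hq] at h1
  rw [show p = ⟨p.asIdeal, p.isPrime⟩ from rfl, h1, Module.rankAtStalk_eq_finrank_of_free]
  simp

/-- The hypotheses say that two of the basis vectors freely generate the quotient once `f` is
inverted. Writing the classes of the other two through them gives relations, elements of `N`, which
are the rows of the graph up to sign and denominators. -/
theorem exists_extend_eq_graph (N : Submodule A (Fin 4 → A)) (τ : Splitting) (f : A)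
    (e : (Fin 2 → A) →ₗ[A] ((Fin 4 → A) ⧸ N))
    (he : ∀ w, e w = N.mkQ (fun k ↦ Sum.elim (fun _ ↦ (0 : A)) w (τ.symm k)))
    (hinj : ∀ w, e w = 0 → ∃ n : ℕ, f ^ n • w = 0)
    (hsurj : ∀ x, ∃ (n : ℕ) (w : _), e w = f ^ n • x) :
    ∃ M : Matrix (Fin 2) (Fin 2) (Localization.Away f),
      graph τ M = extend (algebraMap A (Localization.Away f)) N := by
  let φ := algebraMap A (Localization.Away f)
  have hφ : IsUnit (φ f) := IsLocalization.Away.algebraMap_isUnit f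
  have key (i : Fin 2) := hsurj (N.mkQ (Pi.single (τ (Sum.inl i)) 1))
  choose n w hw using key
  have hfn (i : Fin 2) : IsUnit (φ f ^ n i) := hφ.pow _
  let M : Matrix (Fin 2) (Fin 2) (Localization.Away f) :=
    Matrix.of fun i j ↦ -(((hfn i).unit⁻¹ : (Localization.Away f)ˣ) : Localization.Away f) *
      φ (w i j)
  have hrow (i : Fin 2) : row τ M i ∈ extend φ N := by
    have h1 : f ^ n i • (Pi.single (τ (Sum.inl i)) 1 : Fin 4 → A) -
        (fun k ↦ Sum.elim (fun _ ↦ (0 : A)) (w i) (τ.symm k)) ∈ N := by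
      rw [← Submodule.Quotient.mk_eq_zero, ← Submodule.mkQ_apply, map_sub, map_smul, ← hw, he,
        sub_self]
    convert Submodule.smul_mem _ (((hfn i).unit⁻¹ : (Localization.Away f)ˣ) : Localization.Away f)
      (mem_extend φ h1) using 1
    ext k
    obtain ⟨k, rfl⟩ := τ.surjective k
    have h2 : (((hfn i).unit⁻¹ : (Localization.Away f)ˣ) : Localization.Away f) * φ f ^ n i = 1 :=
      (hfn i).val_inv_mul
    rcases k with k | k
    · by_cases hik : i = k
      · subst hik
        simp [h2]
      · simp [hik, Pi.single_apply, Ne.symm hik]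
    · simp [M, Pi.single_apply]
  refine ⟨M, le_antisymm (Submodule.span_le.mpr ?_) ?_⟩
  · rintro _ ⟨i, rfl⟩
    exact hrow i
  · intro v hv
    -- This difference is supported on the last two coordinates and dies in the quotient, so
    -- injectivity of `e` up to powers of `f` kills it.
    let z := v - ∑ i, v (τ (Sum.inl i)) • row τ M i
    have hz : z ∈ extend φ N := Submodule.sub_mem _ hv
      (Submodule.sum_mem _ fun i _ ↦ Submodule.smul_mem _ _ (hrow i))
    have hz0 (i : Fin 2) : z (τ (Sum.inl i)) = 0 := by
      fin_cases i <;> simp [z, Fin.sum_univ_two]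
    suffices hz' : z = 0 from mem_graph_iff.mpr (sub_eq_zero.mp hz').symm
    obtain ⟨m, v', hv', h⟩ := exists_of_mem_extend (f := f) hz
    have h0 (i : Fin 2) : ∃ r : ℕ, f ^ r * v' (τ (Sum.inl i)) = 0 := by
      have h1 := congrFun h (τ (Sum.inl i))
      rw [Pi.smul_apply, hz0, smul_zero, ← map_zero (algebraMap A (Localization.Away f))] at h1
      obtain ⟨r, hr⟩ := IsLocalization.Away.exists_of_eq f h1
      exact ⟨r, by rw [hr, mul_zero]⟩
    choose r hr using h0
    have hs (i : Fin 2) : f ^ (r 0 + r 1) * v' (τ (Sum.inl i)) = 0 := by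
      fin_cases i
      · simp only [pow_add, Fin.zero_eta]; rw [mul_right_comm, hr, zero_mul]
      · simp only [pow_add, Fin.mk_one]; rw [mul_assoc, hr, mul_zero]
    have h2 : e (fun j ↦ f ^ (r 0 + r 1) * v' (τ (Sum.inr j))) = 0 := by
      rw [he, Submodule.mkQ_apply, Submodule.Quotient.mk_eq_zero]
      convert N.smul_mem (f ^ (r 0 + r 1)) hv' using 1
      ext k
      obtain ⟨k, rfl⟩ := τ.surjective k
      rcases k with k | k
      · simp [hs]
      · simp
    obtain ⟨t, ht⟩ := hinj _ h2
    ext k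
    obtain ⟨k, rfl⟩ := τ.surjective k
    rcases k with k | k
    · exact hz0 k
    · have h3 := congrFun h (τ (Sum.inr k))
      have h4 := congrArg φ (congrFun ht k)
      simp only [Pi.smul_apply, smul_eq_mul, map_mul, map_pow, Pi.zero_apply, map_zero] at h3 h4
      change φ (v' _) = φ f ^ m * _ at h3
      rw [h3, ← mul_assoc, ← mul_assoc] at h4
      exact (((hφ.pow t).mul (hφ.pow (r 0 + r 1))).mul (hφ.pow m)).mul_right_eq_zero.mp
        (by rw [← h4])

theorem exists_splitting (a : Fin 2 → Fin 4) (ha : Function.Injective a) :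
    ∃ τ : Splitting, ∀ j, τ (Sum.inr j) = a j := by
  classical
  have hcard : Fintype.card ↥((Set.range a)ᶜ : Set (Fin 4)) = 2 := by
    rw [Fintype.card_compl_set, Set.card_range_of_injective ha, Fintype.card_fin, Fintype.card_fin]
  let g := (Fintype.equivFinOfCardEq hcard).symm
  refine ⟨(Equiv.sumComm _ _).trans ((Equiv.sumCongr (Equiv.ofInjective a ha) g).trans
    (Equiv.Set.sumCompl (Set.range a))), fun j ↦ ?_⟩
  simp only [Equiv.trans_apply, Equiv.sumComm_apply, Sum.swap_inr, Equiv.sumCongr_apply,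
    Sum.map_inl]
  exact Equiv.Set.sumCompl_apply_inl _ _

/-- Over the local ring at a maximal ideal, the images of the four basis vectors span a free module
of rank two, so two of them form a basis. The resulting map `e` from a free module of rank two is an
isomorphism at `m`, hence over a basic open neighbourhood, by finite presentation. -/
theorem isLocallyGraph_of_projective (N : Submodule A (Fin 4 → A))
    [Module.Finite A ((Fin 4 → A) ⧸ N)] [Module.Projective A ((Fin 4 → A) ⧸ N)]
    (h : ∀ p, Module.rankAtStalk (R := A) ((Fin 4 → A) ⧸ N) p = 2) : IsLocallyGraph N := by
  by_contra hne
  obtain ⟨m, hm, hTm⟩ := Ideal.exists_le_maximal _ hne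
  have hmp := hm.isPrime
  have := Module.finitePresentation_of_projective A ((Fin 4 → A) ⧸ N)
  let Q := LocalizedModule m.primeCompl ((Fin 4 → A) ⧸ N)
  let l : ((Fin 4 → A) ⧸ N) →ₗ[A] Q := LocalizedModule.mkLinearMap _ _
  have hQ : Module.finrank (Localization.AtPrime m) Q = 2 := h ⟨m, hmp⟩
  let v : Fin 4 → Q := fun i ↦ l (N.mkQ (Pi.single i 1))
  have hv : Submodule.span (Localization.AtPrime m) (Set.range v) = ⊤ := by
    have h1 : Submodule.span A (Set.range fun i ↦ N.mkQ (Pi.single i 1)) = ⊤ := by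
      have := (Pi.basisFun A (Fin 4)).span_eq
      have h2 := congrArg (Submodule.map N.mkQ) this
      rw [Submodule.map_top, Submodule.range_mkQ, Submodule.map_span, ← Set.range_comp] at h2
      rw [← h2]
      congr 2
      ext i
      simp
    have := span_eq_top_of_isLocalizedModule (Localization.AtPrime m) m.primeCompl l h1
    rwa [← Set.range_comp] at this
  obtain ⟨κ, a, b, hb⟩ := Module.exists_basis_of_span_of_flat v hv
  have : Finite κ := Module.Finite.finite_basis b
  have hcard : Nat.card κ = 2 := by rw [← Module.finrank_eq_nat_card_basis b, hQ]
  let c : Fin 2 ≃ κ := (Finite.equivFinOfCardEq hcard).symm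
  have hainj : Function.Injective (a ∘ c) := by
    have : Nontrivial (Localization.AtPrime m) := inferInstance
    intro i j hij
    refine c.injective (b.injective ?_)
    rw [hb, hb]
    exact congrArg v hij
  obtain ⟨τ, hτ⟩ := exists_splitting (a ∘ c) hainj
  let e : (Fin 2 → A) →ₗ[A] ((Fin 4 → A) ⧸ N) := N.mkQ ∘ₗ
    LinearMap.pi fun k ↦ Sum.elim (fun _ ↦ 0) (fun j ↦ LinearMap.proj j) (τ.symm k)
  have he (w) : e w = N.mkQ (fun k ↦ Sum.elim (fun _ ↦ (0 : A)) w (τ.symm k)) := by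
    simp only [e, LinearMap.comp_apply]
    congr 1
    ext k
    rcases h : τ.symm k <;> simp [h]
  let l₁ : (Fin 2 → A) →ₗ[A] (Fin 2 → Localization.AtPrime m) :=
    LinearMap.pi fun i ↦ Algebra.linearMap A (Localization.AtPrime m) ∘ₗ LinearMap.proj i
  have hbij : Function.Bijective (IsLocalizedModule.map m.primeCompl l₁ l e) := by
    let B := b.reindex c.symm
    have : IsLocalizedModule.mapExtendScalars m.primeCompl l₁ l (Localization.AtPrime m) e =
        B.equivFun.symm.toLinearMap := by
      refine (Pi.basisFun _ _).ext fun i ↦ ?_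
      have h1 : Pi.basisFun (Localization.AtPrime m) (Fin 2) i = l₁ (Pi.single i 1) := by
        ext j
        simp [l₁, Pi.single_apply, apply_ite]
      have h2 : e (Pi.single i 1) = N.mkQ (Pi.single (a (c i)) 1) := by
        rw [he]
        congr 1
        ext k
        obtain ⟨k, rfl⟩ := τ.surjective k
        have hτi : a (c i) = τ (Sum.inr i) := (hτ i).symm
        rcases k with k | k <;> simp [hτi, Pi.single_apply]
      rw [h1, IsLocalizedModule.mapExtendScalars_apply_apply, IsLocalizedModule.map_apply, h2,
        ← h1, LinearEquiv.coe_coe]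
      simp [B, hb, v]
    have h2 : ⇑(IsLocalizedModule.map m.primeCompl l₁ l e) = ⇑B.equivFun.symm :=
      congrArg DFunLike.coe this
    rw [h2]
    exact B.equivFun.symm.bijective
  obtain ⟨f, hf, hbij⟩ := Module.FinitePresentation.exists_notMem_bijective e m l₁ l hbij
  refine hf (hTm (Ideal.subset_span ⟨τ, exists_extend_eq_graph N τ f e he ?_ ?_⟩))
  · intro w hw
    have h1 : LocalizedModule.map (Submonoid.powers f) e (LocalizedModule.mk w 1) = 0 := by
      rw [LocalizedModule.map_mk, hw, LocalizedModule.zero_mk]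
    have h2 := hbij.1 (h1.trans (map_zero _).symm)
    rw [← LocalizedModule.zero_mk 1, LocalizedModule.mk_eq] at h2
    obtain ⟨⟨_, n, rfl⟩, hn⟩ := h2
    exact ⟨n, by simpa [Submonoid.smul_def] using hn⟩
  · intro x
    obtain ⟨y, hy⟩ := hbij.2 (LocalizedModule.mk x 1)
    induction y using LocalizedModule.induction_on with
    | _ w s =>
    rw [LocalizedModule.map_mk, LocalizedModule.mk_eq] at hy
    obtain ⟨⟨_, n, rfl⟩, hn⟩ := hy
    obtain ⟨_, r, rfl⟩ := s
    refine ⟨n + r, f ^ n • w, ?_⟩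
    rw [map_smul, pow_add, mul_smul]
    simpa [Submonoid.smul_def] using hn

end Quotients

end QuarticBitangents

/-! ### Comparison with Mathlib's Grassmannian functor. -/

namespace QuarticBitangents

theorem isLocallyGraph_lineInCoordinates {A : CommAlgCat.{0} ℂ} (N : linesFunctor.obj A) :
    IsLocallyGraph (lineInCoordinates N) := by
  let N' : Module.Grassmannian A (A ⊗[ℂ] (Fin 4 → ℂ)) 2 := N
  let e : ((A ⊗[ℂ] (Fin 4 → ℂ)) ⧸ N'.toSubmodule) ≃ₗ[A] ((Fin 4 → A) ⧸ lineInCoordinates N) :=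
    Submodule.Quotient.equiv _ _ (TensorProduct.piScalarRight ℂ A A (Fin 4)) rfl
  have := N'.finite_quotient
  have := N'.projective_quotient
  have : Module.Finite A ((Fin 4 → A) ⧸ lineInCoordinates N) := Module.Finite.equiv e
  have : Module.Projective A ((Fin 4 → A) ⧸ lineInCoordinates N) := Module.Projective.of_equiv e
  refine isLocallyGraph_of_projective _ fun p ↦ ?_
  rw [← Module.rankAtStalk_eq_of_equiv e]
  exact N'.rankAtStalk_eq p

/-- The point of the Grassmannian functor given by a submodule of `A⁴` which is locally a graph. -/
noncomputable def lineOfIsLocallyGraph {A : CommAlgCat.{0} ℂ} (N : Submodule A (Fin 4 → A))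
    (h : IsLocallyGraph N) : linesFunctor.obj A :=
  let e : ((A ⊗[ℂ] (Fin 4 → ℂ)) ⧸
      N.map (TensorProduct.piScalarRight ℂ A A (Fin 4)).symm.toLinearMap) ≃ₗ[A] ((Fin 4 → A) ⧸ N) :=
    (Submodule.Quotient.equiv _ _ (TensorProduct.piScalarRight ℂ A A (Fin 4)).symm rfl).symm
  show Module.Grassmannian A (A ⊗[ℂ] (Fin 4 → ℂ)) 2 from
  { toSubmodule := N.map (TensorProduct.piScalarRight ℂ A A (Fin 4)).symm.toLinearMap
    finite_quotient := by
      have := h.finitePresentation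
      exact Module.Finite.equiv e.symm
    projective_quotient := by
      have := h.projective
      exact Module.Projective.of_equiv e.symm
    rankAtStalk_eq := fun p ↦ by
      rw [Module.rankAtStalk_eq_of_equiv e]
      exact h.rankAtStalk_eq p }

theorem lineInCoordinates_lineOfIsLocallyGraph {A : CommAlgCat.{0} ℂ}
    (N : Submodule A (Fin 4 → A)) (h : IsLocallyGraph N) :
    lineInCoordinates (lineOfIsLocallyGraph N h) = N := by
  change (N.map (TensorProduct.piScalarRight ℂ A A (Fin 4)).symm.toLinearMap).map
    (TensorProduct.piScalarRight ℂ A A (Fin 4)).toLinearMap = N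
  rw [← Submodule.map_comp]
  convert Submodule.map_id N
  ext : 1
  simp

theorem lineInCoordinates_injective {A : CommAlgCat.{0} ℂ} :
    Function.Injective (lineInCoordinates (A := A)) := by
  intro N N' h
  refine Module.Grassmannian.ext (R := A) (M := A ⊗[ℂ] (Fin 4 → ℂ)) (k := 2) ?_
  exact Submodule.map_injective_of_injective
    (TensorProduct.piScalarRight ℂ A A (Fin 4)).injective h

/-- Families of lines as submodules of `A⁴`. -/
noncomputable def linesEquiv (A : CommAlgCat.{0} ℂ) :
    linesFunctor.obj A ≃ {N : Submodule A (Fin 4 → A) // IsLocallyGraph N} where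
  toFun N := ⟨lineInCoordinates N, isLocallyGraph_lineInCoordinates N⟩
  invFun N := lineOfIsLocallyGraph N.1 N.2
  left_inv _ := lineInCoordinates_injective (lineInCoordinates_lineOfIsLocallyGraph _ _)
  right_inv _ := Subtype.ext (lineInCoordinates_lineOfIsLocallyGraph _ _)

theorem piScalarRight_cancelBaseChange {A B : Type} [CommRing A] [CommRing B] [Algebra ℂ A]
    [Algebra ℂ B] [Algebra A B] [IsScalarTower ℂ A B] (b : B) (m : A ⊗[ℂ] (Fin 4 → ℂ)) :
    TensorProduct.piScalarRight ℂ B B (Fin 4)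
      (TensorProduct.AlgebraTensorModule.cancelBaseChange ℂ A B B (Fin 4 → ℂ) (b ⊗ₜ[A] m)) =
    b • fun i ↦ algebraMap A B (TensorProduct.piScalarRight ℂ A A (Fin 4) m i) := by
  induction m using TensorProduct.induction_on with
  | zero => ext; simp
  | add x y hx hy =>
    rw [TensorProduct.tmul_add, map_add, map_add, hx, hy]
    ext
    simp [mul_add]
  | tmul a v =>
    ext i
    simp [Algebra.smul_def]
    rw [← IsScalarTower.algebraMap_apply ℂ A B]
    ring

/-- The Grassmannian functor transports a submodule as the kernel of the base-changed quotient map;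
right exactness identifies it with the submodule generated by the image. This is the naturality of
`pointsIso`. -/
theorem lineInCoordinates_map {A B : CommAlgCat.{0} ℂ} (f : A ⟶ B) (N : linesFunctor.obj A) :
    lineInCoordinates (linesFunctor.map f N) =
      extend (f.hom : A →+* B) (lineInCoordinates N) := by
  let P : Submodule A (A ⊗[ℂ] (Fin 4 → ℂ)) := Module.Grassmannian.toSubmodule
    (R := A) (M := A ⊗[ℂ] (Fin 4 → ℂ)) (k := 2) N
  let : Algebra A B := f.hom.toRingHom.toAlgebra
  let : IsScalarTower ℂ A B := IsScalarTower.of_algebraMap_eq fun r ↦ (f.hom.commutes r).symm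
  change ((Module.Grassmannian.baseChangeMkQ B P).ker).map
    (TensorProduct.piScalarRight ℂ B B (Fin 4)).toLinearMap = extend (algebraMap A B)
      (P.map (TensorProduct.piScalarRight ℂ A A (Fin 4)).toLinearMap)
  apply le_antisymm
  · rintro _ ⟨z, hz, rfl⟩
    have h1 : (TensorProduct.AlgebraTensorModule.cancelBaseChange ℂ A B B (Fin 4 → ℂ)).symm z ∈
      (LinearMap.lTensor B P.mkQ).ker := hz
    rw [lTensor_mkQ] at h1
    obtain ⟨y, hy⟩ := h1
    rw [LinearEquiv.eq_symm_apply] at hy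
    rw [← hy]
    clear hy hz
    induction y using TensorProduct.induction_on with
    | zero => simp
    | add x y hx hy =>
      rw [map_add, map_add, map_add]
      exact Submodule.add_mem _ hx hy
    | tmul b n =>
      rw [LinearMap.lTensor_tmul, LinearEquiv.coe_coe, piScalarRight_cancelBaseChange]
      exact Submodule.smul_mem _ b (mem_extend _ ⟨n, n.2, rfl⟩)
  · rw [extend_le_iff]
    rintro _ ⟨p, hp, rfl⟩
    refine ⟨TensorProduct.AlgebraTensorModule.cancelBaseChange ℂ A B B (Fin 4 → ℂ) (1 ⊗ₜ[A] p),
      ?_, ?_⟩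
    · change Module.Grassmannian.baseChangeMkQ B P _ = 0
      rw [Module.Grassmannian.baseChangeMkQ, LinearMap.comp_apply, LinearEquiv.coe_coe,
        LinearEquiv.symm_apply_apply, LinearMap.baseChange_tmul, Submodule.mkQ_apply,
        (Submodule.Quotient.mk_eq_zero P).mpr hp, TensorProduct.tmul_zero]
    · rw [LinearEquiv.coe_coe, piScalarRight_cancelBaseChange, one_smul]
      rfl

end QuarticBitangents

/-! ### The Grassmannian over `ℂ` and its affine charts. -/

namespace QuarticBitangents

open Limits

/-- The coordinate ring of a chart of the Grassmannian over `ℂ`. -/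
abbrev ChartRing : Type := MvPolynomial (Fin 2 × Fin 2) ℂ

/-- The Grassmannian of lines of `ℙ³` over `ℂ`. -/
noncomputable def grassmannian : Over (Spec (CommRingCat.of ℂ)) :=
  Over.mk (pullback.snd (specZIsTerminal.from linesAtlas.scheme)
    (specZIsTerminal.from (Spec (CommRingCat.of ℂ))))

/-- The projection of the complex Grassmannian to the integral one. -/
noncomputable def grassmannianFst : grassmannian.left ⟶ linesAtlas.scheme :=
  pullback.fst (specZIsTerminal.from linesAtlas.scheme)
    (specZIsTerminal.from (Spec (CommRingCat.of ℂ)))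

theorem grassmannian_isPullback : IsPullback grassmannianFst grassmannian.hom
    (specZIsTerminal.from linesAtlas.scheme) (specZIsTerminal.from (Spec (CommRingCat.of ℂ))) :=
  IsPullback.of_hasPullback _ _

noncomputable def overHomEquiv (T : Over (Spec (CommRingCat.of ℂ))) :
    (T ⟶ grassmannian) ≃ (T.left ⟶ linesAtlas.scheme) where
  toFun x := x.left ≫ grassmannianFst
  invFun a := Over.homMk (grassmannian_isPullback.lift a T.hom (specZIsTerminal.hom_ext _ _))
    (grassmannian_isPullback.lift_snd _ _ _)
  left_inv x := by
    ext1
    refine grassmannian_isPullback.hom_ext ?_ ?_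
    · exact grassmannian_isPullback.lift_fst _ _ _
    · exact (grassmannian_isPullback.lift_snd _ _ _).trans (Over.w x).symm
  right_inv a := grassmannian_isPullback.lift_fst _ _ _

noncomputable def pointsEquiv (A : CommAlgCat.{0} ℂ) :
    (pointsFunctor grassmannian).obj A ≃ linesFunctor.obj A :=
  ((overHomEquiv ((algSpec (CommRingCat.of ℂ)).obj (op A))).trans
    (linesAtlas.homEquiv (CommRingCat.of A))).trans (linesEquiv A).symm

theorem lineInCoordinates_pointsEquiv {A : CommAlgCat.{0} ℂ}
    (x : (algSpec (CommRingCat.of ℂ)).obj (op A) ⟶ grassmannian) :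
    lineInCoordinates (pointsEquiv A x) =
      (linesAtlas.homEquiv (CommRingCat.of A) (x.left ≫ grassmannianFst)).1 :=
  congrArg Subtype.val ((linesEquiv A).apply_symm_apply
    (linesAtlas.homEquiv (CommRingCat.of A) (x.left ≫ grassmannianFst)))

theorem lineInCoordinates_pointsEquiv_map {A B : CommAlgCat.{0} ℂ} (f : A ⟶ B)
    (x : (algSpec (CommRingCat.of ℂ)).obj (op A) ⟶ grassmannian) :
    lineInCoordinates (pointsEquiv B ((algSpec (CommRingCat.of ℂ)).map f.op ≫ x)) =
      extend (f.hom : A →+* B) (lineInCoordinates (pointsEquiv A x)) := by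
  rw [lineInCoordinates_pointsEquiv, lineInCoordinates_pointsEquiv]
  have h := linesAtlas.homEquiv_comp (A := CommRingCat.of A) (B := CommRingCat.of B)
    (CommRingCat.ofHom (f.hom : A →+* B)) (x.left ≫ grassmannianFst)
  have h' := (congrArg (linesAtlas.homEquiv (CommRingCat.of B)) (Category.assoc
    (Spec.map (CommRingCat.ofHom (f.hom : A →+* B))) x.left grassmannianFst)).trans h
  exact congrArg Subtype.val h'

/-- The identification of the functor of points of the Grassmannian. -/
noncomputable def pointsIso : pointsFunctor grassmannian ≅ linesFunctor :=
  NatIso.ofComponents (fun A ↦ (pointsEquiv A).toIso) fun {A B} f ↦ by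
    ext x
    apply lineInCoordinates_injective
    exact (lineInCoordinates_pointsEquiv_map f x).trans (lineInCoordinates_map f _).symm

/-- The family of lines in coordinates defined by a point of the Grassmannian. -/
noncomputable abbrev coords {A : CommAlgCat.{0} ℂ}
    (x : (algSpec (CommRingCat.of ℂ)).obj (op A) ⟶ grassmannian) : Submodule A (Fin 4 → A) :=
  lineInCoordinates (pointsIso.hom.app A x)

theorem coords_comp {A B : CommAlgCat.{0} ℂ} (f : A ⟶ B)
    (x : (algSpec (CommRingCat.of ℂ)).obj (op A) ⟶ grassmannian) :
    coords ((algSpec (CommRingCat.of ℂ)).map f.op ≫ x) = extend (f.hom : A →+* B) (coords x) :=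
  lineInCoordinates_pointsEquiv_map f x

theorem coords_injective {A : CommAlgCat.{0} ℂ} :
    Function.Injective (coords (A := A)) := fun _ _ h ↦
  (pointsEquiv A).injective (lineInCoordinates_injective h)

theorem isLocallyGraph_coords {A : CommAlgCat.{0} ℂ}
    (x : (algSpec (CommRingCat.of ℂ)).obj (op A) ⟶ grassmannian) : IsLocallyGraph (coords x) :=
  isLocallyGraph_lineInCoordinates _

/-- The affine charts of the complex Grassmannian. -/
noncomputable def chartHom (σ : Splitting) :
    (algSpec (CommRingCat.of ℂ)).obj (op (CommAlgCat.of ℂ ChartRing)) ⟶ grassmannian :=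
  (overHomEquiv _).symm
    (Spec.map (CommRingCat.ofHom (MvPolynomial.map (algebraMap ℤ ℂ))) ≫ linesAtlas.chart σ)

theorem chartHom_left_fst (σ : Splitting) : (chartHom σ).left ≫ grassmannianFst =
    Spec.map (CommRingCat.ofHom (MvPolynomial.map (algebraMap ℤ ℂ))) ≫ linesAtlas.chart σ :=
  (overHomEquiv _).apply_symm_apply _

theorem coords_chartHom (σ : Splitting) : coords (chartHom σ) = graph σ (genericMatrix ℂ) := by
  refine (lineInCoordinates_pointsEquiv _).trans ?_
  refine (congrArg Subtype.val ((congrArg (linesAtlas.homEquiv (CommRingCat.of ChartRing))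
    (chartHom_left_fst σ)).trans (linesAtlas.homEquiv_chart (A := CommRingCat.of ChartRing)
      (CommRingCat.ofHom (MvPolynomial.map (algebraMap ℤ ℂ)))))).trans ?_
  change extend (MvPolynomial.map (algebraMap ℤ ℂ)) (graph σ (genericMatrix ℤ)) = _
  rw [extend_graph]
  congr 1
  ext i j
  simp [genericMatrix]

/-- Paste the square defining the complex Grassmannian with the one expressing that a polynomial
ring over `ℂ` is the base change of the one over `ℤ`. It transfers openness and joint surjectivity
of the charts from the integral Grassmannian. -/
theorem chartHom_isPullback (σ : Splitting) : IsPullback (chartHom σ).left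
    (Spec.map (CommRingCat.ofHom (MvPolynomial.map (algebraMap ℤ ℂ)))) grassmannianFst
    (linesAtlas.chart σ) := by
  have h : IsPullback (Spec.map (CommRingCat.ofHom (MvPolynomial.map (σ := Fin 2 × Fin 2)
      (algebraMap ℤ ℂ)))) (Spec.map (CommRingCat.ofHom (algebraMap ℂ ChartRing)))
      (Spec.map (CommRingCat.ofHom (algebraMap ℤ (MvPolynomial (Fin 2 × Fin 2) ℤ))))
      (Spec.map (CommRingCat.ofHom (algebraMap ℤ ℂ))) := by
    apply isPullback_SpecMap_of_isPushout
    let : Algebra (MvPolynomial (Fin 2 × Fin 2) ℤ) ChartRing :=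
      MvPolynomial.algebraMvPolynomial
    exact (CommRingCat.isPushout_of_isPushout ℤ (MvPolynomial (Fin 2 × Fin 2) ℤ) ℂ ChartRing)
  have hw : (chartHom σ).left ≫ grassmannian.hom =
      Spec.map (CommRingCat.ofHom (algebraMap ℂ ChartRing)) := Over.w (chartHom σ)
  have key {v : Spec (CommRingCat.of ChartRing) ⟶ Spec (CommRingCat.of ℂ)}
      (hv : v = Spec.map (CommRingCat.ofHom (algebraMap ℂ ChartRing))) :
      IsPullback (Spec.map (CommRingCat.ofHom (MvPolynomial.map (σ := Fin 2 × Fin 2)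
        (algebraMap ℤ ℂ)))) v (linesAtlas.chart σ ≫ specZIsTerminal.from linesAtlas.scheme)
        (specZIsTerminal.from (Spec (CommRingCat.of ℂ))) := by
    subst hv
    convert h using 1
    · exact specZIsTerminal.hom_ext _ _
    · exact specZIsTerminal.hom_ext _ _
  exact (IsPullback.of_bot (key hw) (chartHom_left_fst σ).symm grassmannian_isPullback).flip

theorem isOpenImmersion_chart (H : AffineAtlas) (j : H.J) : IsOpenImmersion (H.chart j) :=
  inferInstance

instance (σ : Splitting) : IsOpenImmersion (chartHom σ).left :=
  MorphismProperty.of_isPullback (P := @IsOpenImmersion) (chartHom_isPullback σ).flip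
    (isOpenImmersion_chart linesAtlas σ)

theorem chartHom_jointly_surjective (x : grassmannian.left) :
    ∃ σ, x ∈ (chartHom σ).left.opensRange := by
  obtain ⟨(σ : Splitting), y, hy⟩ := linesAtlas.chart_jointly_surjective (grassmannianFst x)
  obtain ⟨z, hz, -⟩ := Scheme.Pullback.exists_preimage_pullback x y hy.symm
  refine ⟨σ, (chartHom_isPullback σ).isoPullback.inv z, ?_⟩
  rw [← hz]
  exact congr($((chartHom_isPullback σ).isoPullback_inv_fst) z)

end QuarticBitangents

namespace QuarticBitangents

/-! ### Restriction of a quartic form to a parametrised line. -/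

open Polynomial in
/-- The restriction `F(s v + w)` of a form to a parametrised line, as a polynomial in `s`. -/
noncomputable def lineForm (F : MvPolynomial (Fin 4) ℂ) {A : Type} [CommRing A] [Algebra ℂ A]
    (v w : Fin 4 → A) : A[X] :=
  MvPolynomial.aeval (fun i ↦ C (v i) * X + C (w i)) F

section lineForm

variable (F : MvPolynomial (Fin 4) ℂ) {A B : Type} [CommRing A] [Algebra ℂ A] [CommRing B]
  [Algebra ℂ B]

theorem map_aeval (φ : A →ₐ[ℂ] B) (v : Fin 4 → A) :
    φ (MvPolynomial.aeval v F) = MvPolynomial.aeval (fun i ↦ φ (v i)) F := by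
  rw [← MvPolynomial.comp_aeval_apply]

theorem lineForm_map (φ : A →ₐ[ℂ] B) (v w : Fin 4 → A) :
    (lineForm F v w).map (φ : A →+* B) = lineForm F (fun i ↦ φ (v i)) (fun i ↦ φ (w i)) := by
  have := MvPolynomial.comp_aeval_apply (Polynomial.mapAlgHom φ)
    (f := fun i ↦ Polynomial.C (v i) * Polynomial.X + Polynomial.C (w i)) F
  simpa [lineForm] using this

theorem eval_lineForm (v w : Fin 4 → A) (s : A) :
    (lineForm F v w).eval s = MvPolynomial.aeval (s • v + w) F := by
  have := MvPolynomial.comp_aeval_apply ((Polynomial.aeval (R := A) s).restrictScalars ℂ)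
    (f := fun i ↦ Polynomial.C (v i) * Polynomial.X + Polynomial.C (w i)) F
  simp only [AlgHom.coe_restrictScalars', Polynomial.coe_aeval_eq_eval] at this
  rw [lineForm, this]
  congr 2
  ext i
  simp only [Polynomial.eval_add, Polynomial.eval_mul, Polynomial.eval_C, Polynomial.eval_X,
    Pi.add_apply, Pi.smul_apply, smul_eq_mul]
  ring

variable {F} (hF : F.IsHomogeneous 4)
include hF

/-- On the span of two generic multiples, `F` is a binary form of degree four whose dehomogenization
is `lineForm`; homogenizing recovers it with the same coefficients. -/
theorem aeval_smul_add_smul (v w : Fin 4 → A) (s t : A) :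
    MvPolynomial.aeval (s • v + t • w) F =
      (lineForm F v w).coeff 4 * s ^ 4 + (lineForm F v w).coeff 3 * s ^ 3 * t +
      (lineForm F v w).coeff 2 * s ^ 2 * t ^ 2 + (lineForm F v w).coeff 1 * s * t ^ 3 +
      (lineForm F v w).coeff 0 * t ^ 4 := by
  let g : Fin 4 → MvPolynomial (Fin 2) A := fun i ↦
    MvPolynomial.C (v i) * MvPolynomial.X 0 + MvPolynomial.C (w i) * MvPolynomial.X 1
  have hg : (MvPolynomial.aeval g F).IsHomogeneous 4 := by
    have := hF.eval₂ (n := 1) (algebraMap ℂ (MvPolynomial (Fin 2) A)) g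
      (fun r ↦ MvPolynomial.isHomogeneous_C _ (algebraMap ℂ A r)) fun i ↦
        ((MvPolynomial.isHomogeneous_X _ _).C_mul _).add
          ((MvPolynomial.isHomogeneous_X _ _).C_mul _)
    rw [one_mul] at this
    exact this
  have h1 : MvPolynomial.aeval ![Polynomial.X, 1] (MvPolynomial.aeval g F) = lineForm F v w := by
    have := MvPolynomial.comp_aeval_apply
      ((MvPolynomial.aeval (R := A) ![(Polynomial.X : Polynomial A), 1]).restrictScalars ℂ)
      (f := g) F
    simpa [lineForm, g, Polynomial.C_eq_algebraMap] using this
  have h2 := Polynomial.homogenize_eq_of_isHomogeneous hg h1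
  have h3 := MvPolynomial.comp_aeval_apply
    ((MvPolynomial.aeval (R := A) ![s, t]).restrictScalars ℂ) (f := g) F
  simp only [AlgHom.coe_restrictScalars'] at h3
  rw [← h2] at h3
  have h4 : (fun i ↦ MvPolynomial.aeval (R := A) ![s, t] (g i)) = s • v + t • w := by
    ext i
    simp [g, mul_comm]
  rw [h4] at h3
  rw [← h3, Polynomial.homogenize]
  simp only [map_sum, Finset.Nat.antidiagonal_succ, Finset.Nat.antidiagonal_zero]
  simp [MvPolynomial.aeval_monomial, Finsupp.prod_fintype]
  ring

theorem lineForm_eq (v w : Fin 4 → A) :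
    lineForm F v w = Polynomial.C ((lineForm F v w).coeff 4) * Polynomial.X ^ 4 +
      Polynomial.C ((lineForm F v w).coeff 3) * Polynomial.X ^ 3 +
      Polynomial.C ((lineForm F v w).coeff 2) * Polynomial.X ^ 2 +
      Polynomial.C ((lineForm F v w).coeff 1) * Polynomial.X +
      Polynomial.C ((lineForm F v w).coeff 0) := by
  have h := aeval_smul_add_smul hF (A := Polynomial A) (fun i ↦ Polynomial.C (v i))
    (fun i ↦ Polynomial.C (w i)) Polynomial.X 1
  have h1 := lineForm_map F (IsScalarTower.toAlgHom ℂ A (Polynomial A)) v w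
  have h2 (k : ℕ) : (lineForm F (fun i ↦ Polynomial.C (v i)) (fun i ↦ Polynomial.C (w i))).coeff k
      = Polynomial.C ((lineForm F v w).coeff k) := by
    have := congrArg (fun p ↦ Polynomial.coeff p k) h1
    simpa using this.symm
  simp only [h2, one_smul, one_pow, mul_one] at h
  rw [← h, lineForm]
  congr 2
  ext i : 1
  simp only [Pi.add_apply, Pi.smul_apply, smul_eq_mul]
  ring

theorem coeff_four_lineForm (v w : Fin 4 → A) :
    (lineForm F v w).coeff 4 = MvPolynomial.aeval v F := by
  simpa using (aeval_smul_add_smul hF v w 1 0).symm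

end lineForm

end QuarticBitangents

/-! ### The equations for being a constant times a square. -/

namespace QuarticBitangents

section SquareEquations

variable {A B : Type} [CommRing A] [CommRing B]

/-- The equations on the coefficients of a quartic polynomial with invertible leading coefficient
that express that it is a constant times a square. -/
def squareEqn (a : ℕ → A) : Fin 2 → A :=
  ![8 * a 4 ^ 2 * a 1 - a 3 * (4 * a 2 * a 4 - a 3 ^ 2),
    64 * a 4 ^ 3 * a 0 - (4 * a 2 * a 4 - a 3 ^ 2) ^ 2]

theorem map_squareEqn (φ : A →+* B) (a : ℕ → A) (i : Fin 2) :
    φ (squareEqn a i) = squareEqn (fun k ↦ φ (a k)) i := by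
  fin_cases i <;> simp [squareEqn, map_ofNat]

theorem squareEqn_eq_zero_of_eq {a : ℕ → A} {c α β γ : A} (h4 : a 4 = c * α ^ 2)
    (h3 : a 3 = c * (2 * α * β)) (h2 : a 2 = c * (β ^ 2 + 2 * α * γ))
    (h1 : a 1 = c * (2 * β * γ)) (h0 : a 0 = c * γ ^ 2) : squareEqn a = 0 := by
  ext i
  fin_cases i
  · simp only [squareEqn, Fin.zero_eta, Matrix.cons_val_zero, Pi.zero_apply, h1, h2, h3, h4]
    ring
  · simp only [squareEqn, Fin.mk_one, Matrix.cons_val_one, Matrix.cons_val_fin_one,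
      Pi.zero_apply, h0, h2, h3, h4]
    ring

theorem isUnit_natCast [Algebra ℂ A] {n : ℕ} (hn : n ≠ 0) : IsUnit (n : A) := by
  have h := (IsUnit.mk0 (n : ℂ) (Nat.cast_ne_zero.mpr hn)).map (algebraMap ℂ A)
  rwa [map_natCast] at h

/-- Comparison with `a₄(X² + βX + γ)²` forces `β = a₃ / (2a₄)` and `γ = (4a₂a₄ - a₃²) / (8a₄²)`. The
two equations are the remaining conditions on `a₁` and `a₀`, cleared of denominators. -/
theorem exists_eq_of_squareEqn_eq_zero [Algebra ℂ A] {a : ℕ → A} (ha : IsUnit (a 4))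
    (h : squareEqn a = 0) : ∃ β γ, a 3 = 2 * a 4 * β ∧ a 2 = a 4 * (β ^ 2 + 2 * γ) ∧
      a 1 = 2 * a 4 * β * γ ∧ a 0 = a 4 * γ ^ 2 := by
  obtain ⟨b, hb⟩ := ha.exists_right_inv
  obtain ⟨e, he⟩ := (isUnit_natCast (A := A) (n := 8) (by norm_num)).exists_right_inv
  push_cast at he
  have e1 : 8 * a 4 ^ 2 * a 1 - a 3 * (4 * a 2 * a 4 - a 3 ^ 2) = 0 := congrFun h 0
  have e0 : 64 * a 4 ^ 3 * a 0 - (4 * a 2 * a 4 - a 3 ^ 2) ^ 2 = 0 := congrFun h 1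
  -- Here `b = 1 / a₄` and `e = 1 / 8`, so `4 * e` stands for one half.
  have hβ : a 3 = 2 * a 4 * (4 * e * b * a 3) := by
    linear_combination (-a 3) * (8 * e) * hb - a 3 * he
  generalize hβ' : 4 * e * b * a 3 = β at hβ
  have hγ : a 2 = a 4 * (β ^ 2 + 2 * (4 * e * (b * a 2 - β ^ 2))) := by
    linear_combination (-a 2) * 8 * e * hb + (a 4 * β ^ 2 - a 2) * he
  generalize 4 * e * (b * a 2 - β ^ 2) = γ at hγ
  refine ⟨β, γ, hβ, hγ, ?_, ?_⟩
  · have h8 : 8 * a 4 ^ 2 * (a 1 - 2 * a 4 * β * γ) = 0 := by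
      rw [hβ, hγ] at e1
      linear_combination e1
    linear_combination (e * b ^ 2) * h8 - (a 1 - 2 * a 4 * β * γ) * (a 4 * b + 1) * 8 * e * hb -
      (a 1 - 2 * a 4 * β * γ) * he
  · have h8 : 64 * a 4 ^ 3 * (a 0 - a 4 * γ ^ 2) = 0 := by
      rw [hβ, hγ] at e0
      linear_combination e0
    have hu : IsUnit (64 * a 4 ^ 3) := by
      have := isUnit_natCast (A := A) (n := 64) (by norm_num)
      exact (by exact_mod_cast this : IsUnit (64 : A)).mul (ha.pow 3)
    exact sub_eq_zero.mp (hu.mul_right_eq_zero.mp h8)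

/-- Lagrange interpolation at 0, 1, 2, 3, 4: the inverse of the Vandermonde matrix has denominators
dividing 24, which is a unit. -/
theorem mem_of_quartic_values_mem [Algebra ℂ A] (I : Ideal A) (a : ℕ → A)
    (h : ∀ n : ℕ, n < 5 → a 4 * (n : A) ^ 4 + a 3 * (n : A) ^ 3 +
      a 2 * (n : A) ^ 2 + a 1 * (n : A) + a 0 ∈ I)
    {k : ℕ} (hk : k < 5) : a k ∈ I := by
  have hu : IsUnit (24 : A) := by
    exact_mod_cast isUnit_natCast (A := A) (n := 24) (by norm_num)
  have key (m0 m1 m2 m3 m4 : A) (x : A)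
      (hx : 24 * x = m0 * a 0 + m1 * (a 4 + a 3 + a 2 + a 1 + a 0) +
        m2 * (a 4 * 2 ^ 4 + a 3 * 2 ^ 3 + a 2 * 2 ^ 2 + a 1 * 2 + a 0) +
        m3 * (a 4 * 3 ^ 4 + a 3 * 3 ^ 3 + a 2 * 3 ^ 2 + a 1 * 3 + a 0) +
        m4 * (a 4 * 4 ^ 4 + a 3 * 4 ^ 3 + a 2 * 4 ^ 2 + a 1 * 4 + a 0)) : x ∈ I := by
    refine (Ideal.unit_mul_mem_iff_mem I hu).mp (hx ▸ ?_)
    have h0 := h 0 (by norm_num)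
    have h1 := h 1 (by norm_num)
    have h2 := h 2 (by norm_num)
    have h3 := h 3 (by norm_num)
    have h4 := h 4 (by norm_num)
    simp only [Nat.cast_zero, Nat.cast_one, Nat.cast_ofNat, one_pow, mul_one, ne_eq,
      OfNat.ofNat_ne_zero, not_false_eq_true, zero_pow, mul_zero, zero_add] at h0 h1 h2 h3 h4
    exact I.add_mem (I.add_mem (I.add_mem (I.add_mem (I.mul_mem_left _ h0) (I.mul_mem_left _ h1))
      (I.mul_mem_left _ h2)) (I.mul_mem_left _ h3)) (I.mul_mem_left _ h4)
  interval_cases k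
  -- The multipliers are the rows of 24 times the inverse Vandermonde matrix.
  · exact key 24 0 0 0 0 _ (by ring)
  · exact key (-50) 96 (-72) 32 (-6) _ (by ring)
  · exact key 35 (-104) 114 (-56) 11 _ (by ring)
  · exact key (-10) 36 (-48) 28 (-6) _ (by ring)
  · exact key 1 (-4) 6 (-4) 1 _ (by ring)

end SquareEquations

/-- The affine charts of the open subset of lines not contained in `X`: a chart of the Grassmannian
and a point of the line that is not on `X`. -/
abbrev ChartIndex : Type := Splitting × Fin 5

namespace ChartIndex

variable (i : ChartIndex) {A B : Type} [CommRing A] [CommRing B]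

/-- The point at infinity of the parametrisation of a line. -/
def dir (M : Matrix (Fin 2) (Fin 2) A) : Fin 4 → A :=
  row i.1 M 0 + ((i.2 : ℕ) : A) • row i.1 M 1

/-- The origin of the parametrisation of a line. -/
def base (M : Matrix (Fin 2) (Fin 2) A) : Fin 4 → A :=
  row i.1 M 1

theorem map_dir (φ : A →+* B) (M : Matrix (Fin 2) (Fin 2) A) :
    (fun k ↦ φ (i.dir M k)) = i.dir (M.map φ) := by
  ext k
  simp [dir, ← map_row]

theorem map_base (φ : A →+* B) (M : Matrix (Fin 2) (Fin 2) A) :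
    (fun k ↦ φ (i.base M k)) = i.base (M.map φ) :=
  map_row φ _ _ _

theorem dir_mem (M : Matrix (Fin 2) (Fin 2) A) : i.dir M ∈ graph i.1 M :=
  Submodule.add_mem _ (row_mem_graph _ _ _) (Submodule.smul_mem _ _ (row_mem_graph _ _ _))

theorem base_mem (M : Matrix (Fin 2) (Fin 2) A) : i.base M ∈ graph i.1 M :=
  row_mem_graph _ _ _

/-- The coordinates on a line in the parametrisation. -/
def coord (A : Type) [CommRing A] : (Fin 4 → A) →ₗ[A] (Fin 2 → A) :=
  LinearMap.pi ![LinearMap.proj (i.1 (Sum.inl 0)),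
    LinearMap.proj (i.1 (Sum.inl 1)) - ((i.2 : ℕ) : A) • LinearMap.proj (i.1 (Sum.inl 0))]

theorem coord_smul_add {M : Matrix (Fin 2) (Fin 2) A} {v : Fin 4 → A} (hv : v ∈ graph i.1 M) :
    i.coord A v 0 • i.dir M + i.coord A v 1 • i.base M = v := by
  conv_rhs => rw [← mem_graph_iff.mp hv]
  simp only [coord, dir, base, Fin.sum_univ_two, LinearMap.pi_apply, Matrix.cons_val_zero,
    Matrix.cons_val_one, Matrix.cons_val_fin_one, LinearMap.sub_apply, LinearMap.smul_apply,
    LinearMap.proj_apply]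
  module

variable (F : MvPolynomial (Fin 4) ℂ) [Algebra ℂ A] [Algebra ℂ B]

/-- The restriction of a form to a parametrised line in a chart. -/
noncomputable def form (M : Matrix (Fin 2) (Fin 2) A) : Polynomial A :=
  lineForm F (i.dir M) (i.base M)

theorem map_form (φ : A →ₐ[ℂ] B) (M : Matrix (Fin 2) (Fin 2) A) :
    (i.form F M).map (φ : A →+* B) = i.form F (M.map φ) := by
  rw [form, lineForm_map]
  congr 1
  · exact i.map_dir (φ : A →+* B) M
  · exact i.map_base (φ : A →+* B) M

theorem map_coeff_form (φ : A →ₐ[ℂ] B) (M : Matrix (Fin 2) (Fin 2) A) (k : ℕ) :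
    φ ((i.form F M).coeff k) = (i.form F (M.map φ)).coeff k := by
  rw [← map_form, Polynomial.coeff_map]
  rfl

/-- The equations of the scheme of bitangents in a chart. -/
noncomputable def eqn (M : Matrix (Fin 2) (Fin 2) A) : Fin 2 → A :=
  squareEqn (i.form F M).coeff

theorem map_eqn (φ : A →ₐ[ℂ] B) (M : Matrix (Fin 2) (Fin 2) A) (j : Fin 2) :
    φ (i.eqn F M j) = i.eqn F (M.map φ) j := by
  refine (map_squareEqn (φ : A →+* B) _ j).trans ?_
  congr 2
  ext k
  exact i.map_coeff_form F φ M k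

variable {F} (hF : F.IsHomogeneous 4)
include hF

theorem aeval_eq_form {M : Matrix (Fin 2) (Fin 2) A} {v : Fin 4 → A} (hv : v ∈ graph i.1 M) :
    MvPolynomial.aeval v F =
      (i.form F M).coeff 4 * i.coord A v 0 ^ 4 +
      (i.form F M).coeff 3 * i.coord A v 0 ^ 3 * i.coord A v 1 +
      (i.form F M).coeff 2 * i.coord A v 0 ^ 2 * i.coord A v 1 ^ 2 +
      (i.form F M).coeff 1 * i.coord A v 0 * i.coord A v 1 ^ 3 +
      (i.form F M).coeff 0 * i.coord A v 1 ^ 4 := by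
  conv_lhs => rw [← i.coord_smul_add hv]
  exact aeval_smul_add_smul hF _ _ _ _

/-- A quadratic form whose square is proportional to `F` exists on a line of a chart if and only if
the equations of the chart hold. -/
theorem exists_quadraticForm_iff {M : Matrix (Fin 2) (Fin 2) A}
    (hM : IsUnit ((i.form F M).coeff 4)) :
    (∃ (c : Aˣ) (Q : QuadraticForm A (graph i.1 M)),
      ∀ v : graph i.1 M, MvPolynomial.aeval (v : Fin 4 → A) F = c * Q v ^ 2) ↔
      i.eqn F M = 0 := by
  constructor
  · rintro ⟨c, Q, hQ⟩
    let v : graph i.1 M := ⟨_, i.dir_mem M⟩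
    let w : graph i.1 M := ⟨_, i.base_mem M⟩
    let a := (i.form F M).coeff
    -- Differences between the coefficients of `F` and those of `c * Q²` on `s • v + w`. All five
    -- values at `s = 0, …, 4` vanish, hence so do the differences; `Fin.ofNat 5` only extends the
    -- tuple to `ℕ`.
    let d : ℕ → A := ![a 0 - c * Q w ^ 2, a 1 - c * (2 * QuadraticMap.polar Q v w * Q w),
      a 2 - c * (QuadraticMap.polar Q v w ^ 2 + 2 * Q v * Q w),
      a 3 - c * (2 * Q v * QuadraticMap.polar Q v w), a 4 - c * Q v ^ 2] ∘ Fin.ofNat 5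
    have hd (n : ℕ) (_ : n < 5) : d 4 * (n : A) ^ 4 + d 3 * (n : A) ^ 3 + d 2 * (n : A) ^ 2 +
        d 1 * (n : A) + d 0 ∈ (⊥ : Ideal A) := by
      have h1 := hQ ((n : A) • v + (1 : A) • w)
      have h2 := aeval_smul_add_smul hF (i.dir M) (i.base M) (n : A) 1
      have h3 : Q ((n : A) • v + (1 : A) • w) =
          (n : A) ^ 2 * Q v + n * QuadraticMap.polar Q v w + Q w := by
        rw [one_smul, QuadraticMap.map_add Q, QuadraticMap.map_smul, QuadraticMap.polar_smul_left]
        simp only [smul_eq_mul]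
        ring
      rw [h3] at h1
      have h4 := h2.symm.trans h1
      change a 4 * (n : A) ^ 4 + a 3 * (n : A) ^ 3 * 1 + a 2 * (n : A) ^ 2 * 1 ^ 2 +
        a 1 * (n : A) * 1 ^ 3 + a 0 * 1 ^ 4 = _ at h4
      rw [Ideal.mem_bot]
      change (a 4 - c * Q v ^ 2) * (n : A) ^ 4 +
        (a 3 - c * (2 * Q v * QuadraticMap.polar Q v w)) * (n : A) ^ 3 +
        (a 2 - c * (QuadraticMap.polar Q v w ^ 2 + 2 * Q v * Q w)) * (n : A) ^ 2 +
        (a 1 - c * (2 * QuadraticMap.polar Q v w * Q w)) * (n : A) + (a 0 - c * Q w ^ 2) = 0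
      linear_combination h4
    have hz {k : ℕ} (hk : k < 5) : d k = 0 := by
      simpa using mem_of_quartic_values_mem ⊥ d hd hk
    exact squareEqn_eq_zero_of_eq (sub_eq_zero.mp (hz (k := 4) (by norm_num)))
      (sub_eq_zero.mp (hz (k := 3) (by norm_num))) (sub_eq_zero.mp (hz (k := 2) (by norm_num)))
      (sub_eq_zero.mp (hz (k := 1) (by norm_num))) (sub_eq_zero.mp (hz (k := 0) (by norm_num)))
  · intro h
    obtain ⟨β, γ, h3, h2, h1, h0⟩ := exists_eq_of_squareEqn_eq_zero hM h
    let ℓ (j : Fin 2) : graph i.1 M →ₗ[A] A :=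
      (LinearMap.proj j ∘ₗ i.coord A) ∘ₗ (graph i.1 M).subtype
    refine ⟨hM.unit, QuadraticMap.linMulLin (ℓ 0) (ℓ 0) + β • QuadraticMap.linMulLin (ℓ 0) (ℓ 1) +
      γ • QuadraticMap.linMulLin (ℓ 1) (ℓ 1), fun v ↦ ?_⟩
    rw [i.aeval_eq_form hF v.2, h0, h1, h2, h3]
    simp only [IsUnit.unit_spec, add_apply, smul_apply,
      QuadraticMap.linMulLin_apply, smul_eq_mul]
    change _ = (i.form F M).coeff 4 * (i.coord A v 0 * i.coord A v 0 +
      β * (i.coord A v 0 * i.coord A v 1) + γ * (i.coord A v 1 * i.coord A v 1)) ^ 2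
    ring

end ChartIndex

/-! ### Over a local ring the charts cover all families of lines. -/

theorem IsLocallyGraph.exists_eq_graph {A : Type} [CommRing A] [IsLocalRing A]
    {N : Submodule A (Fin 4 → A)} (h : IsLocallyGraph N) :
    ∃ (σ : Splitting) (M : Matrix (Fin 2) (Fin 2) A), N = graph σ M := by
  obtain ⟨f, ⟨σ, hσ⟩, hf⟩ : ∃ f ∈ {f : A | ∃ (σ : Splitting)
      (M : Matrix (Fin 2) (Fin 2) (Localization.Away f)),
      graph σ M = QuarticBitangents.extend (algebraMap A (Localization.Away f)) N}, IsUnit f := by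
    by_contra! hne
    exact (IsLocalRing.maximalIdeal.isMaximal A).ne_top
      (top_le_iff.mp (h.symm.le.trans (Ideal.span_le.mpr hne)))
  obtain ⟨M, hM⟩ := exists_graph_extend_of_isUnit (φ := RingHom.id A) hf hσ
  exact ⟨σ, M, by rw [hM, extend_id]⟩

section Cover

variable {F : MvPolynomial (Fin 4) ℂ} (hF : F.IsHomogeneous 4) (hL : ContainsNoLine F)

theorem finrank_graph (σ : Splitting) (M : Matrix (Fin 2) (Fin 2) ℂ) :
    Module.finrank ℂ (graph σ M) = 2 := by
  have h : LinearIndependent ℂ (row σ M) := by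
    refine Fintype.linearIndependent_iff.mpr fun g hg j ↦ ?_
    have := congrFun hg (σ (Sum.inl j))
    simpa [Matrix.one_apply] using this
  exact (finrank_span_eq_card h).trans (Fintype.card_fin 2)

-- By the Nullstellensatz a maximal ideal of the chart ring is a complex line; if it contained all
-- five coefficients, that line would lie on the surface.
include hF hL in
theorem span_coeff_lineForm_eq_top (σ : Splitting) :
    Ideal.span ((fun k ↦ (lineForm F (row σ (genericMatrix ℂ) 0)
      (row σ (genericMatrix ℂ) 1)).coeff k) '' Set.Iio 5) = ⊤ := by
  by_contra hne
  obtain ⟨m, hm, hle⟩ := Ideal.exists_le_maximal _ hne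
  obtain ⟨x, rfl⟩ := MvPolynomial.isMaximal_iff_eq_vanishingIdeal_singleton.mp hm
  let φ : ChartRing →ₐ[ℂ] ℂ := MvPolynomial.aeval x
  let M := (genericMatrix ℂ).map φ
  have hz {k : ℕ} (hk : k < 5) : (lineForm F (row σ M 0) (row σ M 1)).coeff k = 0 := by
    have h1 := (MvPolynomial.mem_vanishingIdeal_singleton_iff x _).mp
      (hle (Ideal.subset_span ⟨k, hk, rfl⟩))
    have h2 := congrArg (fun p ↦ p.coeff k)
      (lineForm_map F φ (row σ (genericMatrix ℂ) 0) (row σ (genericMatrix ℂ) 1))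
    simp only [Polynomial.coeff_map] at h2
    have h3 (j : Fin 2) := map_row (φ : ChartRing →+* ℂ) σ (genericMatrix ℂ) j
    simp only [RingHom.coe_coe] at h2 h3
    rw [h3, h3] at h2
    exact h2.symm.trans h1
  obtain ⟨v, hv, hv0⟩ := hL (graph σ M) (finrank_graph σ M)
  rw [← MvPolynomial.coe_aeval_eq_eval] at hv0
  apply hv0
  rw [← mem_graph_iff.mp hv, Fin.sum_univ_two]
  change MvPolynomial.aeval _ F = _
  rw [aeval_smul_add_smul hF, hz, hz, hz, hz, hz] <;> norm_num

-- If none of the five values `F(row 0 + t • row 1)` were a unit, interpolation would put every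
-- coefficient of the quartic in the maximal ideal, against `span_coeff_lineForm_eq_top`.
include hF hL in
theorem exists_isUnit_coeff_four {A : Type} [CommRing A] [Algebra ℂ A] [IsLocalRing A]
    (σ : Splitting) (M : Matrix (Fin 2) (Fin 2) A) :
    ∃ t : Fin 5, IsUnit ((ChartIndex.form (σ, t) F M).coeff 4) := by
  by_contra! hne
  let φ : ChartRing →ₐ[ℂ] A := MvPolynomial.aeval fun p ↦ M p.1 p.2
  have hφ : (genericMatrix ℂ).map φ = M := by
    ext i j
    simp [genericMatrix, φ]
  have hmem {k : ℕ} (hk : k < 5) : (lineForm F (row σ M 1) (row σ M 0)).coeff k ∈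
      IsLocalRing.maximalIdeal A := by
    refine mem_of_quartic_values_mem _ _ (fun n hn ↦ ?_) hk
    have h1 := hne ⟨n, hn⟩
    rw [ChartIndex.form, coeff_four_lineForm hF] at h1
    have h2 := aeval_smul_add_smul hF (row σ M 1) (row σ M 0) (n : A) 1
    simp only [one_pow, mul_one] at h2
    rw [← h2, one_smul, add_comm]
    exact h1
  -- The parameter `t` multiplies row 1, while the unit ideal is generated by the coefficients in
  -- the opposite order of the rows; this exchanges the two orders.
  have hsymm (v w : Fin 4 → A) {k : ℕ} (hk : k < 5)
      (h : ∀ {k}, k < 5 → (lineForm F w v).coeff k ∈ IsLocalRing.maximalIdeal A) :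
      (lineForm F v w).coeff k ∈ IsLocalRing.maximalIdeal A := by
    refine mem_of_quartic_values_mem _ _ (fun n hn ↦ ?_) hk
    have h2 := aeval_smul_add_smul hF v w (n : A) 1
    simp only [one_pow, mul_one] at h2
    rw [← h2, add_comm, aeval_smul_add_smul hF]
    have h' {k : ℕ} (hk : k < 5) (x : A) := Ideal.mul_mem_right x _ (h hk)
    simp only [mul_assoc]
    exact add_mem (add_mem (add_mem (add_mem (h' (by norm_num) _) (h' (by norm_num) _))
      (h' (by norm_num) _)) (h' (by norm_num) _)) (h' (by norm_num) _)
  have h1 := congrArg (Ideal.map φ) (span_coeff_lineForm_eq_top hF hL σ)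
  rw [Ideal.map_top, Ideal.map_span] at h1
  refine (IsLocalRing.maximalIdeal.isMaximal A).ne_top
    (top_le_iff.mp (h1.symm.le.trans (Ideal.span_le.mpr ?_)))
  rintro _ ⟨_, ⟨k, hk, rfl⟩, rfl⟩
  have h2 := congrArg (fun p ↦ p.coeff k)
    (lineForm_map F φ (row σ (genericMatrix ℂ) 0) (row σ (genericMatrix ℂ) 1))
  simp only [Polynomial.coeff_map] at h2
  have h3 (j : Fin 2) := map_row (φ : ChartRing →+* A) σ (genericMatrix ℂ) j
  simp only [RingHom.coe_coe] at h2 h3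
  rw [h3, h3, hφ] at h2
  exact h2.symm ▸ hsymm _ _ hk hmem

include hF hL in
/-- Over a local ring, every family of lines is in one of the charts. -/
theorem exists_chartIndex {A : Type} [CommRing A] [Algebra ℂ A] [IsLocalRing A]
    {N : Submodule A (Fin 4 → A)} (hN : IsLocallyGraph N) :
    ∃ (i : ChartIndex) (M : Matrix (Fin 2) (Fin 2) A),
      N = graph i.1 M ∧ IsUnit ((i.form F M).coeff 4) := by
  obtain ⟨σ, M, rfl⟩ := hN.exists_eq_graph
  obtain ⟨t, ht⟩ := exists_isUnit_coeff_four hF hL σ M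
  exact ⟨(σ, t), M, rfl, ht⟩

end Cover

end QuarticBitangents

/-! ### The Jacobian criterion at a bitangent. -/

namespace QuarticBitangents

theorem derivation_aeval {n : ℕ} {R : Type} [CommRing R] [Algebra ℂ R] (D : Derivation ℂ R R)
    (u : Fin n → R) (F : MvPolynomial (Fin n) ℂ) :
    D (MvPolynomial.aeval u F) =
      ∑ l, MvPolynomial.aeval u (MvPolynomial.pderiv l F) * D (u l) := by
  induction F using MvPolynomial.induction_on with
  | C a => simp
  | add p q hp hq => simp [hp, hq, add_mul, Finset.sum_add_distrib]
  | mul_X p k hp =>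
    simp only [map_mul, MvPolynomial.aeval_X, Derivation.leibniz, hp, smul_eq_mul,
      MvPolynomial.pderiv_X, map_add, add_mul, Finset.sum_add_distrib, Finset.mul_sum]
    congr 1
    · simp [Pi.single_apply, apply_ite, ite_mul]
    · exact Finset.sum_congr rfl fun l _ ↦ by ring

section Smooth

variable {F : MvPolynomial (Fin 4) ℂ}

/-- By Euler's formula a common zero of the partial derivatives lies on `F = 0`, so it is the
origin, and the Nullstellensatz applies. In this algebraic form smoothness passes from `ℂ` to all
residue fields. -/
theorem IsSmoothQuartic.exists_pow_mem (hF : IsSmoothQuartic F) (j : Fin 4) :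
    ∃ n, MvPolynomial.X j ^ n ∈ Ideal.span (Set.range fun i ↦ MvPolynomial.pderiv i F) := by
  rw [← Ideal.mem_radical_iff, ← MvPolynomial.vanishingIdeal_zeroLocus_eq_radical (K := ℂ),
    MvPolynomial.mem_vanishingIdeal_iff]
  intro x hx
  have hz (i) : MvPolynomial.eval x (MvPolynomial.pderiv i F) = 0 :=
    MvPolynomial.mem_zeroLocus_iff.mp hx _ (Ideal.subset_span ⟨i, rfl⟩)
  have h0 : MvPolynomial.eval x F = 0 := by
    have h := congrArg (MvPolynomial.eval x) hF.isHomogeneous.sum_X_mul_pderiv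
    simpa [hz] using h.symm
  by_contra hne
  have hx0 : x ≠ 0 := by
    rintro rfl
    simp at hne
  obtain ⟨i, hi⟩ := hF.jacobian x hx0 h0
  exact hi (hz i)

theorem IsSmoothQuartic.eq_zero_of_aeval_pderiv (hF : IsSmoothQuartic F) {K : Type} [Field K]
    [Algebra ℂ K] {u : Fin 4 → K}
    (h : ∀ i, MvPolynomial.aeval u (MvPolynomial.pderiv i F) = 0) : u = 0 := by
  ext j
  obtain ⟨n, hn⟩ := hF.exists_pow_mem j
  have hle : Ideal.span (Set.range fun i ↦ MvPolynomial.pderiv i F) ≤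
      RingHom.ker (MvPolynomial.aeval (R := ℂ) u) := by
    rw [Ideal.span_le]
    rintro _ ⟨i, rfl⟩
    exact h i
  have := hle hn
  rw [RingHom.mem_ker, map_pow, MvPolynomial.aeval_X] at this
  exact eq_zero_of_pow_eq_zero this

end Smooth

/-- The differential of `squareEqn`. -/
def squareEqnDeriv {A : Type} [CommRing A] (a d : ℕ → A) : Fin 2 → A :=
  ![16 * a 4 * d 4 * a 1 + 8 * a 4 ^ 2 * d 1 - d 3 * (4 * a 2 * a 4 - a 3 ^ 2) -
      a 3 * (4 * d 2 * a 4 + 4 * a 2 * d 4 - 2 * a 3 * d 3),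
    192 * a 4 ^ 2 * d 4 * a 0 + 64 * a 4 ^ 3 * d 0 - 2 * (4 * a 2 * a 4 - a 3 ^ 2) *
      (4 * d 2 * a 4 + 4 * a 2 * d 4 - 2 * a 3 * d 3)]

theorem map_squareEqnDeriv {A B : Type} [CommRing A] [CommRing B] (φ : A →+* B) (a d : ℕ → A)
    (j : Fin 2) : φ (squareEqnDeriv a d j) =
      squareEqnDeriv (fun k ↦ φ (a k)) (fun k ↦ φ (d k)) j := by
  fin_cases j <;> simp [squareEqnDeriv, map_ofNat]

theorem derivation_squareEqn {R : Type} [CommRing R] [Algebra ℂ R] (D : Derivation ℂ R R)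
    (a : ℕ → R) (j : Fin 2) :
    D (squareEqn a j) = squareEqnDeriv a (fun k ↦ D (a k)) j := by
  have hD (n : ℕ) [n.AtLeastTwo] : D (OfNat.ofNat n : R) = 0 := D.map_natCast n
  fin_cases j
  · simp only [squareEqn, squareEqnDeriv, Fin.zero_eta, Matrix.cons_val_zero, map_sub,
      Derivation.leibniz, Derivation.leibniz_pow, hD, smul_eq_mul, nsmul_eq_mul]
    push_cast
    ring
  · simp only [squareEqn, squareEqnDeriv, Fin.mk_one, Matrix.cons_val_one,
      Matrix.cons_val_fin_one, map_sub, Derivation.leibniz, Derivation.leibniz_pow, hD,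
      smul_eq_mul, nsmul_eq_mul]
    push_cast
    ring

theorem squareEqnDeriv_sum {A ι : Type} [CommRing A] [Fintype ι] (a : ℕ → A) (c : ι → A)
    (d : ι → ℕ → A) (j : Fin 2) : squareEqnDeriv a (fun k ↦ ∑ e, c e * d e k) j =
      ∑ e, c e * squareEqnDeriv a (d e) j := by
  fin_cases j
  · simp only [squareEqnDeriv, Fin.zero_eta, Matrix.cons_val_zero]
    simp only [Finset.mul_sum, Finset.sum_mul, ← Finset.sum_add_distrib, ← Finset.sum_sub_distrib]
    exact Finset.sum_congr rfl fun _ _ ↦ by ring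
  · simp only [squareEqnDeriv, Fin.mk_one, Matrix.cons_val_one, Matrix.cons_val_fin_one]
    simp only [Finset.mul_sum, Finset.sum_mul, ← Finset.sum_add_distrib, ← Finset.sum_sub_distrib]
    exact Finset.sum_congr rfl fun _ _ ↦ by ring

/-- At a square, the differential of `squareEqn` computes the remainder of the division by the root
of the square. -/
theorem squareEqnDeriv_of_square {A : Type} [CommRing A] {a d : ℕ → A} {β γ u₀ u₁ u₂ r₀ r₁ : A}
    (h3 : a 3 = 2 * a 4 * β) (h2 : a 2 = a 4 * (β ^ 2 + 2 * γ)) (h1 : a 1 = 2 * a 4 * β * γ)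
    (h0 : a 0 = a 4 * γ ^ 2) (d4 : d 4 = u₂) (d3 : d 3 = u₁ + β * u₂)
    (d2 : d 2 = u₀ + β * u₁ + γ * u₂) (d1 : d 1 = β * u₀ + γ * u₁ + r₁)
    (d0 : d 0 = γ * u₀ + r₀) :
    squareEqnDeriv a d = ![8 * a 4 ^ 2 * r₁, 64 * a 4 ^ 3 * r₀] := by
  ext j
  fin_cases j
  · simp only [squareEqnDeriv, Fin.zero_eta, Matrix.cons_val_zero, h0, h1, h2, h3, d0, d1, d2, d3,
      d4]
    ring
  · simp only [squareEqnDeriv, Fin.mk_one, Matrix.cons_val_one, Matrix.cons_val_fin_one, h0, h1,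
      h2, h3, d0, d1, d2, d3, d4]
    ring

/-- If all 2 × 2 minors of the pair `x`, `y` vanished, so would the determinant of the images of any
two coefficient vectors, but it is 1 for vectors mapping to the standard basis. -/
theorem exists_minor_ne_zero {K ι : Type} [Field K] [Fintype ι] (x y : ι → K)
    (h : ∀ r₀ r₁ : K, ∃ c : ι → K, ∑ e, c e * x e = r₀ ∧ ∑ e, c e * y e = r₁) :
    ∃ e f, x e * y f - x f * y e ≠ 0 := by
  by_contra! hne
  obtain ⟨c, hc0, hc1⟩ := h 1 0
  obtain ⟨d, hd0, hd1⟩ := h 0 1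
  have key : (∑ e, c e * x e) * (∑ f, d f * y f) - (∑ e, c e * y e) * (∑ f, d f * x f) = 0 := by
    rw [Finset.sum_mul_sum, Finset.sum_mul_sum, ← Finset.sum_sub_distrib]
    refine Finset.sum_eq_zero fun e _ ↦ ?_
    rw [← Finset.sum_sub_distrib]
    refine Finset.sum_eq_zero fun f _ ↦ ?_
    linear_combination (c e * d f) * hne e f
  rw [hc0, hd1, hc1, hd0] at key
  simp at key

namespace ChartIndex

variable (i : ChartIndex) (F : MvPolynomial (Fin 4) ℂ)

/-- The weight with which the variation of an entry of the matrix moves the points of the line. -/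
noncomputable def weight (A : Type) [CommRing A] (e : Fin 2 × Fin 2) : Polynomial A :=
  ![Polynomial.X, Polynomial.C ((i.2 : ℕ) : A) * Polynomial.X + 1] e.1

theorem pderiv_row (σ : Splitting) (e : Fin 2 × Fin 2) (k : Fin 2) (l : Fin 4) :
    MvPolynomial.pderiv e (row σ (genericMatrix ℂ) k l) =
      if e.1 = k ∧ σ (Sum.inr e.2) = l then 1 else 0 := by
  obtain ⟨l | l, rfl⟩ := σ.surjective l
  · rw [row_inl]
    have : MvPolynomial.pderiv e ((1 : Matrix (Fin 2) (Fin 2) ChartRing) k l) = 0 := by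
      rw [Matrix.one_apply]
      split_ifs <;> simp
    simp [this]
  · rw [row_inr]
    obtain ⟨e₁, e₂⟩ := e
    simp only [genericMatrix, Matrix.of_apply, MvPolynomial.pderiv_X, Pi.single_apply,
      Prod.mk.injEq, EmbeddingLike.apply_eq_iff_eq, Sum.inr.injEq]
    congr 1
    simp [eq_comm]

/-- The derivatives of the form with respect to the entries of the matrix. -/
theorem sum_pderiv_coeff_form (hF : F.IsHomogeneous 4) (e : Fin 2 × Fin 2) :
    ∑ k ∈ Finset.range 5, Polynomial.C (MvPolynomial.pderiv e
        ((i.form F (genericMatrix ℂ)).coeff k)) * Polynomial.X ^ k =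
      i.weight ChartRing e *
        i.form (MvPolynomial.pderiv (i.1 (Sum.inr e.2)) F) (genericMatrix ℂ) := by
  -- Both sides are compared at the integers `n`, where the chain rule applies to `F(n • dir +
  -- base)`.
  refine Polynomial.eq_of_infinite_eval_eq _ _
    ((Set.infinite_range_of_injective (Nat.cast_injective (R := ChartRing))).mono ?_)
  rintro _ ⟨n, rfl⟩
  have h1 := aeval_smul_add_smul hF (i.dir (genericMatrix ℂ)) (i.base (genericMatrix ℂ))
    (n : ChartRing) 1
  have h2 := congrArg (MvPolynomial.pderiv e) h1
  rw [derivation_aeval] at h2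
  have h3 (l : Fin 4) : MvPolynomial.pderiv e (((n : ChartRing) • i.dir (genericMatrix ℂ) +
      (1 : ChartRing) • i.base (genericMatrix ℂ)) l) =
      if i.1 (Sum.inr e.2) = l then (i.weight ChartRing e).eval (n : ChartRing) else 0 := by
    obtain ⟨e₁, e₂⟩ := e
    simp only [dir, base, Pi.add_apply, Pi.smul_apply, smul_eq_mul, map_add, Derivation.leibniz,
      Derivation.map_natCast, pderiv_row, Derivation.map_one_eq_zero, weight]
    fin_cases e₁ <;> split_ifs <;> simp_all
    ring
  simp only [h3, mul_ite, mul_zero, Finset.sum_ite_eq, Finset.mem_univ, if_true] at h2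
  have h4 : (i.form (MvPolynomial.pderiv (i.1 (Sum.inr e.2)) F) (genericMatrix ℂ)).eval
      (n : ChartRing) = _ := eval_lineForm _ _ _ _
  change Polynomial.eval _ _ = Polynomial.eval _ _
  rw [Polynomial.eval_mul, h4, mul_comm (Polynomial.eval _ _)]
  rw [one_smul] at h2
  rw [h2]
  simp only [Finset.sum_range_succ, Finset.sum_range_zero, Polynomial.eval_add,
    Polynomial.eval_mul, Polynomial.eval_C, Polynomial.eval_pow, Polynomial.eval_X, map_add,
    Derivation.leibniz, Derivation.leibniz_pow, Derivation.map_natCast, smul_eq_mul, form,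
    one_pow, mul_one, smul_zero, mul_zero, zero_add]
  ring

end ChartIndex

end QuarticBitangents

namespace QuarticBitangents

section lineForm

variable {F : MvPolynomial (Fin 4) ℂ} {A : Type} [CommRing A] [Algebra ℂ A]

theorem derivative_lineForm (v w : Fin 4 → A) :
    Polynomial.derivative (lineForm F v w) =
      ∑ l, lineForm (MvPolynomial.pderiv l F) v w * Polynomial.C (v l) := by
  have h := derivation_aeval ((Polynomial.derivative' (R := A)).restrictScalars ℂ)
    (fun i ↦ Polynomial.C (v i) * Polynomial.X + Polynomial.C (w i)) F
  refine Eq.trans h (Finset.sum_congr rfl fun l _ ↦ ?_)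
  congr 1
  change Polynomial.derivative _ = _
  simp

theorem sum_mul_lineForm_pderiv (hF : F.IsHomogeneous 4) (v w : Fin 4 → A) :
    ∑ l, (Polynomial.C (v l) * Polynomial.X + Polynomial.C (w l)) *
      lineForm (MvPolynomial.pderiv l F) v w = 4 * lineForm F v w := by
  have h := congrArg (MvPolynomial.aeval (R := ℂ)
    fun i ↦ Polynomial.C (v i) * Polynomial.X + Polynomial.C (w i)) hF.sum_X_mul_pderiv
  simpa [lineForm] using h

end lineForm

namespace ChartIndex

variable (i : ChartIndex) {F : MvPolynomial (Fin 4) ℂ}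

theorem sum_splitting {A : Type} [CommRing A] (σ : Splitting) (M : Matrix (Fin 2) (Fin 2) A)
    (k : Fin 2) (d : Fin 4 → A) : ∑ l, d l * row σ M k l =
      d (σ (Sum.inl k)) + ∑ j, d (σ (Sum.inr j)) * M k j := by
  rw [← σ.sum_comp, Fintype.sum_sum_type]
  simp [Matrix.one_apply]

/-- At a bitangent, the root of the square and the derivatives of `F` in the directions transverse
to the line have no common zero. -/
theorem span_eq_top (hF : IsSmoothQuartic F) {K : Type} [Field K] [Algebra ℂ K]
    (M : Matrix (Fin 2) (Fin 2) K) {c : K} {q : Polynomial K}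
    (hq : i.form F M = Polynomial.C c * q ^ 2) :
    Ideal.span {q, i.form (MvPolynomial.pderiv (i.1 (Sum.inr 0)) F) M,
      i.form (MvPolynomial.pderiv (i.1 (Sum.inr 1)) F) M} = ⊤ := by
  by_contra hne
  obtain ⟨m, hm, hle⟩ := Ideal.exists_le_maximal _ hne
  -- The ideal `m` is a closed point of the affine line, with parameter `s`, at which `q` and both
  -- transverse derivatives vanish. The goal is to produce a singular point of the quartic there.
  let : Field (Polynomial K ⧸ m) := Ideal.Quotient.field m
  let mk := Ideal.Quotient.mkₐ ℂ m
  let d (l : Fin 4) := mk (i.form (MvPolynomial.pderiv l F) M)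
  have hqm : mk q = 0 := Ideal.Quotient.eq_zero_iff_mem.mpr (hle (Ideal.subset_span (by simp)))
  have hd (j : Fin 2) : d (i.1 (Sum.inr j)) = 0 :=
    Ideal.Quotient.eq_zero_iff_mem.mpr (hle (Ideal.subset_span (by fin_cases j <;> simp)))
  let s := mk Polynomial.X
  let cst (x : K) := mk (Polynomial.C x)
  -- The derivative of `c q²` is divisible by `q`. Together with Euler's formula in `h2`, it kills
  -- the derivatives in both directions of the line.
  have h1 : ∑ l, d l * cst (i.dir M l) = 0 := by
    have h := congrArg mk (derivative_lineForm (F := F) (i.dir M) (i.base M))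
    change mk (Polynomial.derivative (i.form F M)) = _ at h
    rw [hq] at h
    simp only [Polynomial.derivative_mul, Polynomial.derivative_pow, Polynomial.derivative_C,
      map_add, map_mul, map_sum, map_pow, hqm] at h
    simpa [d, cst, form] using h.symm
  have h2 : ∑ l, (cst (i.dir M l) * s + cst (i.base M l)) * d l = 0 := by
    have h := congrArg mk (sum_mul_lineForm_pderiv hF.isHomogeneous (i.dir M) (i.base M))
    change _ = mk (4 * i.form F M) at h
    rw [hq] at h
    simp only [map_add, map_mul, map_sum, map_pow, hqm] at h
    simpa [d, cst, s, form] using h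
  have h3 : ∑ l, d l * cst (row i.1 M 1 l) = 0 := by
    have h4 : ∑ l, (cst (i.dir M l) * s + cst (i.base M l)) * d l =
        s * ∑ l, d l * cst (i.dir M l) + ∑ l, d l * cst (row i.1 M 1 l) := by
      rw [Finset.mul_sum, ← Finset.sum_add_distrib]
      exact Finset.sum_congr rfl fun l _ ↦ by rw [base]; ring
    rw [h2, h1, mul_zero, zero_add] at h4
    exact h4.symm
  have h4 : ∑ l, d l * cst (row i.1 M 0 l) = 0 := by
    have h5 : ∑ l, d l * cst (i.dir M l) =
        ∑ l, d l * cst (row i.1 M 0 l) + cst (i.2 : ℕ) * ∑ l, d l * cst (row i.1 M 1 l) := by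
      rw [Finset.mul_sum, ← Finset.sum_add_distrib]
      refine Finset.sum_congr rfl fun l _ ↦ ?_
      simp only [dir, Pi.add_apply, Pi.smul_apply, smul_eq_mul, map_add, map_mul, cst]
      ring
    rw [h1, h3, mul_zero, add_zero] at h5
    exact h5.symm
  have hrow (k : Fin 2) : ∑ l, d l * cst (row i.1 M k l) = 0 := by
    fin_cases k
    · exact h4
    · exact h3
  have hcst (k : Fin 2) (l : Fin 4) : cst (row i.1 M k l) =
      row i.1 (M.map ((Ideal.Quotient.mk m).comp Polynomial.C)) k l :=
    congrFun (map_row ((Ideal.Quotient.mk m).comp Polynomial.C) i.1 M k) l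
  have hd' (l : Fin 4) : d l = 0 := by
    obtain ⟨k | k, rfl⟩ := i.1.surjective l
    · have h := hrow k
      simp only [hcst] at h
      rw [sum_splitting] at h
      simpa [hd] using h
    · exact hd k
  have hu : (fun l ↦ cst (i.dir M l) * s + cst (i.base M l)) = 0 := by
    refine hF.eq_zero_of_aeval_pderiv fun l ↦ (Eq.trans ?_ (hd' l))
    change _ = mk (MvPolynomial.aeval _ _)
    rw [map_aeval]
    simp [cst, s]
  -- The two coordinates of the point in the unit block are `s` and `t * s + 1`, which cannot both
  -- vanish.
  have e0 := congrFun hu (i.1 (Sum.inl 0))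
  have e1 := congrFun hu (i.1 (Sum.inl 1))
  simp only [dir, base, cst, Pi.add_apply, Pi.smul_apply, row_inl, Matrix.one_apply_eq,
    Matrix.one_apply_ne, ne_eq, zero_ne_one, one_ne_zero, not_false_eq_true, smul_eq_mul, mul_zero,
    mul_one, add_zero, zero_add, map_zero, map_one, one_mul, Pi.zero_apply] at e0 e1
  rw [e0] at e1
  simp at e1

theorem form_eq_of_eqn {A : Type} [CommRing A] [Algebra ℂ A] (hF : F.IsHomogeneous 4)
    {M : Matrix (Fin 2) (Fin 2) A} {β γ : A}
    (h3 : (i.form F M).coeff 3 = 2 * (i.form F M).coeff 4 * β)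
    (h2 : (i.form F M).coeff 2 = (i.form F M).coeff 4 * (β ^ 2 + 2 * γ))
    (h1 : (i.form F M).coeff 1 = 2 * (i.form F M).coeff 4 * β * γ)
    (h0 : (i.form F M).coeff 0 = (i.form F M).coeff 4 * γ ^ 2) :
    i.form F M = Polynomial.C ((i.form F M).coeff 4) *
      (Polynomial.X ^ 2 + Polynomial.C β * Polynomial.X + Polynomial.C γ) ^ 2 := by
  refine (lineForm_eq hF _ _).trans ?_
  change _ + Polynomial.C ((i.form F M).coeff 3) * _ + Polynomial.C ((i.form F M).coeff 2) * _ +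
    Polynomial.C ((i.form F M).coeff 1) * _ + Polynomial.C ((i.form F M).coeff 0) = _
  rw [h0, h1, h2, h3]
  simp only [map_mul, map_add, map_pow, map_ofNat]
  change Polynomial.C ((i.form F M).coeff 4) * _ + _ + _ + _ + _ = _
  ring

/-- The derivatives of the form at a bitangent attain every residue modulo the root of the
square. -/
theorem exists_sum_eq {K : Type} [Field K] (β γ r₀ r₁ : K) (g : Fin 2 → Polynomial K)
    (hg : Ideal.span {Polynomial.X ^ 2 + Polynomial.C β * Polynomial.X + Polynomial.C γ,
      g 0, g 1} = ⊤) (h : Fin 2 × Fin 2 → Polynomial K)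
    (hh : ∀ e, h e = i.weight K e * g e.2) (hdeg : ∀ e, (h e).natDegree ≤ 4) :
    ∃ (c : Fin 2 × Fin 2 → K) (u₀ u₁ u₂ : K), ∑ e, Polynomial.C (c e) * h e =
      (Polynomial.X ^ 2 + Polynomial.C β * Polynomial.X + Polynomial.C γ) *
        (Polynomial.C u₂ * Polynomial.X ^ 2 + Polynomial.C u₁ * Polynomial.X + Polynomial.C u₀) +
      (Polynomial.C r₁ * Polynomial.X + Polynomial.C r₀) := by
  set q : Polynomial K := Polynomial.X ^ 2 + Polynomial.C β * Polynomial.X + Polynomial.C γ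
  set r : Polynomial K := Polynomial.C r₁ * Polynomial.X + Polynomial.C r₀
  have hqdeg : q.natDegree = 2 := by unfold q; compute_degree!
  have hqm : q.Monic := by unfold q; monicity!
  have h1 : (1 : Polynomial K) ∈ Ideal.span {q, g 0, g 1} := hg ▸ Submodule.mem_top
  rw [Ideal.mem_span_insert] at h1
  obtain ⟨b, z, hz, h1⟩ := h1
  obtain ⟨b₀, b₁, rfl⟩ := Ideal.mem_span_pair.mp hz
  have hlin (p : Polynomial K) : ∃ x y : K,
      p %ₘ q = Polynomial.C x * Polynomial.X + Polynomial.C y := by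
    refine ⟨(p %ₘ q).coeff 1, (p %ₘ q).coeff 0, Polynomial.eq_X_add_C_of_natDegree_le_one ?_⟩
    have := Polynomial.natDegree_modByMonic_lt p hqm (by
      intro h
      rw [h] at hqdeg
      simp at hqdeg)
    lia
  obtain ⟨x₀, y₀, h₀⟩ := hlin (r * b₀)
  obtain ⟨x₁, y₁, h₁⟩ := hlin (r * b₁)
  -- From `1 = b q + b₀ g₀ + b₁ g₁` multiplied by `r`, only the remainders of `r b₀` and `r b₁`
  -- modulo `q` matter. Each is linear and decomposes along the two weights: `x X + y = (x - y t) X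
  -- + y (t X + 1)`.
  let c : Fin 2 × Fin 2 → K := fun e ↦
    ![![x₀ - y₀ * ((i.2 : ℕ) : K), x₁ - y₁ * ((i.2 : ℕ) : K)], ![y₀, y₁]] e.1 e.2
  have hc : ∑ e, Polynomial.C (c e) * h e = (r * b₀ %ₘ q) * g 0 + (r * b₁ %ₘ q) * g 1 := by
    rw [h₀, h₁, Fintype.sum_prod_type]
    simp only [hh, Fin.sum_univ_two, c, weight]
    simp only [Matrix.cons_val_zero, Matrix.cons_val_one, Matrix.cons_val_fin_one, map_sub, map_mul]
    ring
  set u := -(b * r + (r * b₀ /ₘ q) * g 0 + (r * b₁ /ₘ q) * g 1)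
  have hu : ∑ e, Polynomial.C (c e) * h e = q * u + r := by
    have e₀ := Polynomial.modByMonic_add_div (r * b₀) q
    have e₁ := Polynomial.modByMonic_add_div (r * b₁) q
    rw [hc]
    linear_combination (-r) * h1 + g 0 * e₀ + g 1 * e₁
  -- All variations have degree at most 4 and `q` is monic of degree 2.
  have hudeg : u.natDegree ≤ 2 := by
    have h2 : (q * u).natDegree ≤ 4 := by
      rw [show q * u = ∑ e, Polynomial.C (c e) * h e - r by rw [hu]; ring]
      refine (Polynomial.natDegree_sub_le _ _).trans (max_le
        (Polynomial.natDegree_sum_le_of_forall_le _ _ fun e _ ↦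
          (Polynomial.natDegree_C_mul_le _ _).trans (hdeg e)) ?_)
      unfold r
      compute_degree
      norm_num
    by_cases hu0 : u = 0
    · simp [hu0]
    · rw [hqm.natDegree_mul' hu0, hqdeg] at h2
      lia
  refine ⟨c, u.coeff 0, u.coeff 1, u.coeff 2, ?_⟩
  rw [hu]
  congr 2
  exact Polynomial.eq_quadratic_of_degree_le_two (Polynomial.natDegree_le_iff_degree_le.mp hudeg)

open Polynomial in
theorem coeff_quartic {A : Type} [CommRing A] (b₄ b₃ b₂ b₁ b₀ : A) :
    let p := C b₄ * X ^ 4 + C b₃ * X ^ 3 + C b₂ * X ^ 2 + C b₁ * X + C b₀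
    p.coeff 4 = b₄ ∧ p.coeff 3 = b₃ ∧ p.coeff 2 = b₂ ∧ p.coeff 1 = b₁ ∧ p.coeff 0 = b₀ := by
  refine ⟨?_, ?_, ?_, ?_, ?_⟩ <;>
  simp [coeff_X, coeff_C, coeff_X_pow]

/-- At a bitangent, the differential of the equations is surjective. -/
theorem exists_squareEqnDeriv_eq {K : Type} [Field K] [CharZero K] {a : ℕ → K} {β γ : K}
    (h4 : a 4 ≠ 0) (e3 : a 3 = 2 * a 4 * β) (e2 : a 2 = a 4 * (β ^ 2 + 2 * γ))
    (e1 : a 1 = 2 * a 4 * β * γ) (e0 : a 0 = a 4 * γ ^ 2) (g : Fin 2 → Polynomial K)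
    (hg : Ideal.span {Polynomial.X ^ 2 + Polynomial.C β * Polynomial.X + Polynomial.C γ,
      g 0, g 1} = ⊤) (d : Fin 2 × Fin 2 → ℕ → K)
    (hd : ∀ e, ∑ k ∈ Finset.range 5, Polynomial.C (d e k) * Polynomial.X ^ k =
      i.weight K e * g e.2) (x y : K) :
    ∃ c : Fin 2 × Fin 2 → K, ∑ e, c e * squareEqnDeriv a (d e) 0 = x ∧
      ∑ e, c e * squareEqnDeriv a (d e) 1 = y := by
  have h8 : (8 * a 4 ^ 2 : K) ≠ 0 := mul_ne_zero (by norm_num) (pow_ne_zero _ h4)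
  have h64 : (64 * a 4 ^ 3 : K) ≠ 0 := mul_ne_zero (by norm_num) (pow_ne_zero _ h4)
  -- The remainder is chosen so that the factors `8a₄²` and `64a₄³` of `squareEqnDeriv_of_square`
  -- turn it into `x` and `y`.
  obtain ⟨c, u₀, u₁, u₂, hc⟩ := i.exists_sum_eq β γ (y / (64 * a 4 ^ 3)) (x / (8 * a 4 ^ 2)) g
    hg _ hd fun e ↦ Polynomial.natDegree_sum_le_of_forall_le _ _ fun k hk ↦
      (Polynomial.natDegree_C_mul_X_pow_le _ _).trans
        (Nat.le_of_lt_succ (Finset.mem_range.mp hk))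
  generalize hr₁ : x / (8 * a 4 ^ 2) = r₁ at hc
  generalize hr₀ : y / (64 * a 4 ^ 3) = r₀ at hc
  have hrhs : (Polynomial.X ^ 2 + Polynomial.C β * Polynomial.X + Polynomial.C γ) *
        (Polynomial.C u₂ * Polynomial.X ^ 2 + Polynomial.C u₁ * Polynomial.X + Polynomial.C u₀) +
      (Polynomial.C r₁ * Polynomial.X + Polynomial.C r₀) =
      Polynomial.C u₂ * Polynomial.X ^ 4 + Polynomial.C (u₁ + β * u₂) * Polynomial.X ^ 3 +
      Polynomial.C (u₀ + β * u₁ + γ * u₂) * Polynomial.X ^ 2 +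
      Polynomial.C (β * u₀ + γ * u₁ + r₁) * Polynomial.X + Polynomial.C (γ * u₀ + r₀) := by
    simp only [map_add, map_mul]
    ring
  rw [hrhs] at hc
  have hlhs (k : ℕ) (hk : k < 5) : ∑ e, c e * d e k = (∑ e, Polynomial.C (c e) *
      ∑ k ∈ Finset.range 5, Polynomial.C (d e k) * Polynomial.X ^ k).coeff k := by
    simp only [Polynomial.finsetSum_coeff, Polynomial.coeff_C_mul, Polynomial.coeff_X_pow]
    refine Finset.sum_congr rfl fun e _ ↦ ?_
    simp [hk]
  rw [hc] at hlhs
  obtain ⟨c4, c3, c2, c1, c0⟩ := coeff_quartic u₂ (u₁ + β * u₂) (u₀ + β * u₁ + γ * u₂)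
    (β * u₀ + γ * u₁ + r₁) (γ * u₀ + r₀)
  have key := squareEqnDeriv_of_square (d := fun k ↦ ∑ e, c e * d e k) e3 e2 e1 e0
    ((hlhs 4 (by norm_num)).trans c4) ((hlhs 3 (by norm_num)).trans c3)
    ((hlhs 2 (by norm_num)).trans c2) ((hlhs 1 (by norm_num)).trans c1)
    ((hlhs 0 (by norm_num)).trans c0)
  refine ⟨c, ?_, ?_⟩
  · rw [← squareEqnDeriv_sum, key, ← hr₁]
    exact mul_div_cancel₀ _ h8
  · rw [← squareEqnDeriv_sum, key, ← hr₀]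
    exact mul_div_cancel₀ _ h64

theorem map_pderiv_eqn {K : Type} [CommRing K] [Algebra ℂ K] (φ : ChartRing →ₐ[ℂ] K)
    (e : Fin 2 × Fin 2) (j : Fin 2) :
    φ (MvPolynomial.pderiv e (i.eqn F (genericMatrix ℂ) j)) =
      squareEqnDeriv (i.form F ((genericMatrix ℂ).map φ)).coeff
        (fun k ↦ φ (MvPolynomial.pderiv e ((i.form F (genericMatrix ℂ)).coeff k))) j := by
  rw [eqn, derivation_squareEqn]
  refine (map_squareEqnDeriv (φ : ChartRing →+* K) _ _ j).trans ?_
  congr 2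
  ext k
  exact i.map_coeff_form F φ _ k

theorem sum_map_pderiv_coeff_form (hF : F.IsHomogeneous 4) {K : Type} [CommRing K] [Algebra ℂ K]
    (φ : ChartRing →ₐ[ℂ] K) (e : Fin 2 × Fin 2) :
    ∑ k ∈ Finset.range 5, Polynomial.C (φ (MvPolynomial.pderiv e
      ((i.form F (genericMatrix ℂ)).coeff k))) * Polynomial.X ^ k =
      i.weight K e * i.form (MvPolynomial.pderiv (i.1 (Sum.inr e.2)) F)
        ((genericMatrix ℂ).map φ) := by
  have h1 := congrArg (Polynomial.map (φ : ChartRing →+* K)) (i.sum_pderiv_coeff_form F hF e)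
  rw [Polynomial.map_mul, i.map_form] at h1
  have h2 : (i.weight ChartRing e).map (φ : ChartRing →+* K) = i.weight K e := by
    obtain ⟨k, l⟩ := e
    fin_cases k <;> simp [weight]
  rw [h2] at h1
  rw [← h1, Polynomial.map_sum]
  simp only [Polynomial.map_mul, Polynomial.map_pow, Polynomial.map_C, Polynomial.map_X,
    RingHom.coe_coe]

/-- A minor of the Jacobian matrix of the equations of a chart. -/
noncomputable def minor (F : MvPolynomial (Fin 4) ℂ) (e f : Fin 2 × Fin 2) : ChartRing :=
  MvPolynomial.pderiv e (i.eqn F (genericMatrix ℂ) 0) *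
    MvPolynomial.pderiv f (i.eqn F (genericMatrix ℂ) 1) -
  MvPolynomial.pderiv f (i.eqn F (genericMatrix ℂ) 0) *
    MvPolynomial.pderiv e (i.eqn F (genericMatrix ℂ) 1)

/-- At a bitangent, the equations of the scheme of bitangents satisfy the Jacobian criterion. -/
theorem exists_map_minor_ne_zero (hF : IsSmoothQuartic F) {K : Type} [Field K] [Algebra ℂ K]
    (φ : ChartRing →ₐ[ℂ] K) (h4 : φ ((i.form F (genericMatrix ℂ)).coeff 4) ≠ 0)
    (hE : ∀ j, φ (i.eqn F (genericMatrix ℂ) j) = 0) :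
    ∃ e f, φ (i.minor F e f) ≠ 0 := by
  have : CharZero K := charZero_of_injective_algebraMap (algebraMap ℂ K).injective
  rw [i.map_coeff_form F φ] at h4
  have hEM : squareEqn (i.form F ((genericMatrix ℂ).map φ)).coeff = 0 := by
    ext j
    exact (i.map_eqn F φ _ j).symm.trans (hE j)
  obtain ⟨β, γ, e3, e2, e1, e0⟩ := exists_eq_of_squareEqn_eq_zero (IsUnit.mk0 _ h4) hEM
  have hform := i.form_eq_of_eqn hF.isHomogeneous e3 e2 e1 e0
  simp only [minor, map_sub, map_mul, map_pderiv_eqn]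
  exact exists_minor_ne_zero _ _ (i.exists_squareEqnDeriv_eq h4 e3 e2 e1 e0
    (fun j ↦ i.form (MvPolynomial.pderiv (i.1 (Sum.inr j)) F) ((genericMatrix ℂ).map φ))
    (i.span_eq_top hF _ hform) _ (i.sum_map_pderiv_coeff_form hF.isHomogeneous φ))

end ChartIndex

end QuarticBitangents

/-! ### Standard smoothness of the charts of the scheme of bitangents. -/

namespace QuarticBitangents

/-- The Jacobian criterion for a localization of the quotient of a polynomial ring. -/
theorem isStandardSmoothOfRelativeDimension_of_jacobian {R σ ι : Type} [CommRing R] [Fintype σ]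
    [Fintype ι] [DecidableEq ι] (v : ι → MvPolynomial σ R) (a : ι → σ) (ha : Function.Injective a)
    (T : Type) [CommRing T] [Algebra R T]
    [Algebra (MvPolynomial σ R ⧸ Ideal.span (Set.range v)) T]
    [IsScalarTower R (MvPolynomial σ R ⧸ Ideal.span (Set.range v)) T]
    (r : MvPolynomial σ R ⧸ Ideal.span (Set.range v)) [IsLocalization.Away r T]
    (h : IsUnit (algebraMap (MvPolynomial σ R ⧸ Ideal.span (Set.range v)) T
      (Ideal.Quotient.mk _ (Matrix.of fun i j ↦ (v j).pderiv (a i)).det))) :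
    Algebra.IsStandardSmoothOfRelativeDimension (Nat.card σ - Nat.card ι) R T := by
  let P := Algebra.PreSubmersivePresentation.naive (R := R) (v := v) a ha
  let L := Algebra.PreSubmersivePresentation.localizationAway T r
  have hL : L.dimension = 0 := Algebra.Presentation.localizationAway_dimension_zero r
  have hP : P.jacobian = Ideal.Quotient.mk _ (Matrix.of fun i j ↦ (v j).pderiv (a i)).det := by
    rw [Algebra.PreSubmersivePresentation.jacobian_eq_jacobiMatrix_det]
    have : P.jacobiMatrix = Matrix.of fun i j ↦ (v j).pderiv (a i) := by
      refine Matrix.ext fun i j ↦ ?_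
      exact Algebra.PreSubmersivePresentation.jacobiMatrix_apply P i j
    rw [this]
    rfl
  -- The Jacobian of the composite presentation is the product of the minor and of `r`, both units
  -- in `T`; inverting `r` adds one variable and one relation, so the dimension is unchanged.
  let S : Algebra.SubmersivePresentation R T (Unit ⊕ σ) (Unit ⊕ ι) :=
    { L.comp P with
      jacobian_isUnit := by
        rw [Algebra.PreSubmersivePresentation.comp_jacobian_eq_jacobian_smul_jacobian,
          Algebra.smul_def, hP, Algebra.PreSubmersivePresentation.localizationAway_jacobian]
        exact h.mul (IsLocalization.Away.algebraMap_isUnit r) }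
  refine S.isStandardSmoothOfRelativeDimension ?_
  exact (Algebra.PreSubmersivePresentation.dimension_comp_eq_dimension_add_dimension L P).trans
    (by rw [hL, zero_add]; rfl)

namespace ChartIndex

variable (i : ChartIndex) (F : MvPolynomial (Fin 4) ℂ)

/-- The quotient of the coordinate ring of a chart of the Grassmannian by the equations of the
bitangents. -/
abbrev QuotientRing : Type := ChartRing ⧸ Ideal.span (Set.range (i.eqn F (genericMatrix ℂ)))

/-- The first coefficient of the form of the generic line, in the quotient ring. -/
noncomputable abbrev leadQ : i.QuotientRing F :=
  Ideal.Quotient.mk _ ((i.form F (genericMatrix ℂ)).coeff 4)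

/-- The coordinate ring of a chart of the scheme of bitangents. -/
abbrev BitangentRing : Type := Localization.Away (i.leadQ F)

/-- The coordinates on a chart of the scheme of bitangents. -/
noncomputable def toBitangentRing : ChartRing →ₐ[ℂ] i.BitangentRing F :=
  (IsScalarTower.toAlgHom ℂ (i.QuotientRing F) (i.BitangentRing F)).comp
    (Ideal.Quotient.mkₐ ℂ _)

theorem toBitangentRing_apply (p : ChartRing) : i.toBitangentRing F p =
    algebraMap (i.QuotientRing F) (i.BitangentRing F) (Ideal.Quotient.mk _ p) := rfl

theorem isUnit_toBitangentRing :
    IsUnit (i.toBitangentRing F ((i.form F (genericMatrix ℂ)).coeff 4)) :=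
  IsLocalization.Away.algebraMap_isUnit (i.leadQ F)

theorem toBitangentRing_eqn (j : Fin 2) :
    i.toBitangentRing F (i.eqn F (genericMatrix ℂ) j) = 0 := by
  have h : (Ideal.Quotient.mk (Ideal.span (Set.range (i.eqn F (genericMatrix ℂ)))))
      (i.eqn F (genericMatrix ℂ) j) = 0 :=
    Ideal.Quotient.eq_zero_iff_mem.mpr (Ideal.subset_span ⟨j, rfl⟩)
  rw [toBitangentRing_apply, h, map_zero]

variable {F}

/-- Inverting `a₄` and then the minor amounts to one localization of the quotient ring, with four
variables and two equations. -/
theorem isStandardSmooth_away_minor {e f : Fin 2 × Fin 2} (hef : e ≠ f) :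
    Algebra.IsStandardSmoothOfRelativeDimension 2 ℂ
      (Localization.Away (i.toBitangentRing F (i.minor F e f))) := by
  let r : i.QuotientRing F := i.leadQ F * Ideal.Quotient.mk _ (i.minor F e f)
  have : IsLocalization.Away r (Localization.Away (i.toBitangentRing F (i.minor F e f))) :=
    by
    have : IsLocalization.Away (algebraMap (i.QuotientRing F) (i.BitangentRing F)
        (Ideal.Quotient.mk _ (i.minor F e f)))
        (Localization.Away (i.toBitangentRing F (i.minor F e f))) :=
      inferInstanceAs (IsLocalization.Away (i.toBitangentRing F (i.minor F e f)) _)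
    exact IsLocalization.Away.mul' (i.BitangentRing F) _ _ _
  have ha : Function.Injective ![e, f] := by
    intro x y hxy
    fin_cases x <;> fin_cases y <;> simp_all [eq_comm]
  have key := isStandardSmoothOfRelativeDimension_of_jacobian (i.eqn F (genericMatrix ℂ)) ![e, f] ha
    (Localization.Away (i.toBitangentRing F (i.minor F e f))) r ?_
  · simpa using key
  · have h1 : (Matrix.of fun a b ↦ MvPolynomial.pderiv (![e, f] a)
        (i.eqn F (genericMatrix ℂ) b)).det = i.minor F e f := by
      rw [Matrix.det_fin_two, minor]
      simp
      ring
    rw [h1]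
    exact IsLocalization.Away.algebraMap_isUnit (i.toBitangentRing F (i.minor F e f))

theorem span_minor_eq_top (hF : IsSmoothQuartic F) :
    Ideal.span (Set.range fun p : {p : (Fin 2 × Fin 2) × (Fin 2 × Fin 2) // p.1 ≠ p.2} ↦
      i.toBitangentRing F (i.minor F p.1.1 p.1.2)) = ⊤ := by
  by_contra hne
  obtain ⟨m, hm, hle⟩ := Ideal.exists_le_maximal _ hne
  let : Field (i.BitangentRing F ⧸ m) := Ideal.Quotient.field m
  obtain ⟨e, f, hef⟩ := i.exists_map_minor_ne_zero hF
    ((Ideal.Quotient.mkₐ ℂ m).comp (i.toBitangentRing F))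
    ((i.isUnit_toBitangentRing F).map (Ideal.Quotient.mkₐ ℂ m)).ne_zero
    fun j ↦ by rw [AlgHom.comp_apply, toBitangentRing_eqn, map_zero]
  have hne' : e ≠ f := by
    rintro rfl
    exact hef (by rw [minor, sub_self, map_zero])
  exact hef (Ideal.Quotient.eq_zero_iff_mem.mpr (hle (Ideal.subset_span ⟨⟨(e, f), hne'⟩, rfl⟩)))

theorem locally_isStandardSmooth (hF : IsSmoothQuartic F) :
    RingHom.Locally (RingHom.IsStandardSmoothOfRelativeDimension 2)
      (algebraMap ℂ (i.BitangentRing F)) := by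
  refine ⟨_, i.span_minor_eq_top hF, ?_⟩
  rintro _ ⟨p, rfl⟩
  rw [← IsScalarTower.algebraMap_eq, RingHom.isStandardSmoothOfRelativeDimension_algebraMap]
  exact i.isStandardSmooth_away_minor p.2

end ChartIndex

end QuarticBitangents

/-! ### Vanishing of sections on scheme-theoretic images, and lifting to closed subschemes. -/

namespace AlgebraicGeometry

open Limits TopologicalSpace

theorem section_eq_zero_of_cover {X : Scheme.{0}} {V : X.Opens} (s : Γ(X, V))
    (h : ∀ x ∈ V, ∃ (Y : Scheme.{0}) (j : Y ⟶ X) (_ : IsOpenImmersion j) (y : Y), j y = x ∧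
      j.app V s = 0) : s = 0 := by
  refine TopCat.Presheaf.section_ext X.sheaf V s 0 fun x hx ↦ ?_
  obtain ⟨Y, j, _, y, rfl, hy⟩ := h x hx
  rw [map_zero]
  have h1 := Scheme.Hom.germ_stalkMap_apply j V y hx s
  rw [hy, map_zero] at h1
  exact (ConcreteCategory.bijective_of_isIso (j.stalkMap y)).1 (h1.trans (map_zero _).symm)

section chartSection

variable {G : Scheme.{0}} {R : CommRingCat.{0}} (u : Spec R ⟶ G) [IsOpenImmersion u]

/-- The section of the structure sheaf over an affine chart corresponding to an element of its
coordinate ring. -/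
noncomputable def chartSection (a : R) : Γ(G, u ''ᵁ ⊤) :=
  (u.appIso ⊤).inv ((Scheme.ΓSpecIso R).inv a)

theorem comp_app_apply {T T' : Scheme.{0}} (t : T' ⟶ T) (g : T ⟶ G) {U : G.Opens} (s : Γ(G, U)) :
    (t ≫ g).app U s = t.app (g ⁻¹ᵁ U) (g.app U s) :=
  congr($(Scheme.Hom.comp_app t g U) s)

theorem app_eq_zero_of_eq {T : Scheme.{0}} {g g' : T ⟶ G} (h : g = g') {U : G.Opens} {s : Γ(G, U)}
    (hs : g.app U s = 0) : g'.app U s = 0 := by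
  subst h
  exact hs

/-- For a quasi-compact morphism, functions on the scheme-theoretic image over an affine open inject
into functions on the source. -/
theorem imageι_app_eq_zero {T : Scheme.{0}} (f : T ⟶ G) [QuasiCompact f] {V : G.Opens}
    (hV : IsAffineOpen V) (s : Γ(G, V)) (h : f.app V s = 0) : f.imageι.app V s = 0 := by
  refine f.toImage_app_injective ⟨V, hV⟩ (Eq.trans ?_ (map_zero _).symm)
  exact (comp_app_apply f.toImage f.imageι s).symm.trans
    (app_eq_zero_of_eq f.toImage_imageι.symm h)

theorem app_eq_zero_of_sigma {κ : Type} {B : κ → CommRingCat.{0}} (f : (∐ fun k ↦ Spec (B k)) ⟶ G)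
    {U : G.Opens} (s : Γ(G, U)) (h : ∀ (k : κ) (b : B k),
      Set.range (Spec.map (CommRingCat.ofHom (algebraMap (B k) (Localization.Away b))) ≫
        Sigma.ι (fun k ↦ Spec (B k)) k ≫ f) ⊆ U →
      (Spec.map (CommRingCat.ofHom (algebraMap (B k) (Localization.Away b))) ≫
        Sigma.ι (fun k ↦ Spec (B k)) k ≫ f).app U s = 0) : f.app U s = 0 := by
  refine section_eq_zero_of_cover _ fun x hx ↦ ?_
  obtain ⟨(k : κ), z, rfl⟩ := (sigmaOpenCover fun k ↦ Spec (B k)).exists_eq x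
  let u := Sigma.ι (fun k ↦ Spec (B k)) k
  obtain ⟨_, ⟨b, rfl⟩, hzb, hb⟩ :=
    PrimeSpectrum.isTopologicalBasis_basic_opens.exists_subset_of_mem_open
      (a := z) (u := (u ⁻¹ᵁ f ⁻¹ᵁ U : TopologicalSpace.Opens _).carrier) hx (u ⁻¹ᵁ f ⁻¹ᵁ U).isOpen
  let r := Spec.map (CommRingCat.ofHom (algebraMap (B k) (Localization.Away b)))
  have hr : Set.range r = (PrimeSpectrum.basicOpen b).carrier :=
    PrimeSpectrum.localization_away_comap_range (Localization.Away b) b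
  obtain ⟨z', rfl⟩ := hr.symm.le hzb
  refine ⟨_, r ≫ u, inferInstance, z', rfl, (comp_app_apply (r ≫ u) f s).symm.trans
    (app_eq_zero_of_eq (Category.assoc _ _ _).symm (h k b ?_))⟩
  rintro _ ⟨t, rfl⟩
  exact hb (hr.le ⟨t, rfl⟩)

theorem app_chartSection_eq_zero_iff {A : CommRingCat.{0}} (ψ : R ⟶ A) (a : R) :
    (Spec.map ψ ≫ u).app (u ''ᵁ ⊤) (chartSection u a) = 0 ↔ ψ a = 0 := by
  let k := eqToHom (u.preimage_image_eq ⊤)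
  have h1 : u.app (u ''ᵁ ⊤) (chartSection u a) =
      (Spec R).presheaf.map k.op ((Scheme.ΓSpecIso R).inv a) :=
    congr($(u.appIso_inv_app ⊤) ((Scheme.ΓSpecIso R).inv a))
  have h2 : (Spec.map ψ).app (u ⁻¹ᵁ u ''ᵁ ⊤)
      ((Spec R).presheaf.map k.op ((Scheme.ΓSpecIso R).inv a)) =
      (Spec A).presheaf.map ((Opens.map (Spec.map ψ).base).map k).op
        ((Spec.map ψ).app ⊤ ((Scheme.ΓSpecIso R).inv a)) :=
    congr($((Spec.map ψ).naturality k.op) ((Scheme.ΓSpecIso R).inv a))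
  have h3 : (Scheme.ΓSpecIso A).inv (ψ a) = (Spec.map ψ).app ⊤ ((Scheme.ΓSpecIso R).inv a) :=
    congr($(Scheme.ΓSpecIso_inv_naturality ψ) a)
  have inj1 : Function.Injective
      ((Spec A).presheaf.map ((Opens.map (Spec.map ψ).base).map k).op) :=
    (ConcreteCategory.bijective_of_isIso _).1
  have inj2 : Function.Injective (Scheme.ΓSpecIso A).inv :=
    (ConcreteCategory.bijective_of_isIso _).1
  rw [comp_app_apply, h1, h2, ← h3]
  exact (map_eq_zero_iff _ inj1).trans (map_eq_zero_iff _ inj2)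

end chartSection

/-- A morphism from the spectrum of a ring to a closed subscheme can be constructed locally. -/
theorem exists_lift_of_forall_localization {Z X : Scheme.{0}} (ι : Z ⟶ X) [IsClosedImmersion ι]
    {A : Type} [CommRing A] (x : Spec (CommRingCat.of A) ⟶ X)
    (h : ∀ (p : Ideal A) [p.IsPrime], ∃ y : Spec (CommRingCat.of (Localization.AtPrime p)) ⟶ Z,
      y ≫ ι = Spec.map (CommRingCat.ofHom (algebraMap A (Localization.AtPrime p))) ≫ x) :
    ∃ y : Spec (CommRingCat.of A) ⟶ Z, y ≫ ι = x := by
  obtain ⟨I, e, he⟩ := (IsClosedImmersion.Spec_iff (R := CommRingCat.of A)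
    (f := pullback.snd ι x)).mp inferInstance
  -- The pullback of `Z` to `Spec A` is the closed subscheme of `I`. The lift over each local ring
  -- makes `A → A_m` factor through `A ⧸ I`, so elements of `I` vanish in every `A_m`.
  have hI (a : A) (ha : a ∈ (I : Ideal A)) : a = 0 := by
    refine Module.eq_zero_of_localization_maximal (fun m _ ↦ Localization.AtPrime m)
      (fun m _ ↦ Algebra.linearMap A _) a fun m _ ↦ ?_
    obtain ⟨y, hy⟩ := h m
    let z := pullback.lift y _ hy
    have hz : (z ≫ e.hom) ≫ Spec.map (CommRingCat.ofHom (Ideal.Quotient.mk I)) =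
        Spec.map (CommRingCat.ofHom (algebraMap A (Localization.AtPrime m))) := by
      rw [Category.assoc]
      erw [← he]
      exact pullback.lift_snd _ _ _
    have h2 := congr($(Spec.map_injective (by
      rw [Spec.map_comp, Spec.map_preimage]
      exact hz : Spec.map (CommRingCat.ofHom (Ideal.Quotient.mk I) ≫ Spec.preimage (z ≫ e.hom)) =
        Spec.map (CommRingCat.ofHom (algebraMap A (Localization.AtPrime m))))) a)
    have h3 : Ideal.Quotient.mk I a = 0 := Ideal.Quotient.eq_zero_iff_mem.mpr ha
    refine h2.symm.trans ?_
    change (Spec.preimage (z ≫ e.hom)) (Ideal.Quotient.mk I a) = 0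
    rw [h3, map_zero]
  have hbot : I = ⊥ := (eq_bot_iff).mpr hI
  let r : CommRingCat.of (A ⧸ I) ⟶ CommRingCat.of A :=
    CommRingCat.ofHom (Ideal.Quotient.lift I (RingHom.id A) hI)
  have hr : CommRingCat.ofHom (Ideal.Quotient.mk I) ≫ r = 𝟙 _ := by
    ext a
    rfl
  refine ⟨(Spec.map r ≫ e.inv) ≫ pullback.fst ι x, ?_⟩
  rw [Category.assoc, pullback.condition, he]
  simp only [Category.assoc, Iso.inv_hom_id_assoc]
  rw [← Spec.map_comp_assoc, hr, Spec.map_id, Category.id_comp]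

end AlgebraicGeometry

/-! ### Construction of the scheme of bitangents and its equations on charts. -/

namespace QuarticBitangents

open Limits

section Bitangents

variable (F : MvPolynomial (Fin 4) ℂ)

/-- The spectrum of a `ℂ`-algebra, as a scheme over `ℂ`. -/
noncomputable abbrev specOver (A : Type) [CommRing A] [Algebra ℂ A] :
    Over (Spec (CommRingCat.of ℂ)) :=
  (algSpec (CommRingCat.of ℂ)).obj (op (CommAlgCat.of ℂ A))

/-- The morphism of spectra of a homomorphism of `ℂ`-algebras. -/
noncomputable abbrev specOverMap {A B : Type} [CommRing A] [Algebra ℂ A] [CommRing B] [Algebra ℂ B]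
    (φ : A →ₐ[ℂ] B) : specOver B ⟶ specOver A :=
  (algSpec (CommRingCat.of ℂ)).map (CommAlgCat.ofHom φ).op

section specOver

variable {A B C : Type} [CommRing A] [Algebra ℂ A] [CommRing B] [Algebra ℂ B] [CommRing C]
  [Algebra ℂ C]

theorem specOverMap_comp (φ : A →ₐ[ℂ] B) (χ : B →ₐ[ℂ] C) :
    specOverMap (χ.comp φ) = specOverMap χ ≫ specOverMap φ :=
  (algSpec (CommRingCat.of ℂ)).map_comp (CommAlgCat.ofHom χ).op (CommAlgCat.ofHom φ).op

theorem exists_specOverMap_eq (f : specOver B ⟶ specOver A) :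
    ∃ φ : A →ₐ[ℂ] B, specOverMap φ = f := by
  have := algSpec.instFull (R := CommRingCat.of ℂ)
  obtain ⟨g, hg⟩ := Functor.map_surjective (algSpec (CommRingCat.of ℂ)) f
  exact ⟨g.unop.hom, hg⟩

theorem coords_specOverMap (φ : A →ₐ[ℂ] B) (x : specOver A ⟶ grassmannian) :
    coords (specOverMap φ ≫ x) = extend (φ : A →+* B) (coords x) :=
  coords_comp (CommAlgCat.ofHom φ) x

theorem coords_specOverMap_chartHom (φ : ChartRing →ₐ[ℂ] A) (σ : Splitting) :
    coords (specOverMap φ ≫ chartHom σ) = graph σ ((genericMatrix ℂ).map φ) := by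
  rw [coords_specOverMap, coords_chartHom, extend_graph]
  rfl

end specOver

namespace ChartIndex

variable (i : ChartIndex)

/-- The coordinate ring of the chart of the lines on which a given point is not on `X`. -/
abbrev OpenChartRing : Type := Localization.Away ((i.form F (genericMatrix ℂ)).coeff 4)

/-- The coordinates of the open chart. -/
noncomputable abbrev toOpenChartRing : ChartRing →ₐ[ℂ] i.OpenChartRing F :=
  IsScalarTower.toAlgHom ℂ ChartRing (i.OpenChartRing F)

/-- The open chart of the Grassmannian. -/
noncomputable def openChart : specOver (i.OpenChartRing F) ⟶ grassmannian :=
  specOverMap (i.toOpenChartRing F) ≫ chartHom i.1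

instance : IsOpenImmersion (i.openChart F).left := by
  have h : IsOpenImmersion (specOverMap (i.toOpenChartRing F)).left :=
    inferInstanceAs (IsOpenImmersion (Spec.map (CommRingCat.ofHom
      (algebraMap ChartRing (Localization.Away ((i.form F (genericMatrix ℂ)).coeff 4))))))
  exact inferInstanceAs (IsOpenImmersion
    ((specOverMap (i.toOpenChartRing F)).left ≫ (chartHom i.1).left))

/-- The underlying morphism of the open chart. -/
noncomputable def openChartLeft :
    Spec (CommRingCat.of (i.OpenChartRing F)) ⟶ grassmannian.left :=
  (i.openChart F).left

instance : IsOpenImmersion (i.openChartLeft F) :=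
  inferInstanceAs (IsOpenImmersion (i.openChart F).left)

/-- The morphism from a chart of the scheme of bitangents to the Grassmannian. -/
noncomputable def bitangentChart : specOver (i.BitangentRing F) ⟶ grassmannian :=
  specOverMap (i.toBitangentRing F) ≫ chartHom i.1

variable {F} {A : Type} [CommRing A] [Algebra ℂ A]

theorem coords_openChart (ψ : i.OpenChartRing F →ₐ[ℂ] A) :
    coords (specOverMap ψ ≫ i.openChart F) =
      graph i.1 ((genericMatrix ℂ).map (ψ.comp (i.toOpenChartRing F))) := by
  rw [openChart, ← Category.assoc, ← specOverMap_comp, coords_specOverMap_chartHom]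

theorem coords_bitangentChart (ψ : i.BitangentRing F →ₐ[ℂ] A) :
    coords (specOverMap ψ ≫ i.bitangentChart F) =
      graph i.1 ((genericMatrix ℂ).map (ψ.comp (i.toBitangentRing F))) := by
  rw [bitangentChart, ← Category.assoc, ← specOverMap_comp, coords_specOverMap_chartHom]

theorem isUnit_coeff_openChart (ψ : i.OpenChartRing F →ₐ[ℂ] A) : IsUnit ((i.form F
    ((genericMatrix ℂ).map (ψ.comp (i.toOpenChartRing F)))).coeff 4) := by
  rw [← map_coeff_form]
  exact (IsLocalization.Away.algebraMap_isUnit ((i.form F (genericMatrix ℂ)).coeff 4)).map ψ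

theorem isUnit_coeff_bitangentChart (ψ : i.BitangentRing F →ₐ[ℂ] A) : IsUnit ((i.form F
    ((genericMatrix ℂ).map (ψ.comp (i.toBitangentRing F)))).coeff 4) := by
  rw [← map_coeff_form]
  exact (i.isUnit_toBitangentRing F).map ψ

theorem eqn_bitangentChart (ψ : i.BitangentRing F →ₐ[ℂ] A) :
    i.eqn F ((genericMatrix ℂ).map (ψ.comp (i.toBitangentRing F))) = 0 := by
  ext j
  rw [← map_eqn, AlgHom.comp_apply, toBitangentRing_eqn, map_zero, Pi.zero_apply]

/-- A morphism to the Grassmannian with image in an open chart factors through the chart. -/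
theorem exists_openChart_eq_of_range_subset (x : specOver A ⟶ grassmannian)
    (h : Set.range x.left ⊆ Set.range (i.openChartLeft F)) :
    ∃ ψ : i.OpenChartRing F →ₐ[ℂ] A, specOverMap ψ ≫ i.openChart F = x := by
  let f := IsOpenImmersion.lift (i.openChartLeft F) x.left h
  have hf : f ≫ (i.openChart F).left = x.left := IsOpenImmersion.lift_fac _ _ _
  obtain ⟨ψ, hψ⟩ := exists_specOverMap_eq (Over.homMk (U := specOver A)
    (V := specOver (i.OpenChartRing F)) f ((congrArg (f ≫ ·) (Over.w (i.openChart F)).symm).trans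
      ((Category.assoc _ _ _).symm.trans ((congrArg (· ≫ _) hf).trans (Over.w x)))))
  refine ⟨ψ, ?_⟩
  rw [hψ]
  ext1
  exact hf

theorem exists_map_genericMatrix (M : Matrix (Fin 2) (Fin 2) A) :
    ∃ φ : ChartRing →ₐ[ℂ] A, (genericMatrix ℂ).map φ = M := by
  refine ⟨MvPolynomial.aeval fun p ↦ M p.1 p.2, ?_⟩
  ext a b
  simp [genericMatrix]

/-- A family of lines that is a graph factors through the open chart if the given point of the line
is nowhere on `X`. -/
theorem exists_openChart_eq {x : specOver A ⟶ grassmannian} {M : Matrix (Fin 2) (Fin 2) A}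
    (hx : coords x = graph i.1 M) (hM : IsUnit ((i.form F M).coeff 4)) :
    ∃ ψ : i.OpenChartRing F →ₐ[ℂ] A, specOverMap ψ ≫ i.openChart F = x ∧
      (genericMatrix ℂ).map (ψ.comp (i.toOpenChartRing F)) = M := by
  obtain ⟨φ, rfl⟩ := exists_map_genericMatrix M
  rw [← map_coeff_form] at hM
  let ψ : i.OpenChartRing F →ₐ[ℂ] A := IsLocalization.liftAlgHom
    (M := Submonoid.powers ((i.form F (genericMatrix ℂ)).coeff 4)) (f := φ) (by
      rintro ⟨_, n, rfl⟩
      simpa using hM.pow n)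
  have hψ : ψ.comp (i.toOpenChartRing F) = φ := by
    ext p
    simp [ψ]
  refine ⟨ψ, coords_injective ?_, by rw [hψ]⟩
  rw [coords_openChart, hψ, hx]

theorem exists_bitangentChart_eq {x : specOver A ⟶ grassmannian} {M : Matrix (Fin 2) (Fin 2) A}
    (hx : coords x = graph i.1 M) (hM : IsUnit ((i.form F M).coeff 4)) (hE : i.eqn F M = 0) :
    ∃ ψ : i.BitangentRing F →ₐ[ℂ] A, specOverMap ψ ≫ i.bitangentChart F = x := by
  obtain ⟨φ, rfl⟩ := exists_map_genericMatrix M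
  rw [← map_coeff_form] at hM
  let χ : i.QuotientRing F →ₐ[ℂ] A := Ideal.Quotient.liftₐ _ φ fun a ha ↦ by
    refine (Ideal.span_le (I := RingHom.ker φ)).mpr ?_ ha
    rintro _ ⟨j, rfl⟩
    exact (i.map_eqn F φ _ j).trans (congrFun hE j)
  let ψ : i.BitangentRing F →ₐ[ℂ] A := IsLocalization.liftAlgHom
    (M := Submonoid.powers (i.leadQ F)) (f := χ) (by
      rintro ⟨_, n, rfl⟩
      have : IsUnit (χ (i.leadQ F)) := hM
      simpa using this.pow n)
  have hψ : ψ.comp (i.toBitangentRing F) = φ := by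
    ext p
    simp only [ψ, toBitangentRing_apply, AlgHom.comp_apply, IsLocalization.liftAlgHom_apply,
      IsLocalization.lift_eq]
    exact Ideal.Quotient.lift_mk _ _ _
  refine ⟨ψ, coords_injective ?_⟩
  rw [coords_bitangentChart, hψ, hx]

end ChartIndex

/-- The disjoint union of the charts of the scheme of bitangents, over the Grassmannian. -/
noncomputable def bitangentCover :
    (∐ fun i : ChartIndex ↦ Spec (CommRingCat.of (i.BitangentRing F))) ⟶ grassmannian.left :=
  Sigma.desc fun i ↦ (i.bitangentChart F).left

theorem sigmaι_comp_bitangentCover (k : ChartIndex) {A : CommRingCat.{0}}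
    (φ : CommRingCat.of (k.BitangentRing F) ⟶ A) :
    Spec.map φ ≫ Sigma.ι (fun k : ChartIndex ↦ Spec (CommRingCat.of (k.BitangentRing F))) k ≫
      bitangentCover F = Spec.map φ ≫ (k.bitangentChart F).left :=
  congrArg (Spec.map φ ≫ ·) (Sigma.ι_desc _ _)

/-- The source is a finite disjoint union of spectra of noetherian rings. Quasi-compactness is what
`imageι_app_eq_zero` requires. -/
instance : QuasiCompact (bitangentCover F) := by
  have : TopologicalSpace.NoetherianSpace
      (∐ fun i : ChartIndex ↦ Spec (CommRingCat.of (i.BitangentRing F)) : Scheme) :=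
    (sigmaSpec fun i : ChartIndex ↦
      CommRingCat.of (i.BitangentRing F)).isOpenEmbedding.isInducing.noetherianSpace
  infer_instance

/-- The scheme of bitangents. -/
noncomputable def bitangentScheme : Over (Spec (CommRingCat.of ℂ)) :=
  Over.mk ((bitangentCover F).imageι ≫ grassmannian.hom)

/-- The embedding of the scheme of bitangents in the Grassmannian. -/
noncomputable def bitangentι : bitangentScheme F ⟶ grassmannian :=
  Over.homMk (bitangentCover F).imageι

instance : IsClosedImmersion (bitangentι F).left :=
  inferInstanceAs (IsClosedImmersion (bitangentCover F).imageι)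

theorem bitangentChart_factors (i : ChartIndex) :
    ∃ y : specOver (i.BitangentRing F) ⟶ bitangentScheme F,
      y ≫ bitangentι F = i.bitangentChart F := by
  have h : (Sigma.ι (fun i : ChartIndex ↦ Spec (CommRingCat.of (i.BitangentRing F))) i ≫
      (bitangentCover F).toImage) ≫ (bitangentCover F).imageι = (i.bitangentChart F).left := by
    rw [Category.assoc, Scheme.Hom.toImage_imageι]
    exact Sigma.ι_desc _ _
  refine ⟨Over.homMk (Sigma.ι (fun i : ChartIndex ↦ Spec (CommRingCat.of (i.BitangentRing F))) i ≫
    (bitangentCover F).toImage) ?_, ?_⟩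
  · exact (Category.assoc _ _ _).symm.trans
      ((congrArg (· ≫ grassmannian.hom) h).trans (Over.w (i.bitangentChart F)))
  · ext1
    exact h

variable {F} (hF : F.IsHomogeneous 4)
include hF

/-- Existence of a quadratic form whose square is proportional to `F` depends on the line alone.
This is why the loci cut out in different charts agree on overlaps. -/
theorem eqn_eq_zero_iff_of_graph_eq {A : Type} [CommRing A] [Algebra ℂ A] {i k : ChartIndex}
    {M M' : Matrix (Fin 2) (Fin 2) A} (h : graph i.1 M = graph k.1 M')
    (hM : IsUnit ((i.form F M).coeff 4)) (hM' : IsUnit ((k.form F M').coeff 4)) :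
    i.eqn F M = 0 ↔ k.eqn F M' = 0 := by
  rw [← i.exists_quadraticForm_iff hF hM, ← k.exists_quadraticForm_iff hF hM', h]

theorem map_eqn_eq_zero {A : Type} [CommRing A] [Algebra ℂ A] {i k : ChartIndex}
    {ψ : i.OpenChartRing F →ₐ[ℂ] A} {ρ : k.BitangentRing F →ₐ[ℂ] A}
    (h : specOverMap ψ ≫ i.openChart F = specOverMap ρ ≫ k.bitangentChart F) (j : Fin 2) :
    ψ (i.toOpenChartRing F (i.eqn F (genericMatrix ℂ) j)) = 0 := by
  have h1 := congrArg coords h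
  rw [ChartIndex.coords_bitangentChart, ChartIndex.coords_openChart] at h1
  have h2 := (eqn_eq_zero_iff_of_graph_eq hF h1 (i.isUnit_coeff_openChart ψ)
    (k.isUnit_coeff_bitangentChart ρ)).mpr (k.eqn_bitangentChart ρ)
  exact (i.map_eqn F (ψ.comp (i.toOpenChartRing F)) _ j).trans (congrFun h2 j)

theorem app_eqn_eq_zero (i k : ChartIndex) (j : Fin 2) {A : Type} [CommRing A] [Algebra ℂ A]
    (ρ : k.BitangentRing F →ₐ[ℂ] A)
    (hρ : Set.range (specOverMap ρ ≫ k.bitangentChart F).left ⊆ Set.range (i.openChartLeft F)) :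
    (specOverMap ρ ≫ k.bitangentChart F).left.app (i.openChartLeft F ''ᵁ ⊤)
      (chartSection (i.openChartLeft F)
        (i.toOpenChartRing F (i.eqn F (genericMatrix ℂ) j))) = 0 := by
  obtain ⟨ψ, hψ⟩ := i.exists_openChart_eq_of_range_subset _ hρ
  have h1 : Spec.map (CommRingCat.ofHom (ψ : i.OpenChartRing F →+* A)) ≫ i.openChartLeft F =
      (specOverMap ρ ≫ k.bitangentChart F).left := congrArg (fun f ↦ f.left) hψ
  have h2 := (app_chartSection_eq_zero_iff (i.openChartLeft F)
    (CommRingCat.ofHom (ψ : i.OpenChartRing F →+* A)) (i.toOpenChartRing F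
      (i.eqn F (genericMatrix ℂ) j))).mpr (map_eqn_eq_zero hF hψ j)
  exact app_eq_zero_of_eq h1 h2

/-- The equations of a chart vanish on the scheme of bitangents. -/
theorem imageι_app_eqn (i : ChartIndex) (j : Fin 2) :
    (bitangentCover F).imageι.app (i.openChartLeft F ''ᵁ ⊤) (chartSection (i.openChartLeft F)
      (i.toOpenChartRing F (i.eqn F (genericMatrix ℂ) j))) = 0 := by
  refine imageι_app_eq_zero _ ((isAffineOpen_top _).image_of_isOpenImmersion _) _ ?_
  refine app_eq_zero_of_sigma _ _ fun k b hb ↦ ?_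
  have hx' := sigmaι_comp_bitangentCover F k
    (CommRingCat.ofHom (algebraMap _ (Localization.Away b)))
  refine app_eq_zero_of_eq hx'.symm (app_eqn_eq_zero hF i k j
    (IsScalarTower.toAlgHom ℂ _ (Localization.Away b)) ?_)
  rw [hx'] at hb
  refine hb.trans ?_
  rintro _ ⟨w, -, hw⟩
  exact ⟨w, hw⟩

/-- A family of lines in a chart factors through the scheme of bitangents if and only if it
satisfies the equations of the chart. -/
theorem factors_iff_eqn {A : Type} [CommRing A] [Algebra ℂ A] (i : ChartIndex)
    {x : specOver A ⟶ grassmannian} {M : Matrix (Fin 2) (Fin 2) A}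
    (hx : coords x = graph i.1 M) (hM : IsUnit ((i.form F M).coeff 4)) :
    (∃ y, y ≫ bitangentι F = x) ↔ i.eqn F M = 0 := by
  constructor
  · rintro ⟨y, rfl⟩
    obtain ⟨ψ, hψ, rfl⟩ := i.exists_openChart_eq hx hM
    ext j
    have h1 := (comp_app_apply y.left (bitangentι F).left (chartSection (i.openChartLeft F)
      (i.toOpenChartRing F (i.eqn F (genericMatrix ℂ) j)))).trans
      ((congrArg _ (imageι_app_eqn hF i j)).trans (map_zero _))
    have h2 : y.left ≫ (bitangentι F).left = Spec.map (CommRingCat.ofHom (ψ : _ →+* A)) ≫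
        (i.openChartLeft F) := (congrArg (fun f ↦ f.left) hψ).symm
    have h3 := (app_chartSection_eq_zero_iff (i.openChartLeft F) _ _).mp (app_eq_zero_of_eq h2 h1)
    rw [← i.map_eqn]
    exact h3
  · intro hE
    obtain ⟨ψ, rfl⟩ := i.exists_bitangentChart_eq hx hM hE
    obtain ⟨y, hy⟩ := bitangentChart_factors F i
    exact ⟨specOverMap ψ ≫ y, by rw [Category.assoc, hy]⟩

end Bitangents

end QuarticBitangents

/-! ### The universal property. -/

namespace QuarticBitangents

section IsBitangentScheme

variable {F : MvPolynomial (Fin 4) ℂ} (hF : F.IsHomogeneous 4) (hL : ContainsNoLine F)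
include hF hL

/-- The universal property of the scheme of bitangents over a local ring. -/
theorem factors_iff_of_isLocalRing {A : Type} [CommRing A] [Algebra ℂ A] [IsLocalRing A]
    (x : specOver A ⟶ grassmannian) : (∃ y, y ≫ bitangentι F = x) ↔
      (∃ v ∈ coords x, IsUnit (MvPolynomial.aeval v F)) ∧
      ∃ (c : Aˣ) (Q : QuadraticForm A (coords x)),
        ∀ v : coords x, MvPolynomial.aeval (v : Fin 4 → A) F = c * Q v ^ 2 := by
  obtain ⟨i, M, hx, hM⟩ := exists_chartIndex hF hL (isLocallyGraph_coords x)
  rw [factors_iff_eqn hF i hx hM, ← i.exists_quadraticForm_iff hF hM]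
  have hx' : coords x = graph i.1 M := hx
  generalize coords x = N at hx'
  subst hx'
  refine (and_iff_right ⟨_, i.dir_mem M, ?_⟩).symm
  rwa [← coeff_four_lineForm hF _ (i.base M)]

theorem factors_localization_iff {A : Type} [CommRing A] [Algebra ℂ A]
    (x : specOver A ⟶ grassmannian) (p : Ideal A) [p.IsPrime] :
    (∃ y, y ≫ bitangentι F = specOverMap (IsScalarTower.toAlgHom ℂ A
        (Localization.AtPrime p)) ≫ x) ↔
      (∃ v ∈ stalkAt (coords x) p, IsUnit (MvPolynomial.aeval v F)) ∧
      ∃ (c : (Localization.AtPrime p)ˣ)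
        (Q : QuadraticForm (Localization.AtPrime p) (stalkAt (coords x) p)),
        ∀ v : stalkAt (coords x) p,
          MvPolynomial.aeval (v : Fin 4 → Localization.AtPrime p) F = c * Q v ^ 2 := by
  have hs : coords (specOverMap (IsScalarTower.toAlgHom ℂ A (Localization.AtPrime p)) ≫ x) =
    stalkAt (coords x) p := coords_specOverMap _ x
  rw [← hs]
  exact factors_iff_of_isLocalRing hF hL _

/-- `IsBitangentFamily` is a condition on the local rings of `A`, and so is factoring through a
closed subscheme; `factors_localization_iff` matches the two at each prime. -/
theorem isBitangentScheme : IsBitangentScheme F pointsIso (bitangentι F) where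
  isClosedImmersion := inferInstance
  factors_iff A x := by
    constructor
    · rintro ⟨y, rfl⟩ p _
      exact (factors_localization_iff hF hL (A := A) _ p).mp
        ⟨specOverMap (IsScalarTower.toAlgHom ℂ A (Localization.AtPrime p)) ≫ y, Category.assoc _ _ _⟩
    · intro h
      obtain ⟨y, hy⟩ := exists_lift_of_forall_localization (A := A) (bitangentι F).left x.left
        fun p _ ↦ by
          obtain ⟨y, hy⟩ := (factors_localization_iff hF hL (A := A) x p).mpr (h p)
          exact ⟨y.left, congrArg (fun f ↦ f.left) hy⟩
      refine ⟨Over.homMk y ?_, Over.OverMorphism.ext hy⟩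
      exact (congrArg (y ≫ ·) (Over.w (bitangentι F)).symm).trans
        ((Category.assoc _ _ _).symm.trans ((congrArg (· ≫ _) hy).trans (Over.w x)))

end IsBitangentScheme

end QuarticBitangents

/-! ### The charts are open in the scheme of bitangents; smoothness. -/

namespace AlgebraicGeometry

open Limits

/-- A morphism to a closed subscheme is the restriction of an affine open chart if it has the
universal property for closed subschemes of the chart. -/
theorem isOpenImmersion_of_factors {S G B : Scheme.{0}} {R : CommRingCat.{0}} (ι : S ⟶ G)
    [IsClosedImmersion ι] (u : Spec R ⟶ G) [IsOpenImmersion u] (b : B ⟶ S) [Mono (b ≫ ι)]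
    (q : B ⟶ Spec R) (hq : b ≫ ι = q ≫ u)
    (h : ∀ (I : Ideal R) (y : Spec (CommRingCat.of (R ⧸ I)) ⟶ S),
      y ≫ ι = Spec.map (CommRingCat.ofHom (Ideal.Quotient.mk I)) ≫ u →
      ∃ z : Spec (CommRingCat.of (R ⧸ I)) ⟶ B,
        z ≫ b ≫ ι = Spec.map (CommRingCat.ofHom (Ideal.Quotient.mk I)) ≫ u) :
    IsOpenImmersion b ∧ ∀ s, ι s ∈ Set.range u → s ∈ Set.range b := by
  -- The part of `S` over the chart is a closed subscheme `Spec (R ⧸ I)`; applying `h` to this `I`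
  -- produces the inverse of the comparison map from `B`.
  obtain ⟨I, e, he⟩ := (IsClosedImmersion.Spec_iff (f := pullback.snd ι u)).mp inferInstance
  obtain ⟨z, hz⟩ := h I (e.inv ≫ pullback.fst ι u) (by
    rw [Category.assoc, pullback.condition, he, Category.assoc, Iso.inv_hom_id_assoc])
  have hb : (e.hom ≫ z) ≫ b = pullback.fst ι u := by
    rw [← cancel_mono ι, Category.assoc, Category.assoc, hz, pullback.condition, he,
      Category.assoc]
  let f : B ⟶ pullback ι u := pullback.lift b q hq
  have hf : f ≫ pullback.fst ι u = b := pullback.lift_fst _ _ _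
  have h1 : f ≫ e.hom ≫ z = 𝟙 B := by
    rw [← cancel_mono (b ≫ ι), ← Category.assoc _ b ι, Category.assoc f, hb, hf, Category.id_comp]
  have h2 : (e.hom ≫ z) ≫ f = 𝟙 (pullback ι u) := by
    rw [← cancel_mono (pullback.fst ι u), Category.assoc, hf, hb, Category.id_comp]
  have : IsIso f := ⟨_, h1, h2⟩
  refine ⟨hf ▸ inferInstance, ?_⟩
  rintro s ⟨t, ht⟩
  obtain ⟨p, rfl, -⟩ := Scheme.Pullback.exists_preimage_pullback s t ht.symm
  exact ⟨(e.hom ≫ z) p, congr($hb p)⟩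

end AlgebraicGeometry

namespace QuarticBitangents

section Smooth

variable {F : MvPolynomial (Fin 4) ℂ}

instance (i : ChartIndex) : Mono (i.bitangentChart F).left := by
  let r : Spec (CommRingCat.of (i.BitangentRing F)) ⟶ Spec (CommRingCat.of (i.QuotientRing F)) :=
    Spec.map (CommRingCat.ofHom (algebraMap (i.QuotientRing F) (Localization.Away (i.leadQ F))))
  let s : Spec (CommRingCat.of (i.QuotientRing F)) ⟶ Spec (CommRingCat.of ChartRing) :=
    Spec.map (CommRingCat.ofHom (Ideal.Quotient.mk _))
  have : IsClosedImmersion s := IsClosedImmersion.spec_of_surjective _ Ideal.Quotient.mk_surjective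
  let u : Spec (CommRingCat.of ChartRing) ⟶ grassmannian.left := (chartHom i.1).left
  have : IsOpenImmersion u := inferInstanceAs (IsOpenImmersion (chartHom i.1).left)
  have h : (i.bitangentChart F).left = (r ≫ s) ≫ u :=
    congrArg (· ≫ u) (Spec.map_comp (CommRingCat.ofHom (Ideal.Quotient.mk _))
      (CommRingCat.ofHom (algebraMap (i.QuotientRing F) (Localization.Away (i.leadQ F)))))
  rw [h]
  have : IsOpenImmersion r := inferInstanceAs (IsOpenImmersion (Spec.map (CommRingCat.ofHom
    (algebraMap (i.QuotientRing F) (Localization.Away (i.leadQ F))))))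
  have h1 : Mono r := inferInstance
  have h2 : Mono s := inferInstance
  have h3 : Mono u := inferInstance
  exact @mono_comp _ _ _ _ _ (r ≫ s) (@mono_comp _ _ _ _ _ r h1 s h2) u h3

variable (hF : F.IsHomogeneous 4) (hL : ContainsNoLine F)

-- Apply `exists_chartIndex` to the family over the local ring of the Grassmannian at the point, and
-- take the image of the closed point.
include hF hL in
theorem openChartLeft_jointly_surjective (x : grassmannian.left) :
    ∃ i : ChartIndex, x ∈ Set.range (i.openChartLeft F) := by
  obtain ⟨σ, (p : PrimeSpectrum ChartRing), rfl⟩ := chartHom_jointly_surjective x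
  let φ : ChartRing →ₐ[ℂ] Localization.AtPrime p.asIdeal := IsScalarTower.toAlgHom ℂ _ _
  obtain ⟨i, M, hx, hM⟩ := exists_chartIndex hF hL
    (isLocallyGraph_coords (specOverMap φ ≫ chartHom σ))
  obtain ⟨ψ, hψ, -⟩ := i.exists_openChart_eq hx hM
  have hp : p ∈ Set.range (PrimeSpectrum.comap
      (algebraMap ChartRing (Localization.AtPrime p.asIdeal))) := by
    rw [PrimeSpectrum.localization_comap_range _ p.asIdeal.primeCompl]
    exact Set.disjoint_left.mpr fun a ha ha' ↦ ha ha'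
  obtain ⟨z, hz⟩ := hp
  refine ⟨i, (specOverMap ψ).left z, ?_⟩
  exact (congr($(congrArg Over.Hom.left hψ) z)).trans (congrArg (chartHom σ).left hz)

-- By `factors_iff_eqn`, a closed subscheme of the open chart maps to `S` only if the equations
-- vanish on it, and then it factors through the chart of bitangents.
include hF in
theorem isOpenImmersion_bitangentChart (i : ChartIndex)
    (y : specOver (i.BitangentRing F) ⟶ bitangentScheme F)
    (hy : y ≫ bitangentι F = i.bitangentChart F) :
    IsOpenImmersion y.left ∧ ∀ s, (bitangentι F).left s ∈ Set.range (i.openChartLeft F) →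
      s ∈ Set.range y.left := by
  have hy' : y.left ≫ (bitangentι F).left = (i.bitangentChart F).left :=
    congrArg (fun f ↦ f.left) hy
  have : Mono (y.left ≫ (bitangentι F).left) := hy' ▸ inferInstance
  obtain ⟨q, hq, -⟩ := i.exists_openChart_eq
    ((congrArg coords (Category.id_comp (i.bitangentChart F)).symm).trans
      (congrArg (fun f ↦ coords (f ≫ i.bitangentChart F))
        ((algSpec (CommRingCat.of ℂ)).map_id _).symm) |>.trans
      (i.coords_bitangentChart (AlgHom.id ℂ _))) (i.isUnit_coeff_bitangentChart _)
  refine isOpenImmersion_of_factors (bitangentι F).left (i.openChartLeft F) y.left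
    (specOverMap q).left (hy'.trans (congrArg (fun f ↦ f.left) hq).symm) fun I w hw ↦ ?_
  let ψ : i.OpenChartRing F →ₐ[ℂ] i.OpenChartRing F ⧸ I := Ideal.Quotient.mkₐ ℂ I
  have hE := (factors_iff_eqn hF i (i.coords_openChart ψ) (i.isUnit_coeff_openChart ψ)).mp
    ⟨Over.homMk (U := specOver (i.OpenChartRing F ⧸ I)) w
      ((congrArg (w ≫ ·) (Over.w (bitangentι F)).symm).trans
        ((Category.assoc _ _ _).symm.trans ((congrArg (· ≫ _) hw).trans
          (Over.w (specOverMap ψ ≫ i.openChart F))))), Over.OverMorphism.ext hw⟩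
  obtain ⟨z, hz⟩ := i.exists_bitangentChart_eq (i.coords_openChart ψ)
    (i.isUnit_coeff_openChart ψ) hE
  exact ⟨(specOverMap z).left, (congrArg ((specOverMap z).left ≫ ·) hy').trans
    (congrArg (fun f ↦ f.left) hz)⟩

theorem smoothOfRelativeDimension_bitangentScheme (hF : IsSmoothQuartic F)
    (hL : ContainsNoLine F) : SmoothOfRelativeDimension 2 (bitangentScheme F).hom := by
  choose y hy using bitangentChart_factors F
  have hopen i := isOpenImmersion_bitangentChart hF.isHomogeneous i (y i) (hy i)
  let 𝒰 : (bitangentScheme F).left.OpenCover :=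
    Scheme.Cover.mkOfCovers ChartIndex (fun i ↦ (specOver (i.BitangentRing F)).left)
      (fun i ↦ (y i).left) (fun s ↦ by
        obtain ⟨i, hi⟩ := openChartLeft_jointly_surjective hF.isHomogeneous hL
          ((bitangentι F).left s)
        exact ⟨i, (hopen i).2 s hi⟩) fun i ↦ (hopen i).1
  have : IsZariskiLocalAtSource (@SmoothOfRelativeDimension.{0} 2) :=
    HasRingHomProperty.instIsZariskiLocalAtSource
  refine IsZariskiLocalAtSource.of_openCover 𝒰 fun (i : ChartIndex) ↦ ?_
  have h : 𝒰.f i ≫ (bitangentScheme F).hom =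
      Spec.map (CommRingCat.ofHom (algebraMap ℂ (i.BitangentRing F))) := Over.w (y i)
  rw [h]
  exact (HasRingHomProperty.Spec_iff (P := @SmoothOfRelativeDimension.{0} 2)).mpr
    (i.locally_isStandardSmooth hF)

end Smooth

end QuarticBitangents

/-! ### Complex points: quartics all of whose roots are multiple. -/

namespace QuarticBitangents

section ComplexLines

open Polynomial

theorem exists_quartic_root {a : ℕ → ℂ} (h4 : a 4 ≠ 0) :
    ∃ x, a 4 * x ^ 4 + a 3 * x ^ 3 + a 2 * x ^ 2 + a 1 * x + a 0 = 0 := by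
  have hd : (C (a 4) * X ^ 4 + C (a 3) * X ^ 3 + C (a 2) * X ^ 2 + C (a 1) * X +
      C (a 0)).degree = 4 := by
    compute_degree!
  obtain ⟨x, hx⟩ := IsAlgClosed.exists_root _ (hd.trans_ne (by norm_num))
  exact ⟨x, by simpa using hx⟩

theorem exists_quadratic_factor {a b c : ℂ} (ha : a ≠ 0) :
    ∃ p q, b = -(a * (p + q)) ∧ c = a * p * q := by
  have hd : (C a * X ^ 2 + C b * X + C c).degree = 2 := degree_quadratic ha
  obtain ⟨p, hp⟩ := IsAlgClosed.exists_root _ (hd.trans_ne (by norm_num))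
  have hp' : a * p ^ 2 + b * p + c = 0 := by simpa using hp
  refine ⟨p, -(b / a) - p, ?_, ?_⟩
  · field_simp
    ring
  · field_simp
    linear_combination hp'

/-- A complex quartic polynomial all of whose roots are multiple is a constant times a square. -/
theorem squareEqn_eq_zero_of_multiple_roots {a : ℕ → ℂ} (h4 : a 4 ≠ 0)
    (h : ∀ x, a 4 * x ^ 4 + a 3 * x ^ 3 + a 2 * x ^ 2 + a 1 * x + a 0 = 0 →
      4 * a 4 * x ^ 3 + 3 * a 3 * x ^ 2 + 2 * a 2 * x + a 1 = 0) : squareEqn a = 0 := by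
  obtain ⟨r, hr⟩ := exists_quartic_root h4
  have hr' := h r hr
  -- The coefficients are those of the quotient of the quartic by `(X - r)²`, which factors as `a₄(X
  -- - p)(X - q)`.
  obtain ⟨p, q, hp, hq⟩ := exists_quadratic_factor (b := a 3 + 2 * r * a 4)
    (c := a 2 + 2 * r * a 3 + 3 * r ^ 2 * a 4) h4
  have e3 : a 3 = -(a 4 * (p + q)) - 2 * r * a 4 := by linear_combination hp
  have e2 : a 2 = a 4 * p * q - 2 * r * a 3 - 3 * r ^ 2 * a 4 := by linear_combination hq
  have e1 : a 1 = -(4 * a 4 * r ^ 3 + 3 * a 3 * r ^ 2 + 2 * a 2 * r) := by linear_combination hr'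
  have e0 : a 0 = -(a 4 * r ^ 4 + a 3 * r ^ 3 + a 2 * r ^ 2 + a 1 * r) := by linear_combination hr
  -- If `p ≠ q`, each is a simple root of the quotient; being a multiple root of the quartic, it
  -- must equal `r`, so `p = q` after all.
  have hpq : p = q := by
    by_contra hne
    have hne' : p - q ≠ 0 := sub_ne_zero.mpr hne
    have hp : p = r := by
      have h1 := h p (by rw [e0, e1, e2, e3]; ring)
      have h2 : a 4 * (p - q) * (p - r) ^ 2 = 0 := by
        rw [e1, e2, e3] at h1
        linear_combination h1
      simpa [h4, hne', sub_eq_zero] using h2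
    have hq : q = r := by
      have h1 := h q (by rw [e0, e1, e2, e3]; ring)
      have h2 : a 4 * (p - q) * (q - r) ^ 2 = 0 := by
        rw [e1, e2, e3] at h1
        linear_combination -h1
      simpa [h4, hne', sub_eq_zero] using h2
    exact hne (hp.trans hq.symm)
  subst hpq
  refine squareEqn_eq_zero_of_eq (c := a 4) (α := 1) (β := -(p + r)) (γ := p * r)
    (by ring) ?_ ?_ ?_ ?_
  · rw [e3]
    ring
  · rw [e2, e3]
    ring
  · rw [e1, e2, e3]
    ring
  · rw [e0, e1, e2, e3]
    ring

variable {F : MvPolynomial (Fin 4) ℂ}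

theorem derivative_lineForm_eval (v w : Fin 4 → ℂ) (s : ℂ) :
    (derivative (lineForm F v w)).eval s =
      ∑ l, v l * MvPolynomial.eval (s • v + w) (MvPolynomial.pderiv l F) := by
  rw [derivative_lineForm, eval_finsetSum]
  refine Finset.sum_congr rfl fun l _ ↦ ?_
  rw [eval_mul, eval_C, eval_lineForm, mul_comm]
  rfl

/-- If the restrictions of `F` to parametrised lines are constants times squares, then all zeros
of `F` on the line are multiple. -/
theorem derivative_eq_zero_of_lineForm_eq {z w : Fin 4 → ℂ} {c : ℂ} {R : ℂ[X]}
    (h : lineForm F w z = C c * R ^ 2) (hz : MvPolynomial.eval z F = 0) :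
    ∑ l, w l * MvPolynomial.eval z (MvPolynomial.pderiv l F) = 0 := by
  have h0 : (lineForm F w z).eval 0 = 0 := by
    rw [eval_lineForm, zero_smul, zero_add]
    exact hz
  have h1 := derivative_lineForm_eval (F := F) w z 0
  rw [zero_smul, zero_add] at h1
  rw [← h1, h]
  rw [h] at h0
  rcases mul_eq_zero.mp ((eval_mul).symm.trans h0) with hc | hR
  · rw [eval_C] at hc
    simp [hc]
  · rw [eval_pow, sq_eq_zero_iff] at hR
    simp [derivative_pow, hR]

theorem isBitangentLine_of_quadraticForm {L : Submodule ℂ (Fin 4 → ℂ)}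
    (hL : ∃ v ∈ L, IsUnit (MvPolynomial.aeval v F)) (c : ℂˣ) (Q : QuadraticForm ℂ L)
    (hQ : ∀ v : L, MvPolynomial.aeval (v : Fin 4 → ℂ) F = c * Q v ^ 2) : IsBitangentLine F L := by
  refine ⟨hL.imp fun v hv ↦ ⟨hv.1, hv.2.ne_zero⟩, fun z hz _ hz0 w hw ↦ ?_⟩
  let z' : L := ⟨z, hz⟩
  let w' : L := ⟨w, hw⟩
  refine derivative_eq_zero_of_lineForm_eq (c := c)
    (R := C (Q w') * X ^ 2 + C (QuadraticMap.polar Q w' z') * X + C (Q z')) ?_ hz0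
  refine Polynomial.funext fun x ↦ ?_
  have h1 := hQ (x • w' + z')
  rw [QuadraticMap.map_add Q, QuadraticMap.map_smul, QuadraticMap.polar_smul_left] at h1
  rw [eval_lineForm]
  refine h1.trans ?_
  simp only [smul_eq_mul, eval_mul, eval_C, eval_pow, eval_add, eval_X]
  ring

variable (hF : F.IsHomogeneous 4)
include hF

theorem ChartIndex.eqn_eq_zero_of_isBitangentLine (i : ChartIndex) {M : Matrix (Fin 2) (Fin 2) ℂ}
    (hM : (i.form F M).coeff 4 ≠ 0) (h : IsBitangentLine F (graph i.1 M)) : i.eqn F M = 0 := by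
  refine squareEqn_eq_zero_of_multiple_roots hM fun x hx ↦ ?_
  have hf := lineForm_eq hF (i.dir M) (i.base M)
  have h1 : (i.form F M).eval x = 0 := by
    refine (congrArg (Polynomial.eval x) hf).trans (Eq.trans ?_ hx)
    simp only [eval_add, eval_mul, eval_C, eval_pow, eval_X]
    rfl
  have h2 : (derivative (i.form F M)).eval x = 0 := by
    refine (derivative_lineForm_eval _ _ _).trans (h.2 _ (add_mem (Submodule.smul_mem _ _
      (i.dir_mem M)) (i.base_mem M)) ?_ ?_ _ (i.dir_mem M))
    · intro h0
      have e0 := congrFun h0 (i.1 (Sum.inl 0))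
      have e1 := congrFun h0 (i.1 (Sum.inl 1))
      simp [ChartIndex.dir, ChartIndex.base] at e0 e1
      simp [e0] at e1
    · exact (eval_lineForm F _ _ _).symm.trans h1
  refine Eq.trans ?_ ((congrArg (fun p ↦ Polynomial.eval x (derivative p)) hf).symm.trans h2)
  simp
  change _ = (i.form F M).coeff 4 * _ + (i.form F M).coeff 3 * _ + (i.form F M).coeff 2 * _ +
    (i.form F M).coeff 1
  ring

/-- The complex points of the scheme of bitangents. -/
theorem factors_iff_isBitangentLine (hL : ContainsNoLine F) (x : specOver ℂ ⟶ grassmannian) :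
    (∃ y, y ≫ bitangentι F = x) ↔ IsBitangentLine F (coords x) := by
  constructor
  · intro h
    obtain ⟨h1, c, Q, hQ⟩ := (factors_iff_of_isLocalRing hF hL x).mp h
    exact isBitangentLine_of_quadraticForm h1 c Q hQ
  · intro h
    obtain ⟨i, M, hx, hM⟩ := exists_chartIndex hF hL (isLocallyGraph_coords x)
    refine (factors_iff_eqn hF i hx hM).mpr
      (i.eqn_eq_zero_of_isBitangentLine hF hM.ne_zero ?_)
    have hx' : coords x = graph i.1 M := hx
    rwa [hx'] at h

end ComplexLines

end QuarticBitangents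

/-! ### Existence of a bitangent. -/

namespace QuarticBitangents

section Existence

open Polynomial

/-- A homogeneous polynomial function of positive degree on a plane has a nontrivial zero. -/
theorem exists_zero_of_homogeneous {V : Type} [AddCommGroup V] [Module ℂ V] (D : V → ℂ) {n : ℕ}
    (hn : n ≠ 0) (hD : ∀ (t : ℂ) u, D (t • u) = t ^ n * D u)
    (hP : ∀ a b, ∃ P : ℂ[X], ∀ x, P.eval x = D (x • a + b)) (e f : V) :
    ∃ s t : ℂ, (s ≠ 0 ∨ t ≠ 0) ∧ D (s • e + t • f) = 0 := by
  by_contra! hne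
  obtain ⟨P, hPe⟩ := hP e f
  obtain ⟨P', hPf⟩ := hP f e
  -- Without zeros, `x ↦ D(x e + f)` is a polynomial without roots, hence constant. By homogeneity
  -- `D(x f + e)` is then a multiple of `xⁿ`, which gives `D e = 0` at `x = 0`.
  have hroot x : ¬ P.IsRoot x := fun hx ↦ by
    refine hne x 1 (Or.inr one_ne_zero) ?_
    rw [one_smul, ← hPe]
    exact hx
  have hdeg : P.degree = 0 := by
    by_contra hd
    obtain ⟨x, hx⟩ := IsAlgClosed.exists_root P hd
    exact hroot x hx
  rw [eq_C_of_degree_eq_zero hdeg] at hPe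
  have h : P' = C (P.coeff 0) * X ^ n := by
    refine eq_of_infinite_eval_eq _ _ ((Set.finite_singleton (0 : ℂ)).infinite_compl.mono ?_)
    intro x (hx : x ≠ 0)
    have h1 := hPe x⁻¹
    have h2 : x • f + e = x • (x⁻¹ • e + f) := by
      rw [smul_add, smul_smul, mul_inv_cancel₀ hx, one_smul, add_comm]
    rw [eval_C] at h1
    rw [Set.mem_ofPred_eq, hPf, h2, hD, ← h1, eval_mul, eval_C, eval_pow, eval_X, mul_comm]
  refine hne 1 0 (Or.inl one_ne_zero) ?_
  have h1 := hPf 0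
  rw [h, eval_mul, eval_pow, eval_X, zero_pow hn, mul_zero] at h1
  rw [one_smul, zero_smul, add_zero]
  rw [zero_smul, zero_add] at h1
  exact h1.symm

/-- With `ℓ` the differential of `F` at a point `p` of the surface, its kernel contains the cone
over a plane of tangent lines at `p`; `e` and `f` span a pencil of directions modulo `p`. -/
theorem exists_linearIndependent_mem_ker (ℓ : (Fin 4 → ℂ) →ₗ[ℂ] ℂ) {p : Fin 4 → ℂ} (hp : p ≠ 0)
    (hℓ : ℓ p = 0) : ∃ e f, ℓ e = 0 ∧ ℓ f = 0 ∧ LinearIndependent ℂ ![f, e, p] := by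
  have hker : 3 ≤ Module.finrank ℂ ℓ.ker := by
    have h1 := ℓ.finrank_range_add_finrank_ker
    have h2 : Module.finrank ℂ ℓ.range ≤ 1 :=
      (Submodule.finrank_le _).trans (Module.finrank_self ℂ).le
    rw [Module.finrank_fin_fun] at h1
    omega
  let p' : ℓ.ker := ⟨p, hℓ⟩
  have h1 : LinearIndependent ℂ ![p'] := by
    rw [linearIndependent_unique_iff]
    exact fun h ↦ hp (congrArg Subtype.val h)
  obtain ⟨e, he⟩ := exists_linearIndependent_cons_of_lt_finrank h1 (by omega)
  obtain ⟨f, hf⟩ := exists_linearIndependent_cons_of_lt_finrank he (by omega)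
  refine ⟨e, f, e.2, f.2, ?_⟩
  have h2 := hf.map' ℓ.ker.subtype (Submodule.ker_subtype _)
  have h3 : ℓ.ker.subtype ∘ (Fin.cons f (Fin.cons e ![p'] : Fin 2 → ℓ.ker) : Fin 3 → ℓ.ker) =
      ![f.1, e.1, p] := by
    ext i : 1
    fin_cases i <;> rfl
  exact h3 ▸ h2

variable {F : MvPolynomial (Fin 4) ℂ} (hF : F.IsHomogeneous 4)

theorem exists_linearMap_eq_sum_pderiv (p : Fin 4 → ℂ) : ∃ ℓ : (Fin 4 → ℂ) →ₗ[ℂ] ℂ, ∀ w,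
    ℓ w = ∑ l, w l * MvPolynomial.eval p (MvPolynomial.pderiv l F) :=
  ⟨Fintype.linearCombination ℂ fun l ↦ MvPolynomial.eval p (MvPolynomial.pderiv l F), fun w ↦ by
    simp [Fintype.linearCombination_apply]⟩

theorem coeff_lineForm_smul (t : ℂ) (u p : Fin 4 → ℂ) (k : ℕ) :
    (lineForm F (t • u) p).coeff k = t ^ k * (lineForm F u p).coeff k := by
  have h : lineForm F (t • u) p = (lineForm F u p).comp (C t * X) := by
    refine Polynomial.funext fun x ↦ ?_
    rw [eval_comp, eval_lineForm, eval_lineForm, eval_mul, eval_C, eval_X, smul_smul, mul_comm]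
  rw [h, comp_C_mul_X_coeff, mul_comm]

theorem exists_eval_eq_coeff_lineForm (a b p : Fin 4 → ℂ) (k : ℕ) :
    ∃ P : ℂ[X], ∀ x, P.eval x = (lineForm F (x • a + b) p).coeff k := by
  refine ⟨(lineForm F (fun i ↦ C (a i) * X + C (b i)) (fun i ↦ C (p i))).coeff k, fun x ↦ ?_⟩
  have h := congrArg (fun P ↦ Polynomial.coeff P k) (lineForm_map F (Polynomial.aeval (R := ℂ) x)
    (fun i ↦ C (a i) * X + C (b i)) (fun i ↦ C (p i)))
  simp only [coeff_map, RingHom.coe_coe] at h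
  refine Eq.trans ?_ (h.trans ?_)
  · rw [coe_aeval_eq_eval]
  · congr 2
    · ext i
      simp only [coe_aeval_eq_eval, eval_add, eval_mul, eval_C, eval_X, Pi.add_apply,
        Pi.smul_apply, smul_eq_mul, mul_comm]
    · ext i
      simp only [coe_aeval_eq_eval, eval_C]

theorem coeff_zero_lineForm (u p : Fin 4 → ℂ) :
    (lineForm F u p).coeff 0 = MvPolynomial.eval p F := by
  rw [coeff_zero_eq_eval_zero, eval_lineForm, zero_smul, zero_add]
  rfl

theorem coeff_one_lineForm (u p : Fin 4 → ℂ) : (lineForm F u p).coeff 1 =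
    ∑ l, u l * MvPolynomial.eval p (MvPolynomial.pderiv l F) := by
  have h := derivative_lineForm_eval (F := F) u p 0
  rw [zero_smul, zero_add] at h
  rw [← h, ← coeff_zero_eq_eval_zero, coeff_derivative]
  simp

include hF

theorem sum_mul_eval_pderiv (p : Fin 4 → ℂ) :
    ∑ l, p l * MvPolynomial.eval p (MvPolynomial.pderiv l F) = 4 * MvPolynomial.eval p F := by
  simpa using congrArg (MvPolynomial.eval p) hF.sum_X_mul_pderiv

theorem exists_ne_zero_eval_eq_zero : ∃ p : Fin 4 → ℂ, p ≠ 0 ∧ MvPolynomial.eval p F = 0 := by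
  let e : Fin 4 → ℂ := Pi.single 0 1
  let f : Fin 4 → ℂ := Pi.single 1 1
  by_cases h : MvPolynomial.eval e F = 0
  · exact ⟨e, fun h0 ↦ one_ne_zero (α := ℂ) (by simpa [e] using congrFun h0 0), h⟩
  · obtain ⟨s, hs⟩ := exists_quartic_root (a := (lineForm F e f).coeff)
      (by rwa [coeff_four_lineForm hF])
    refine ⟨s • e + (1 : ℂ) • f, fun h0 ↦ one_ne_zero (α := ℂ) (by
      simpa [e, f] using congrFun h0 1), ?_⟩
    refine (aeval_smul_add_smul hF e f s 1).trans (Eq.trans ?_ hs)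
    ring

/-- A line through a point `p` of `X`, tangent at `p`, and such that the residual intersection is
nonreduced. -/
theorem isBitangentLine_span {u p : Fin 4 → ℂ} (h0 : (lineForm F u p).coeff 0 = 0)
    (h1 : (lineForm F u p).coeff 1 = 0)
    (hd : (lineForm F u p).coeff 3 ^ 2 = 4 * (lineForm F u p).coeff 4 * (lineForm F u p).coeff 2)
    (hL : ∃ v ∈ Submodule.span ℂ {u, p}, MvPolynomial.eval v F ≠ 0) :
    IsBitangentLine F (Submodule.span ℂ {u, p}) := by
  refine ⟨hL, fun z hz _ hz0 w hw ↦ ?_⟩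
  obtain ⟨s, t, rfl⟩ := Submodule.mem_span_pair.mp hz
  obtain ⟨s', t', rfl⟩ := Submodule.mem_span_pair.mp hw
  let S : ℂ[X] := C s' * X + C s
  let T : ℂ[X] := C t' * X + C t
  have h : lineForm F (s' • u + t' • p) (s • u + t • p) =
      S ^ 2 * (C ((lineForm F u p).coeff 4) * S ^ 2 + C ((lineForm F u p).coeff 3) * S * T +
        C ((lineForm F u p).coeff 2) * T ^ 2) := by
    refine Polynomial.funext fun x ↦ ?_
    have e : x • (s' • u + t' • p) + (s • u + t • p) = (s' * x + s) • u + (t' * x + t) • p := by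
      module
    rw [eval_lineForm, e, aeval_smul_add_smul hF, h0, h1]
    simp only [S, T, eval_mul, eval_pow, eval_add, eval_C, eval_X]
    ring
  -- The residual quadric has zero discriminant. If its leading coefficient vanishes it is a
  -- multiple of `T²`; otherwise it is a multiple of `(S + bT)²`.
  by_cases h4 : (lineForm F u p).coeff 4 = 0
  · have h3 : (lineForm F u p).coeff 3 = 0 := by simpa [h4] using hd
    refine derivative_eq_zero_of_lineForm_eq (c := (lineForm F u p).coeff 2) (R := S * T) ?_ hz0
    rw [h, h3, h4, C_0]
    ring
  · obtain ⟨b, hb⟩ : ∃ b, (lineForm F u p).coeff 3 = 2 * (lineForm F u p).coeff 4 * b :=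
      ⟨(lineForm F u p).coeff 3 / (2 * (lineForm F u p).coeff 4), by field_simp⟩
    have h2 : (lineForm F u p).coeff 2 = (lineForm F u p).coeff 4 * b ^ 2 := by
      rw [hb] at hd
      refine mul_left_cancel₀ (mul_ne_zero (by norm_num : (4 : ℂ) ≠ 0) h4) ?_
      linear_combination -hd
    refine derivative_eq_zero_of_lineForm_eq (c := (lineForm F u p).coeff 4)
      (R := S * (S + C b * T)) ?_ hz0
    rw [h, h2, hb]
    simp only [C_mul, C_pow, C_ofNat]
    ring

/-- A smooth quartic surface has a bitangent. -/
theorem exists_isBitangentLine (hL : ContainsNoLine F) :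
    ∃ L : Submodule ℂ (Fin 4 → ℂ), Module.finrank ℂ L = 2 ∧ IsBitangentLine F L := by
  obtain ⟨p, hp, hp0⟩ := exists_ne_zero_eval_eq_zero hF
  obtain ⟨ℓ, hℓ⟩ := exists_linearMap_eq_sum_pderiv (F := F) p
  obtain ⟨e, f, he, hf, hli⟩ := exists_linearIndependent_mem_ker ℓ hp (by
    rw [hℓ, sum_mul_eval_pderiv hF, hp0, mul_zero])
  let c (k : ℕ) (u : Fin 4 → ℂ) : ℂ := (lineForm F u p).coeff k
  -- The discriminant of the residual quadric; as `c k` is homogeneous of degree `k` in `u`, it has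
  -- degree 6.
  obtain ⟨s, t, hst, hD⟩ := exists_zero_of_homogeneous
    (fun u ↦ c 3 u ^ 2 - 4 * c 4 u * c 2 u) (n := 6) (by norm_num) (fun t u ↦ by
      simp only [c, coeff_lineForm_smul]
      ring) (fun a b ↦ by
      obtain ⟨P2, h2⟩ := exists_eval_eq_coeff_lineForm (F := F) a b p 2
      obtain ⟨P3, h3⟩ := exists_eval_eq_coeff_lineForm (F := F) a b p 3
      obtain ⟨P4, h4⟩ := exists_eval_eq_coeff_lineForm (F := F) a b p 4
      exact ⟨P3 ^ 2 - 4 * P4 * P2, fun x ↦ by simp [c, ← h2, ← h3, ← h4]⟩) e f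
  let u := s • e + t • f
  have hli' : LinearIndependent ℂ ![u, p] := by
    refine LinearIndependent.pair_iff.mpr fun a b hab ↦ ?_
    have h1 := Fintype.linearIndependent_iff.mp hli ![a * t, a * s, b] (by
      rw [Fin.sum_univ_three, ← hab]
      change (a * t) • f + (a * s) • e + b • p = a • (s • e + t • f) + b • p
      module)
    have e0 : a * t = 0 := h1 0
    have e1 : a * s = 0 := h1 1
    exact ⟨hst.elim (fun hs ↦ (mul_eq_zero.mp e1).resolve_right hs)
      (fun ht ↦ (mul_eq_zero.mp e0).resolve_right ht), h1 2⟩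
  have hfin : Module.finrank ℂ (Submodule.span ℂ {u, p}) = 2 := by
    have h1 := finrank_span_eq_card hli'
    rwa [Matrix.range_cons, Matrix.range_cons, Matrix.range_empty, Set.union_empty,
      Set.singleton_union, Fintype.card_fin] at h1
  refine ⟨_, hfin, isBitangentLine_span hF ?_ ?_ ?_ (hL _ hfin)⟩
  · rw [coeff_zero_lineForm, hp0]
  · rw [coeff_one_lineForm, ← hℓ, map_add, map_smul, map_smul, he, hf, smul_zero, smul_zero,
      add_zero]
  · exact sub_eq_zero.mp hD

end Existence

theorem exists_coords_eq {L : Submodule ℂ (Fin 4 → ℂ)} (hL : Module.finrank ℂ L = 2) :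
    ∃ x : specOver ℂ ⟶ grassmannian, coords x = L := by
  have hq : Module.finrank ℂ ((Fin 4 → ℂ) ⧸ L) = 2 := by
    have h := L.finrank_quotient_add_finrank
    rw [hL, Module.finrank_fin_fun] at h
    omega
  have h : IsLocallyGraph L := isLocallyGraph_of_projective L fun p ↦ by
    rw [Module.rankAtStalk_eq_finrank_of_free]
    exact hq
  refine ⟨pointsIso.inv.app (CommAlgCat.of ℂ ℂ) (lineOfIsLocallyGraph (A := CommAlgCat.of ℂ ℂ) L h),
    ?_⟩
  refine (congrArg lineInCoordinates ?_).trans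
    (lineInCoordinates_lineOfIsLocallyGraph (A := CommAlgCat.of ℂ ℂ) L h)
  exact congr($(pointsIso.inv_hom_id_app (CommAlgCat.of ℂ ℂ)) _)

theorem nonempty_bitangentScheme {F : MvPolynomial (Fin 4) ℂ} (hF : F.IsHomogeneous 4)
    (hL : ContainsNoLine F) : Nonempty (bitangentScheme F).left := by
  obtain ⟨L, hL2, hb⟩ := exists_isBitangentLine hF hL
  obtain ⟨x, rfl⟩ := exists_coords_eq hL2
  obtain ⟨y, -⟩ := (factors_iff_isBitangentLine hF hL x).mpr hb
  exact ⟨y.left (⊥ : PrimeSpectrum ℂ)⟩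

end QuarticBitangents

theorem mainTheorem3 (F : MvPolynomial (Fin 4) ℂ)
    (hF : QuarticBitangents.IsSmoothQuartic F) (hL : QuarticBitangents.ContainsNoLine F) :
    ∃ (G : Over (Spec (CommRingCat.of ℂ)))
      (e : QuarticBitangents.pointsFunctor G ≅ QuarticBitangents.linesFunctor)
      (S : Over (Spec (CommRingCat.of ℂ))) (ι : S ⟶ G),
      QuarticBitangents.IsBitangentScheme F e ι ∧
      (∀ x : (algSpec (CommRingCat.of ℂ)).obj (op (CommAlgCat.of ℂ ℂ)) ⟶ G,
        (∃ y : (algSpec (CommRingCat.of ℂ)).obj (op (CommAlgCat.of ℂ ℂ)) ⟶ S, y ≫ ι = x) ↔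
        QuarticBitangents.IsBitangentLine F
          (QuarticBitangents.lineInCoordinates (e.hom.app _ x))) ∧
      Nonempty S.left ∧
      SmoothOfRelativeDimension 2 S.hom :=
  ⟨QuarticBitangents.grassmannian, QuarticBitangents.pointsIso, QuarticBitangents.bitangentScheme F,
    QuarticBitangents.bitangentι F, QuarticBitangents.isBitangentScheme hF.isHomogeneous hL,
    QuarticBitangents.factors_iff_isBitangentLine hF.isHomogeneous hL,
    QuarticBitangents.nonempty_bitangentScheme hF.isHomogeneous hL,
    QuarticBitangents.smoothOfRelativeDimension_bitangentScheme hF hL⟩
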